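/- Let $M>0$, $0<|a|<M$, $\Delta(r)=r^2-2Mr+a^2$, $\rho^2=r^2+a^2\cos^2\theta$, $\sigma^2=(r^2+a^2)^2-a^2\Delta\sin^2\theta$, $r_\pm=M\pm\sqrt{M^2-a^2}$. Consider the Kerr blocks $M_{\rm I}=\mathbb R_t\times(r_+,\infty)_r\times\mathbb S^2_{\theta,\varphi}$ (the exterior) and $M_{\rm II}=\mathbb R_t\times(r_-,r_+)_r\times\mathbb S^2_{\theta,\varphi}$ with the metric $$g=-\Big(1-\frac{2Mr}{\rho^2}\Big)dt^2-\frac{4aMr\sin^2\theta}{\rho^2}\,dt\,d\varphi+\frac{\rho^2}{\Delta}dr^2+\rho^2d\theta^2+\frac{\sigma^2}{\rho^2}\sin^2\theta\,d\varphi^2 ,$$ where $M_{\rm I}$ is time-oriented by declaring $-\nabla t$ future directed. Let $v_{\mathcal I}=\partial_t$ and $v_{\mathcal H}=\partial_t+\Omega_{\mathcal H}\partial_\varphi$ with $\Omega_{\mathcal H}=a/(r_+^2+a^2)$, and let $t^*=t+x(r)$, where $x(r)=r+\frac1{2\kappa_+}\ln|r-r_+|+\frac1{2\kappa_-}\ln|r-r_-|$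 and $\kappa_\pm=\frac{r_\pm-r_\mp}{2(r_\pm^2+a^2)}$. A null geodesic with tangent $\dot x$ has the first integrals $E=-g(\partial_t,\dot x)$, $L=g(\partial_\varphi,\dot x)$, the Carter constant $K=\Delta\, g(l_+,\dot x)\,g(l_-,\dot x)$ with $l_\pm=\frac{r^2+a^2}{\Delta}\partial_t\pm\partial_r+\frac a\Delta\partial_\varphi$, and $Q=K-(L-aE)^2$. Its radial potential is $R(r)=\big((r^2+a^2)E-aL\big)^2-\Delta(r)K$, and a double zero of $R$ is an $r$ with $R(r)=R'(r)=0$. Below, $R$ always denotes the radial potential of a null geodesic of $M_{\rm I}$ or $M_{\rm II}$. A null geodesic in $M_{\rm I}$ is understood to be affinely parametrized and maximal in $M_{\rm I}$, with parameter interval $(s_-,s_+)$, $-\infty\le s_-<s_+\le+\infty$; it starts at $r_+$ (resp. at $\infty$) if $r(s)\to r_+$ (resp. $r(s)\to\infty$) as $s\to s_-$. Then the following hold. 1. For all $0<|a|<M$ and every future directed null geodesic in $M_{\rm I}$: $\lim_{s\to s_\pm}t(s)=\pm\infty$; and $\lim_{s\to s_-}t^*(s)=-\infty$ if the geodesic starts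 at $r_+$. 2. There exists $0<a_0\le1$ such that, whenever $0<|a|/M<a_0$, every future directed null geodesic in $M_{\rm I}$ which starts neither at $r_+$ nor at $\infty$ passes through an open region of $M_{\rm I}$ on which $v_{\mathcal H}$ and $v_{\mathcal I}$ are both timelike. 3. For all $0<|a|<M$, $R$ has no double zeros in $(r_-,r_+)$. 4. There exist $0<a_0<1$ and $C>0$ such that, whenever $0<|a|/M\le a_0$ and $E\ne0$, every double zero of $R$ in $[r_-,\infty)$ lies in $[3M-C|a|,\,3M+C|a|]$, and if there is such a double zero then $|L/E|\le CM$ and $|Q/E^2|\le CM^2$. 5. There exists $0<a_1\le1$ such that, whenever $0<|a|/M<a_1$, at every point of $\mathbb R_t\times[r_+,\infty)\times\mathbb S^2$ whose radius $r$ is a double zero of $R$ one has $r>r_+$, and $v_{\mathcal H}$ and $v_{\mathcal I}$ are future directed timelike there. -/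

import Mathlib

open Filter Topology

namespace Kerr

noncomputable section

/-- Points and tangent vectors. The exterior `ℝ_t × ]r₊, ∞[_r × S²` is identified with the open
subset `{|(x 1, x 2, x 3)| > r₊}` of `ℝ⁴` by the diffeomorphism
`(t, r, θ, φ) ↦ (t, r sin θ cos φ, r sin θ sin φ, r cos θ)`, which is a single global chart
containing the axis `sin θ = 0`. The coordinate `x 0` is the Boyer-Lindquist time `t`. The block
`ℝ_t × ]r₋, r₊[_r × S²` is treated in the same way. -/
abbrev Pt : Type := Fin 4 → ℝ

/-- The outer horizon radius `r₊`. -/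
def rPlus (M a : ℝ) : ℝ := M + √(M ^ 2 - a ^ 2)

/-- The inner horizon radius `r₋`. -/
def rMinus (M a : ℝ) : ℝ := M - √(M ^ 2 - a ^ 2)

/-- `Δ(r) = r² - 2 M r + a²`. -/
def Delta (M a r : ℝ) : ℝ := r ^ 2 - 2 * M * r + a ^ 2

/-- The Boyer-Lindquist radius `r` of a point. -/
def rad (x : Pt) : ℝ := √(x 1 ^ 2 + x 2 ^ 2 + x 3 ^ 2)

/-- `cos θ`. -/
def cosTheta (x : Pt) : ℝ := x 3 / rad x

/-- `ρ² = r² + a² cos² θ`. -/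
def rhoSq (a : ℝ) (x : Pt) : ℝ := rad x ^ 2 + a ^ 2 * cosTheta x ^ 2

/-- The block `M_I = ℝ × ]r₊, ∞[ × S²` (the Kerr exterior). -/
def exterior (M a : ℝ) : Set Pt := {x | rPlus M a < rad x}

/-- The block `M_II = ℝ × ]r₋, r₊[ × S²`. -/
def blockII (M a : ℝ) : Set Pt := {x | rMinus M a < rad x ∧ rad x < rPlus M a}

/-- The one-form `dr`. -/
def dr (x v : Pt) : ℝ := (x 1 * v 1 + x 2 * v 2 + x 3 * v 3) / rad x

/-- The one-form `sin² θ dφ`. -/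
def sinSqDphi (x v : Pt) : ℝ := (x 1 * v 2 - x 2 * v 1) / rad x ^ 2

/-- The round metric `dθ² + sin² θ dφ²`. -/
def sphereMetric (x v w : Pt) : ℝ :=
  (v 1 * w 1 + v 2 * w 2 + v 3 * w 3 - dr x v * dr x w) / rad x ^ 2

/-- The Kerr metric `g`. Since `σ² / ρ² = ρ² + a² sin² θ (1 + 2 M r / ρ²)`, this is
`-(1 - 2Mr/ρ²) dt² - (4aMr sin²θ/ρ²) dt dφ + (ρ²/Δ) dr² + ρ² dθ² + (σ²/ρ²) sin²θ dφ²`,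
see `metric_boyerLindquist`. -/
def metric (M a : ℝ) (x v w : Pt) : ℝ :=
  -(1 - 2 * M * rad x / rhoSq a x) * (v 0 * w 0)
    - 2 * a * M * rad x / rhoSq a x * (v 0 * sinSqDphi x w + w 0 * sinSqDphi x v)
    + rhoSq a x / Delta M a (rad x) * (dr x v * dr x w)
    + rhoSq a x * sphereMetric x v w
    + a ^ 2 * (1 + 2 * M * rad x / rhoSq a x) * (sinSqDphi x v * sinSqDphi x w)

/-- The point with Boyer-Lindquist coordinates `(t, r, θ, φ)`. -/
def blPoint (t r θ φ : ℝ) : Pt :=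
  ![t, r * (Real.sin θ * Real.cos φ), r * (Real.sin θ * Real.sin φ), r * Real.cos θ]

/-- The vector `t' ∂_t + r' ∂_r + θ' ∂_θ + φ' ∂_φ` at `blPoint t r θ φ`. -/
def blVector (r θ φ t' r' θ' φ' : ℝ) : Pt :=
  ![t',
    r' * (Real.sin θ * Real.cos φ)
      + r * (θ' * Real.cos θ * Real.cos φ - φ' * Real.sin θ * Real.sin φ),
    r' * (Real.sin θ * Real.sin φ)
      + r * (θ' * Real.cos θ * Real.sin φ + φ' * Real.sin θ * Real.cos φ),
    r' * Real.cos θ - r * (θ' * Real.sin θ)]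

lemma rad_blPoint {t r θ φ : ℝ} (hr : 0 < r) : rad (blPoint t r θ φ) = r := by
  have h : (r * (Real.sin θ * Real.cos φ)) ^ 2 + (r * (Real.sin θ * Real.sin φ)) ^ 2
      + (r * Real.cos θ) ^ 2 = r ^ 2 := by
    linear_combination r ^ 2 * Real.sin θ ^ 2 * Real.sin_sq_add_cos_sq φ
      + r ^ 2 * Real.sin_sq_add_cos_sq θ
  simp only [rad, blPoint]
  simp [h, Real.sqrt_sq hr.le]

/-- In Boyer-Lindquist coordinates `metric` is the usual Kerr metric. -/
lemma metric_boyerLindquist {M a t r θ φ t' r' θ' φ' ρ2 σ2 : ℝ} (hr : 0 < r)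
    (hρ : ρ2 = r ^ 2 + a ^ 2 * Real.cos θ ^ 2)
    (hσ : σ2 = (r ^ 2 + a ^ 2) ^ 2 - a ^ 2 * Delta M a r * Real.sin θ ^ 2) :
    metric M a (blPoint t r θ φ) (blVector r θ φ t' r' θ' φ') (blVector r θ φ t' r' θ' φ')
      = -(1 - 2 * M * r / ρ2) * t' ^ 2 - 4 * a * M * r * Real.sin θ ^ 2 / ρ2 * (t' * φ')
        + ρ2 / Delta M a r * r' ^ 2 + ρ2 * θ' ^ 2 + σ2 / ρ2 * Real.sin θ ^ 2 * φ' ^ 2 := by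
  have hr0 : r ≠ 0 := hr.ne'
  have hρ0 : ρ2 ≠ 0 := by rw [hρ]; positivity
  have hθ := Real.sin_sq_add_cos_sq θ
  have hφ := Real.sin_sq_add_cos_sq φ
  have hc : cosTheta (blPoint t r θ φ) = Real.cos θ := by
    simp only [cosTheta, rad_blPoint hr]
    simp [blPoint, hr0]
  have hR : rhoSq a (blPoint t r θ φ) = ρ2 := by
    simp only [rhoSq, hc, rad_blPoint hr, hρ]
  have hdr : dr (blPoint t r θ φ) (blVector r θ φ t' r' θ' φ') = r' := by
    simp only [dr, rad_blPoint hr]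
    rw [div_eq_iff hr0]
    simp [blPoint, blVector]
    linear_combination (r' * r * Real.sin θ ^ 2 + r ^ 2 * θ' * Real.sin θ * Real.cos θ) * hφ
      + r' * r * hθ
  have hb : sinSqDphi (blPoint t r θ φ) (blVector r θ φ t' r' θ' φ')
      = Real.sin θ ^ 2 * φ' := by
    simp only [sinSqDphi, rad_blPoint hr]
    rw [div_eq_iff (pow_ne_zero 2 hr0)]
    simp [blPoint, blVector]
    linear_combination r ^ 2 * Real.sin θ ^ 2 * φ' * hφ
  have hs : sphereMetric (blPoint t r θ φ) (blVector r θ φ t' r' θ' φ')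
      (blVector r θ φ t' r' θ' φ') = θ' ^ 2 + Real.sin θ ^ 2 * φ' ^ 2 := by
    simp only [sphereMetric, hdr, rad_blPoint hr]
    rw [div_eq_iff (pow_ne_zero 2 hr0)]
    simp [blVector]
    linear_combination (r' ^ 2 * Real.sin θ ^ 2 + r ^ 2 * θ' ^ 2 * Real.cos θ ^ 2
      + r ^ 2 * φ' ^ 2 * Real.sin θ ^ 2 + 2 * r * r' * θ' * Real.sin θ * Real.cos θ) * hφ
      + (r' ^ 2 + r ^ 2 * θ' ^ 2) * hθ
  have hv0 : blVector r θ φ t' r' θ' φ' 0 = t' := by simp [blVector]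
  have hσ' : σ2 / ρ2 = ρ2 + a ^ 2 * Real.sin θ ^ 2 * (1 + 2 * M * r / ρ2) := by
    field_simp
    rw [hσ, hρ, Delta]
    have : Real.cos θ ^ 2 = 1 - Real.sin θ ^ 2 := by linear_combination hθ
    rw [this]; ring
  simp only [metric, hR, hdr, hb, hs, hv0, rad_blPoint hr, hσ']
  ring

/-- The `i`-th partial derivative. -/
def partialDeriv (i : Fin 4) (f : Pt → ℝ) (x : Pt) : ℝ := fderiv ℝ f x (Pi.single i 1)

/-- The components `g_{ij}`. -/
def metricComp (M a : ℝ) (i j : Fin 4) (x : Pt) : ℝ :=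
  metric M a x (Pi.single i 1) (Pi.single j 1)

/-- The Christoffel symbols of the first kind
`Γ_{k,ij} = (∂_i g_{kj} + ∂_j g_{ki} - ∂_k g_{ij}) / 2`. -/
def christoffel (M a : ℝ) (k i j : Fin 4) (x : Pt) : ℝ :=
  (partialDeriv i (metricComp M a k j) x + partialDeriv j (metricComp M a k i) x
    - partialDeriv k (metricComp M a i j) x) / 2

/-- `γ` is an affinely parametrized geodesic of the Kerr exterior on the open set `J` of
parameters: the components `g_{kj} γ''^j + Γ_{k,ij} γ'^i γ'^j` of the covector `g ∇_{γ'} γ'`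
vanish (`g` being nondegenerate, this says that `∇_{γ'} γ' = 0`). -/
def IsGeodesicOn (M a : ℝ) (γ : ℝ → Pt) (J : Set ℝ) : Prop :=
  (∀ s ∈ J, γ s ∈ exterior M a) ∧ ContDiffOn ℝ 2 γ J ∧
    ∀ s ∈ J, ∀ k : Fin 4,
      ∑ j, metricComp M a k j (γ s) * deriv (deriv γ) s j
        + ∑ i, ∑ j, christoffel M a k i j (γ s) * deriv γ s i * deriv γ s j = 0

/-- The open interval `]s₋, s₊[`, with possibly infinite ends. -/
def interval (sm sp : EReal) : Set ℝ := {s : ℝ | sm < (s : EReal) ∧ (s : EReal) < sp}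

/-- The filter of the limit `s → s₋` from inside `]s₋, s₊[`. -/
def pastEnd (sm : EReal) : Filter ℝ := comap Real.toEReal (𝓝[>] sm)

/-- The filter of the limit `s → s₊` from inside `]s₋, s₊[`. -/
def futureEnd (sp : EReal) : Filter ℝ := comap Real.toEReal (𝓝[<] sp)

/-- `v` is null at `x`. -/
def IsNull (M a : ℝ) (x v : Pt) : Prop := v ≠ 0 ∧ metric M a x v v = 0

/-- `v` is timelike at `x`. -/
def IsTimelike (M a : ℝ) (x v : Pt) : Prop := metric M a x v v < 0

/-- A causal vector `v` at a point of the exterior is future directed, for the time orientation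
given by `-∇t`, if `g(-∇t, v) = -dt(v)` is negative. -/
def IsFutureDirected (v : Pt) : Prop := 0 < v 0

/-- `γ`, with parameter interval `]s₋, s₊[`, is a future directed null geodesic of the exterior
which is maximal in the exterior, i.e. is not the restriction of a geodesic of the exterior
defined on a larger interval. The values of `γ` outside `]s₋, s₊[` are irrelevant. -/
structure IsFutureNullGeodesic (M a : ℝ) (γ : ℝ → Pt) (sm sp : EReal) : Prop where
  lt : sm < sp
  geodesic : IsGeodesicOn M a γ (interval sm sp)
  null : ∀ s ∈ interval sm sp, IsNull M a (γ s) (deriv γ s)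
  future : ∀ s ∈ interval sm sp, IsFutureDirected (deriv γ s)
  maximal : ∀ (δ : ℝ → Pt) (um up : EReal), um ≤ sm → sp ≤ up →
    IsGeodesicOn M a δ (interval um up) → Set.EqOn δ γ (interval sm sp) → um = sm ∧ up = sp

/-- `γ` starts at `r₊`. -/
def StartsAtHorizon (M a : ℝ) (γ : ℝ → Pt) (sm : EReal) : Prop :=
  Tendsto (fun s => rad (γ s)) (pastEnd sm) (𝓝 (rPlus M a))

/-- `γ` starts at infinity. -/
def StartsAtInfinity (γ : ℝ → Pt) (sm : EReal) : Prop :=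
  Tendsto (fun s => rad (γ s)) (pastEnd sm) atTop

/-- The surface gravity `κ₊ = (r₊ - r₋) / (2 (r₊² + a²))`. -/
def kappaPlus (M a : ℝ) : ℝ := (rPlus M a - rMinus M a) / (2 * (rPlus M a ^ 2 + a ^ 2))

/-- `κ₋ = (r₋ - r₊) / (2 (r₋² + a²))`. -/
def kappaMinus (M a : ℝ) : ℝ := (rMinus M a - rPlus M a) / (2 * (rMinus M a ^ 2 + a ^ 2))

/-- `x(r) = r + ln |r - r₊| / (2 κ₊) + ln |r - r₋| / (2 κ₋)`. -/
def tortoise (M a r : ℝ) : ℝ :=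
  r + 1 / (2 * kappaPlus M a) * Real.log |r - rPlus M a|
    + 1 / (2 * kappaMinus M a) * Real.log |r - rMinus M a|

/-- The Kerr-star time `t* = t + x(r)`. -/
def tStar (M a : ℝ) (x : Pt) : ℝ := x 0 + tortoise M a (rad x)

/-- The vector field `∂_t`. -/
def dT : Pt := ![1, 0, 0, 0]

/-- The vector field `∂_r`. -/
def dR (x : Pt) : Pt := ![0, x 1 / rad x, x 2 / rad x, x 3 / rad x]

/-- The vector field `∂_φ`. -/
def dPhi (x : Pt) : Pt := ![0, -x 2, x 1, 0]

/-- The angular velocity `Ω_H = a / (r₊² + a²)` of the horizon. -/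
def omegaH (M a : ℝ) : ℝ := a / (rPlus M a ^ 2 + a ^ 2)

/-- The Killing field `v_I = ∂_t`. -/
def vI : Pt := dT

/-- The Killing field `v_H = ∂_t + Ω_H ∂_φ`. -/
def vH (M a : ℝ) (x : Pt) : Pt := dT + omegaH M a • dPhi x

/-- The first integral `E = -g(∂_t, v)`. -/
def energy (M a : ℝ) (x v : Pt) : ℝ := -metric M a x dT v

/-- The first integral `L = g(∂_φ, v)`. -/
def angMom (M a : ℝ) (x v : Pt) : ℝ := metric M a x (dPhi x) v

/-- The principal null directions `((r² + a²) / Δ) ∂_t ± ∂_r + (a / Δ) ∂_φ`, for `ε = ±1`. -/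
def principalNull (M a ε : ℝ) (x : Pt) : Pt :=
  ((rad x ^ 2 + a ^ 2) / Delta M a (rad x)) • dT + ε • dR x
    + (a / Delta M a (rad x)) • dPhi x

/-- The Carter constant `K = Δ g(l₊, v) g(l₋, v) + r² g(v, v)`, i.e. the value on `(v, v)` of the
Killing tensor of the Kerr metric; here `l₊`, `l₋` are the principal null directions. -/
def carterK (M a : ℝ) (x v : Pt) : ℝ :=
  Delta M a (rad x) * metric M a x (principalNull M a 1 x) v
      * metric M a x (principalNull M a (-1) x) v
    + rad x ^ 2 * metric M a x v v

/-- `Q = K - (L - a E)²`. -/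
def carterQ (M a : ℝ) (x v : Pt) : ℝ :=
  carterK M a x v - (angMom M a x v - a * energy M a x v) ^ 2

/-- `(E, L, Q)` are the first integrals of a null geodesic of `M_I` or `M_II`: as they are
constant along geodesics, they are read off from one tangent vector. -/
def AreNullIntegrals (M a E L Q : ℝ) : Prop :=
  ∃ x v : Pt, x ∈ exterior M a ∪ blockII M a ∧ IsNull M a x v ∧
    E = energy M a x v ∧ L = angMom M a x v ∧ Q = carterQ M a x v

/-- The radial potential `R(r) = P(r)² - Δ(r) K`, with `P(r) = (r² + a²) E - a L` and
`K = Q + (L - a E)²`. -/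
def radialPotential (M a E L Q r : ℝ) : ℝ :=
  ((r ^ 2 + a ^ 2) * E - a * L) ^ 2 - Delta M a r * (Q + (L - a * E) ^ 2)

/-- `r` is a double zero of the radial potential (a zero of order at least two). -/
def IsDoubleZero (M a E L Q r : ℝ) : Prop :=
  radialPotential M a E L Q r = 0 ∧ deriv (radialPotential M a E L Q) r = 0

end

end Kerr

namespace Kerr

/-! ### Pointwise algebra of the Kerr metric -/

/-! Everything rests on three identities for a null vector `v`, with `P = (r² + a²) E - a L` and `b
= sin² θ φ'`: `P = Δ (t' - a b)`, `(ρ² r')² = P² - Δ K = R(r)`, and `K sin² θ = (L - a E sin² θ)² +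
(ρ² (cos θ)')²`. They give `K ≥ 0`, with `E ≠ 0` if `K = 0`, and `(L - a E σ)² ≤ K σ` for some `σ ∈
[0, 1]`. These constraints (`Admissible`) are all that the study of the zeros of `R` uses.

Zeros of `R`. Between the horizons `Δ < 0`, so `R = P² - Δ K` is a sum of nonnegative terms, and it
vanishes only if `K = P = 0`, which is impossible. Outside, put `K = k²` with `k > 0`; after
changing the sign of `(E, L)` if necessary, a zero has `P = √Δ k`, whence `R' = 2 k (2 r √Δ E - (r -
M) k)`. Since `|L| ≤ k + |a| |E|`, the slope `R'` is negative for `r ≤ 3M - 4|a|` and positive for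
`r ≥ 3M + 2|a|` (`radialSlope_neg`, `radialSlope_pos`). Double zeros are thus squeezed to `3M`,
where for small `|a| / M` both Killing fields are timelike.

Conservation laws. In the Cartesian-like chart `∂_t`, `∂_φ` and `r ∂_r` are affine vector fields, so
one Euler-Lagrange identity (`hasDerivAt_metric_affine`) yields the constancy of `E` and `L` and the
radial equation `ρ² (ρ² r')' = R' / 2`, without computing a Christoffel symbol. Constancy of `K`
follows on differentiating `K = (P² - (ρ² r')²) / Δ`.

Limits of `t`. The bound `|r'| ≤ (2 / M) (r - r₊) |t'|` makes `log (r - r₊)` Lipschitz in `t`. If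
`t` were bounded towards an end, `r` would stay in a compact shell, where fixed first integrals
bound the velocity and keep `|t'|` away from zero. The parameter would then have a finite limit with
the orbit in a compact subset of phase space, so the geodesic would extend, against maximality.

Crossing the region near `3M`. A geodesic avoiding `29M/10 < r < 31M/10` stays on one side, where
all turning points are of one type. Then `r'` vanishes at most once and `r` is monotone near `s₋`. A
limit in `(r₊, ∞)` would have to be a double zero of `R` (`false_of_tendsTo`), and there is none on
that side; so the geodesic starts at `r₊` or at infinity. -/

lemma rad_sq (x : Pt) : rad x ^ 2 = x 1 ^ 2 + x 2 ^ 2 + x 3 ^ 2 :=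
  Real.sq_sqrt (by positivity)

lemma rhoSq_pos (a : ℝ) {x : Pt} (hr : 0 < rad x) : 0 < rhoSq a x := by
  unfold rhoSq; positivity

lemma cosTheta_sq_le_one {x : Pt} (hr : 0 < rad x) : cosTheta x ^ 2 ≤ 1 := by
  unfold cosTheta
  rw [div_pow, div_le_one (by positivity), rad_sq]
  nlinarith [sq_nonneg (x 1), sq_nonneg (x 2)]

lemma metric_smul_add_left (M a k : ℝ) (x u w v : Pt) :
    metric M a x (k • u + w) v = k * metric M a x u v + metric M a x w v := by
  simp only [metric, sphereMetric, sinSqDphi, dr, Pi.add_apply, Pi.smul_apply, smul_eq_mul]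
  ring

lemma metric_comm (M a : ℝ) (x v w : Pt) : metric M a x v w = metric M a x w v := by
  simp only [metric, sphereMetric]
  ring

lemma metric_neg_neg (M a : ℝ) (x v w : Pt) : metric M a x (-v) (-w) = metric M a x v w := by
  simp only [metric, sphereMetric, sinSqDphi, dr, Pi.neg_apply]
  ring

lemma metric_dT (M a : ℝ) (x v : Pt) :
    metric M a x dT v = -(1 - 2 * M * rad x / rhoSq a x) * v 0
      - 2 * a * M * rad x / rhoSq a x * sinSqDphi x v := by
  simp [metric, sphereMetric, sinSqDphi, dr, dT]

lemma sinSqDphi_dPhi {x : Pt} (hr : 0 < rad x) : sinSqDphi x (dPhi x) = 1 - cosTheta x ^ 2 := by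
  have := rad_sq x
  simp only [sinSqDphi, dPhi, cosTheta]
  field_simp
  simp
  linear_combination -this

lemma dr_dPhi (x : Pt) : dr x (dPhi x) = 0 := by
  simp only [dr, dPhi]
  simp
  left; ring

lemma sphereMetric_dPhi (x v : Pt) : sphereMetric x (dPhi x) v = sinSqDphi x v := by
  simp only [sphereMetric, dr_dPhi, sinSqDphi]
  simp [dPhi]
  ring

lemma metric_dPhi (M a : ℝ) {x : Pt} (hr : 0 < rad x) (v : Pt) :
    metric M a x (dPhi x) v = -(2 * a * M * rad x / rhoSq a x * (1 - cosTheta x ^ 2)) * v 0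
      + (rhoSq a x + a ^ 2 * (1 + 2 * M * rad x / rhoSq a x) * (1 - cosTheta x ^ 2))
        * sinSqDphi x v := by
  simp only [metric, sphereMetric_dPhi, dr_dPhi, sinSqDphi_dPhi hr]
  simp [dPhi]
  ring

lemma metric_dR (M a : ℝ) {x : Pt} (hr : 0 < rad x) (v : Pt) :
    metric M a x (dR x) v = rhoSq a x / Delta M a (rad x) * dr x v := by
  have h1 : dr x (dR x) = 1 := by
    have := rad_sq x
    simp only [dr, dR]
    simp
    field_simp
    linear_combination -this
  have h2 : sinSqDphi x (dR x) = 0 := by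
    simp only [sinSqDphi, dR]
    simp
    left; ring
  have h3 : sphereMetric x (dR x) v = 0 := by
    simp only [sphereMetric, h1]
    simp only [dR, dr]
    simp
    left; ring
  simp only [metric, h1, h2, h3]
  simp [dR]

/-- `P(r) = (r² + a²) E - a L` at the base point. -/
lemma radialP_eq (M a : ℝ) {x : Pt} (hr : 0 < rad x) (v : Pt) :
    (rad x ^ 2 + a ^ 2) * energy M a x v - a * angMom M a x v
      = Delta M a (rad x) * (v 0 - a * sinSqDphi x v) := by
  have h := rhoSq_pos a hr
  rw [energy, angMom, metric_dT, metric_dPhi M a hr]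
  field_simp
  rw [rhoSq, Delta]
  ring

/-- The polar momentum `L - a E sin² θ`. -/
lemma angMom_sub (M a : ℝ) {x : Pt} (hr : 0 < rad x) (v : Pt) :
    angMom M a x v - a * energy M a x v * (1 - cosTheta x ^ 2)
      = (rad x ^ 2 + a ^ 2) * sinSqDphi x v - a * (1 - cosTheta x ^ 2) * v 0 := by
  have h := rhoSq_pos a hr
  rw [energy, angMom, metric_dT, metric_dPhi M a hr]
  field_simp
  rw [rhoSq]
  ring

lemma metric_principalNull (M a ε : ℝ) {x : Pt} (hr : 0 < rad x) (v : Pt) :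
    metric M a x (principalNull M a ε x) v
      = (-((rad x ^ 2 + a ^ 2) * energy M a x v - a * angMom M a x v)
        + ε * (rhoSq a x * dr x v)) / Delta M a (rad x) := by
  have h : principalNull M a ε x = ((rad x ^ 2 + a ^ 2) / Delta M a (rad x)) • dT
      + (ε • dR x + ((a / Delta M a (rad x)) • dPhi x + 0)) := by
    simp [principalNull, add_assoc]
  have h0 : metric M a x 0 v = 0 := by simp [metric, sphereMetric, sinSqDphi, dr]
  rw [h, metric_smul_add_left, metric_smul_add_left, metric_smul_add_left, h0, metric_dR M a hr,
    energy, angMom]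
  ring

lemma carterK_eq (M a : ℝ) {x : Pt} (hr : 0 < rad x) (hΔ : Delta M a (rad x) ≠ 0) (v : Pt) :
    Delta M a (rad x) * (carterK M a x v - rad x ^ 2 * metric M a x v v)
      = ((rad x ^ 2 + a ^ 2) * energy M a x v - a * angMom M a x v) ^ 2
        - (rhoSq a x * dr x v) ^ 2 := by
  rw [carterK, metric_principalNull M a 1 hr, metric_principalNull M a (-1) hr]
  field_simp
  ring

/-- The Carter constant without denominators vanishing on the axis or on the horizons. -/
lemma carterK_eq_sphere (M a : ℝ) {x : Pt} (hr : 0 < rad x) (hΔ : Delta M a (rad x) ≠ 0) {v : Pt}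
    (hn : metric M a x v v = 0) :
    carterK M a x v = rhoSq a x ^ 2 * sphereMetric x v v
      - a * (v 0 - a * sinSqDphi x v) * ((rad x ^ 2 + a ^ 2) * sinSqDphi x v
        - a * (1 - cosTheta x ^ 2) * v 0 + rhoSq a x * sinSqDphi x v) := by
  have h := rhoSq_pos a hr
  have h1 := carterK_eq M a hr hΔ v
  rw [hn, radialP_eq M a hr] at h1
  have h2 : Delta M a (rad x) * rhoSq a x * metric M a x v v = 0 := by rw [hn]; ring
  rw [metric] at h2
  field_simp at h2
  refine mul_left_cancel₀ hΔ ?_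
  have hρ : rhoSq a x = rad x ^ 2 + a ^ 2 * cosTheta x ^ 2 := rfl
  have hD : Delta M a (rad x) = rad x ^ 2 - 2 * M * rad x + a ^ 2 := rfl
  generalize sphereMetric x v v = S at *
  generalize sinSqDphi x v = b at *
  generalize dr x v = p at *
  generalize v 0 = t at *
  generalize carterK M a x v = K at *
  generalize rhoSq a x = ρ at *
  generalize cosTheta x = c at *
  generalize rad x = r at *
  generalize Delta M a r = D at *
  subst hρ hD
  linear_combination h1 - h2

/-- The derivative of `cos θ` along `v`. -/
noncomputable def dCosTheta (x v : Pt) : ℝ := (v 3 - cosTheta x * dr x v) / rad x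

/-- In polar coordinates both sides equal `sin² θ θ'²`; the Cartesian form remains valid on the
axis. -/
lemma sphereMetric_axial {x : Pt} (hr : 0 < rad x) (v : Pt) :
    (1 - cosTheta x ^ 2) * sphereMetric x v v - sinSqDphi x v ^ 2 = dCosTheta x v ^ 2 := by
  have h := rad_sq x
  simp only [sphereMetric, sinSqDphi, dCosTheta, dr, cosTheta]
  field_simp
  generalize rad x = r at *
  generalize x 1 = x1 at *
  generalize x 2 = x2 at *
  generalize x 3 = x3 at *
  generalize v 1 = v1 at *
  generalize v 2 = v2 at *
  generalize v 3 = v3 at *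
  have h3 : x3 ^ 2 = r ^ 2 - x1 ^ 2 - x2 ^ 2 := by linarith
  ring_nf
  rw [show x3 ^ 4 = (x3 ^ 2) ^ 2 by ring, show x3 ^ 3 = x3 ^ 2 * x3 by ring, h3]
  ring

lemma norm_sq_spatial {x : Pt} (hr : 0 < rad x) (v : Pt) :
    v 1 ^ 2 + v 2 ^ 2 + v 3 ^ 2 = dr x v ^ 2 + rad x ^ 2 * sphereMetric x v v := by
  simp only [sphereMetric]
  field_simp
  ring

lemma eq_zero_of_components {x v : Pt} (hr : 0 < rad x) (h0 : v 0 = 0) (hp : dr x v = 0)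
    (hS : sphereMetric x v v = 0) : v = 0 := by
  have h5 := norm_sq_spatial hr v
  rw [hp, hS] at h5
  ext i
  fin_cases i
  · exact h0
  all_goals
    simp
    nlinarith [sq_nonneg (v 1), sq_nonneg (v 2), sq_nonneg (v 3)]

lemma sphereMetric_self_nonneg {x : Pt} (hr : 0 < rad x) (v : Pt) : 0 ≤ sphereMetric x v v := by
  have h := rad_sq x
  simp only [sphereMetric, dr]
  apply div_nonneg _ (by positivity)
  -- Lagrange's identity: the tangential part of the norm is the square of the cross product `x × v`
  -- divided by `r²`.
  have : v 1 * v 1 + v 2 * v 2 + v 3 * v 3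
      - (x 1 * v 1 + x 2 * v 2 + x 3 * v 3) / rad x * ((x 1 * v 1 + x 2 * v 2 + x 3 * v 3) / rad x)
      = ((x 1 * v 2 - x 2 * v 1) ^ 2 + (x 2 * v 3 - x 3 * v 2) ^ 2 + (x 3 * v 1 - x 1 * v 3) ^ 2)
        / rad x ^ 2 := by
    field_simp
    rw [h]
    ring
  rw [this]
  positivity

lemma carterK_mul_sinSq (M a : ℝ) {x : Pt} (hr : 0 < rad x) (hΔ : Delta M a (rad x) ≠ 0) {v : Pt}
    (hn : metric M a x v v = 0) :
    carterK M a x v * (1 - cosTheta x ^ 2)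
      = (angMom M a x v - a * energy M a x v * (1 - cosTheta x ^ 2)) ^ 2
        + (rhoSq a x * dCosTheta x v) ^ 2 := by
  rw [angMom_sub M a hr, mul_pow, ← sphereMetric_axial hr, carterK_eq_sphere M a hr hΔ hn, rhoSq]
  ring

/-- Off the axis `K sin² θ` is a sum of squares. On the axis this says nothing, but there `b = 0`
and `carterK_eq_sphere` reduces to `K = ρ⁴ (θ'² + sin² θ φ'²)`. -/
lemma carterK_nonneg (M a : ℝ) {x : Pt} (hr : 0 < rad x) (hΔ : Delta M a (rad x) ≠ 0) {v : Pt}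
    (hn : metric M a x v v = 0) : 0 ≤ carterK M a x v := by
  rcases (sub_nonneg.2 (cosTheta_sq_le_one hr)).eq_or_lt with h | h
  · have hb : sinSqDphi x v = 0 := by
      have := sphereMetric_axial hr v
      rw [← h] at this
      nlinarith [sq_nonneg (sinSqDphi x v), sq_nonneg (dCosTheta x v)]
    rw [carterK_eq_sphere M a hr hΔ hn, hb, ← h]
    have := sphereMetric_self_nonneg hr v
    have h' : 0 ≤ rhoSq a x ^ 2 * sphereMetric x v v := by positivity
    linarith
  · refine nonneg_of_mul_nonneg_left ?_ h
    rw [carterK_mul_sinSq M a hr hΔ hn]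
    positivity

/-- If `E = K = 0`, the polar identity forces `L = 0`; then `t'`, `r'` and the spherical part vanish
in turn, and a null vector is nonzero by definition. -/
lemma energy_ne_zero_of_carterK_eq_zero (M a : ℝ) {x : Pt} (hr : 0 < rad x)
    (hΔ : Delta M a (rad x) ≠ 0) {v : Pt} (hn : IsNull M a x v) (hK : carterK M a x v = 0) :
    energy M a x v ≠ 0 := by
  intro hE
  apply hn.1
  have hρ := rhoSq_pos a hr
  have h1 := carterK_mul_sinSq M a hr hΔ hn.2
  rw [hK, hE, zero_mul] at h1
  have hL : angMom M a x v = 0 := by nlinarith [sq_nonneg (rhoSq a x * dCosTheta x v)]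
  have h2 := radialP_eq M a hr v
  have h3 := angMom_sub M a hr v
  rw [hE, hL] at h2 h3
  have h4 : v 0 = a * sinSqDphi x v := by
    have : Delta M a (rad x) * (v 0 - a * sinSqDphi x v) = 0 := by rw [← h2]; ring
    rcases mul_eq_zero.1 this with h | h
    · exact absurd h hΔ
    · linarith
  have hb : sinSqDphi x v = 0 := by
    have : rhoSq a x * sinSqDphi x v = 0 := by
      rw [h4] at h3
      rw [rhoSq]
      linear_combination -h3
    exact (mul_eq_zero.1 this).resolve_left hρ.ne'
  have hp : dr x v = 0 := by
    have := carterK_eq M a hr hΔ v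
    rw [hK, hn.2, hE, hL] at this
    have h5 : (rhoSq a x * dr x v) ^ 2 = 0 := by linarith
    exact (mul_eq_zero.1 (pow_eq_zero_iff two_ne_zero |>.1 h5)).resolve_left hρ.ne'
  have hS : sphereMetric x v v = 0 := by
    have := carterK_eq_sphere M a hr hΔ hn.2
    rw [hK, h4, hb] at this
    have h5 : rhoSq a x ^ 2 * sphereMetric x v v = 0 := by linarith
    exact (mul_eq_zero.1 h5).resolve_left (by positivity)
  exact eq_zero_of_components hr (by rw [h4, hb, mul_zero]) hp hS

/-- The relations between the first integrals of a null geodesic of a Kerr block, `K` being the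
Carter constant. -/
def Admissible (a E L K : ℝ) : Prop :=
  0 ≤ K ∧ (K = 0 → E ≠ 0) ∧ ∃ σ, 0 ≤ σ ∧ σ ≤ 1 ∧ (L - a * E * σ) ^ 2 ≤ K * σ

/-- The witness is `σ = sin² θ`, and the inequality is the polar identity with the square `(ρ² (cos
θ)')²` dropped. -/
lemma admissible_of_isNull {M a : ℝ} {x v : Pt} (hr : 0 < rad x)
    (hΔ : Delta M a (rad x) ≠ 0) (hn : IsNull M a x v) :
    Admissible a (energy M a x v) (angMom M a x v) (carterK M a x v) := by
  refine ⟨carterK_nonneg M a hr hΔ hn.2, energy_ne_zero_of_carterK_eq_zero M a hr hΔ hn,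
    1 - cosTheta x ^ 2, sub_nonneg.2 (cosTheta_sq_le_one hr),
    sub_le_self _ (sq_nonneg _), ?_⟩
  rw [carterK_mul_sinSq M a hr hΔ hn.2]
  linarith [sq_nonneg (rhoSq a x * dCosTheta x v)]

/-- Reversing the tangent vector changes the signs of `E` and `L` but not of `K`; this allows `P ≥
0` to be assumed in the study of zeros. -/
lemma Admissible.neg {a E L K : ℝ} (h : Admissible a E L K) : Admissible a (-E) (-L) K := by
  obtain ⟨h1, h2, σ, h3, h4, h5⟩ := h
  refine ⟨h1, fun h => neg_ne_zero.2 (h2 h), σ, h3, h4, ?_⟩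
  convert h5 using 1
  ring

lemma Admissible.abs_angMom_le {a E L k : ℝ} (h : Admissible a E L (k ^ 2)) (hk : 0 ≤ k) :
    |L| ≤ k + |a| * |E| := by
  obtain ⟨-, -, σ, h3, h4, h5⟩ := h
  have h6 : |L - a * E * σ| ≤ k := by
    apply abs_le_of_sq_le_sq _ hk
    nlinarith [sq_nonneg k]
  have h7 : |a * E * σ| ≤ |a| * |E| := by
    rw [abs_mul, abs_mul, abs_of_nonneg h3]
    exact mul_le_of_le_one_right (by positivity) h4
  calc |L| = |(L - a * E * σ) + a * E * σ| := by ring_nf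
    _ ≤ _ := (abs_add_le _ _).trans (add_le_add h6 h7)

/-- A principal null geodesic has `P ≠ 0`. -/
lemma Admissible.radialP_ne_zero {a E L r : ℝ} (h : Admissible a E L 0) (hr : 0 < r) :
    (r ^ 2 + a ^ 2) * E - a * L ≠ 0 := by
  obtain ⟨-, h2, σ, h3, h4, h5⟩ := h
  -- With `K = 0` the polar inequality becomes an equality, so `P = (r² + a² (1 - σ)) E`, which is
  -- `ρ² E` if `σ = sin² θ`.
  have hL : L = a * E * σ := by nlinarith [sq_nonneg (L - a * E * σ)]
  have : (r ^ 2 + a ^ 2) * E - a * L = (r ^ 2 + a ^ 2 * (1 - σ)) * E := by rw [hL]; ring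
  rw [this]
  have h1 : 0 < r ^ 2 + a ^ 2 * (1 - σ) := by
    have : 0 ≤ a ^ 2 * (1 - σ) := mul_nonneg (sq_nonneg a) (by linarith)
    positivity
  exact mul_ne_zero h1.ne' (h2 rfl)

end Kerr

namespace Kerr

/-! ### The horizons -/

section Horizon

variable {M a : ℝ}

lemma sqrt_horizon_pos (h : |a| < M) : 0 < √(M ^ 2 - a ^ 2) := by
  apply Real.sqrt_pos.2
  nlinarith [abs_nonneg a, sq_abs a]

lemma sqrt_horizon_lt (ha : 0 < |a|) (h : |a| < M) : √(M ^ 2 - a ^ 2) < M := by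
  rw [Real.sqrt_lt' (ha.trans h)]
  have : 0 < a ^ 2 := by rw [← sq_abs]; positivity
  linarith

lemma rMinus_pos (ha : 0 < |a|) (h : |a| < M) : 0 < rMinus M a :=
  sub_pos.2 (sqrt_horizon_lt ha h)

lemma rMinus_lt_rPlus (h : |a| < M) : rMinus M a < rPlus M a := by
  have := sqrt_horizon_pos h
  unfold rMinus rPlus
  linarith

lemma lt_rPlus (h : |a| < M) : M < rPlus M a := by
  have := sqrt_horizon_pos h
  unfold rPlus
  linarith

lemma rPlus_lt (ha : 0 < |a|) (h : |a| < M) : rPlus M a < 2 * M := by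
  have := sqrt_horizon_lt ha h
  unfold rPlus
  linarith

lemma Delta_eq (h : |a| < M) (r : ℝ) : Delta M a r = (r - rPlus M a) * (r - rMinus M a) := by
  have : √(M ^ 2 - a ^ 2) ^ 2 = M ^ 2 - a ^ 2 :=
    Real.sq_sqrt (by nlinarith [abs_nonneg a, sq_abs a])
  unfold Delta rPlus rMinus
  linear_combination this

lemma Delta_pos (h : |a| < M) {r : ℝ} (hr : rPlus M a < r) : 0 < Delta M a r := by
  rw [Delta_eq h]
  exact mul_pos (by linarith) (by linarith [rMinus_lt_rPlus h])

lemma Delta_neg (h : |a| < M) {r : ℝ} (h1 : rMinus M a < r) (h2 : r < rPlus M a) :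
    Delta M a r < 0 := by
  rw [Delta_eq h]
  exact mul_neg_of_neg_of_pos (by linarith) (by linarith)

end Horizon

/-! ### Zeros of the radial potential -/

lemma hasDerivAt_radialPotential (M a E L Q r : ℝ) :
    HasDerivAt (radialPotential M a E L Q)
      (4 * r * E * ((r ^ 2 + a ^ 2) * E - a * L) - 2 * (r - M) * (Q + (L - a * E) ^ 2)) r := by
  have h : HasDerivAt (fun r : ℝ => r ^ 2) (2 * r) r := by simpa using hasDerivAt_pow 2 r
  have h1 : HasDerivAt (fun r : ℝ => (r ^ 2 + a ^ 2) * E - a * L) (2 * r * E) r :=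
    ((h.add_const _).mul_const E).sub_const _
  have h2 : HasDerivAt (Delta M a) (2 * r - 2 * M) r := by
    unfold Delta
    have := (h.sub ((hasDerivAt_id r).const_mul (2 * M))).add_const (a ^ 2)
    rw [mul_one] at this
    exact this
  exact ((h1.pow 2).sub (h2.mul_const (Q + (L - a * E) ^ 2))).congr_deriv (by push_cast; ring)

/-- The slope of the radial potential, as a function of the Carter constant `K`. -/
def radialSlope (M a E L K r : ℝ) : ℝ :=
  4 * r * E * ((r ^ 2 + a ^ 2) * E - a * L) - 2 * (r - M) * K

/-- At a zero of the radial potential outside the horizon, `P = √Δ k` with `K = k²`, `k > 0`. -/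
lemma Admissible.exists_sqrt {a E L K Δ r : ℝ} (h : Admissible a E L K) (hr : 0 < r)
    (hΔ : 0 < Δ) (hP : 0 ≤ (r ^ 2 + a ^ 2) * E - a * L)
    (hR : ((r ^ 2 + a ^ 2) * E - a * L) ^ 2 = Δ * K) :
    ∃ k, 0 < k ∧ K = k ^ 2 ∧ (r ^ 2 + a ^ 2) * E - a * L = √Δ * k := by
  have hK : K ≠ 0 := by
    rintro rfl
    exact h.radialP_ne_zero hr (by simpa using hR)
  have hK' : 0 < K := lt_of_le_of_ne h.1 hK.symm
  refine ⟨√K, Real.sqrt_pos.2 hK', (Real.sq_sqrt h.1).symm, ?_⟩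
  rw [← Real.sqrt_mul hΔ.le, ← hR, Real.sqrt_sq hP]

/-- With `P = q k`, `q = √Δ`, the sign is that of `2 r q E - (r - M) k`, which is clearly negative
if `E ≤ 0`. If `E > 0`, then `a L ≤ |a| (k + |a| E)` turns `P = q k` into `r² E ≤ k (q + |a|)`, and
it remains to compare `2 q (q + |a|)` with `r (r - M)`. -/
lemma radialSlope_neg {M a E L K r : ℝ} (h : Admissible a E L K) (ha : 0 < |a|) (hM : |a| < M)
    (hr : rPlus M a < r) (hr3 : r ≤ 3 * M - 4 * |a|) (hP : 0 ≤ (r ^ 2 + a ^ 2) * E - a * L)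
    (hR : ((r ^ 2 + a ^ 2) * E - a * L) ^ 2 = Delta M a r * K) : radialSlope M a E L K r < 0 := by
  have hMr : M < r := (lt_rPlus hM).trans hr
  have hr0 : 0 < r := by linarith
  have hΔ := Delta_pos hM hr
  obtain ⟨k, hk, rfl, hPk⟩ := h.exists_sqrt hr0 hΔ hP hR
  have hL := h.abs_angMom_le hk.le
  set q := √(Delta M a r) with hq
  have hq0 : 0 < q := Real.sqrt_pos.2 hΔ
  have hq2 : q ^ 2 = r ^ 2 - 2 * M * r + a ^ 2 := Real.sq_sqrt hΔ.le
  have ha2 : a ^ 2 = |a| ^ 2 := (sq_abs a).symm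
  have hqr : q < r := by nlinarith
  rw [radialSlope, hPk]
  have key : 2 * r * q * E < (r - M) * k := by
    rcases le_or_gt E 0 with hE | hE
    · have : 0 < (r - M) * k := mul_pos (by linarith) hk
      have : 2 * r * q * E ≤ 0 := mul_nonpos_of_nonneg_of_nonpos (by positivity) hE
      linarith
    · rw [abs_of_pos hE] at hL
      have h1 : a * L ≤ |a| * (k + |a| * E) := by
        calc a * L ≤ |a * L| := le_abs_self _
          _ = |a| * |L| := abs_mul _ _
          _ ≤ _ := by gcongr
      have h2 : r ^ 2 * E ≤ k * (q + |a|) := by nlinarith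
      -- Here `r (r - M) - 2 q² = r (3M - r) - 2a² ≥ 4|a| r - 2a²`, and this exceeds `2 q |a|`
      -- because `q < r` and `|a| < r`.
      have h3 : 2 * q ^ 2 + 2 * q * |a| < r * (r - M) := by nlinarith
      have h4 : 2 * q * (r ^ 2 * E) ≤ 2 * q * (k * (q + |a|)) := by gcongr
      have h5 : k * (2 * q ^ 2 + 2 * q * |a|) < k * (r * (r - M)) := by gcongr
      have h6 : r * (2 * r * q * E) < r * ((r - M) * k) := by nlinarith
      exact lt_of_mul_lt_mul_left h6 hr0.le
  nlinarith

/-- The mirror image of `radialSlope_neg`: the lower bound for `a L` gives `k (q - |a|) ≤ (r² + 2a²)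
E`. The case `E ≤ 0` is excluded because it would give `q k ≤ r² E + |a| k ≤ |a| k`, while `q > |a|`
this far out. -/
lemma radialSlope_pos {M a E L K r : ℝ} (h : Admissible a E L K) (ha : 0 < |a|) (hM : |a| < M)
    (hr3 : 3 * M + 2 * |a| ≤ r) (hP : 0 ≤ (r ^ 2 + a ^ 2) * E - a * L)
    (hR : ((r ^ 2 + a ^ 2) * E - a * L) ^ 2 = Delta M a r * K) :
    0 < E ∧ 0 < radialSlope M a E L K r := by
  have hMr : M < r := by linarith
  have hr0 : 0 < r := by linarith
  have hr : rPlus M a < r := by linarith [rPlus_lt ha hM]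
  have hΔ := Delta_pos hM hr
  obtain ⟨k, hk, rfl, hPk⟩ := h.exists_sqrt hr0 hΔ hP hR
  have hL := h.abs_angMom_le hk.le
  set q := √(Delta M a r) with hq
  have hq0 : 0 < q := Real.sqrt_pos.2 hΔ
  have hq2 : q ^ 2 = r ^ 2 - 2 * M * r + a ^ 2 := Real.sq_sqrt hΔ.le
  have ha2 : a ^ 2 = |a| ^ 2 := (sq_abs a).symm
  have hqr : q < r := by nlinarith
  have haq : |a| < q := by nlinarith
  have h1 : -(a * L) ≤ |a| * (k + |a| * |E|) := by
    calc -(a * L) ≤ |a * L| := neg_le_abs _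
      _ = |a| * |L| := abs_mul _ _
      _ ≤ _ := by gcongr
  have hE : 0 < E := by
    by_contra! hE
    rw [abs_of_nonpos hE] at h1
    have : 0 ≤ r ^ 2 * (-E) := mul_nonneg (sq_nonneg r) (by linarith)
    nlinarith
  refine ⟨hE, ?_⟩
  rw [abs_of_pos hE] at h1
  rw [radialSlope, hPk]
  have h2 : k * (q - |a|) ≤ (r ^ 2 + 2 * a ^ 2) * E := by nlinarith
  -- After replacing `q |a|` by `r |a|`, the difference of the two sides is `r² (r - 3M - 2|a|) + 2
  -- a² M`, which is where `3M + 2|a|` comes from.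
  have h3 : (r - M) * (r ^ 2 + 2 * a ^ 2) < 2 * r * q * (q - |a|) := by
    have h31 : 2 * |a| * r ^ 2 ≤ r ^ 2 * (r - 3 * M) := by nlinarith [sq_nonneg r]
    have h32 : 2 * r * q * |a| ≤ 2 * r * r * |a| := by gcongr
    have h33 : 0 < a ^ 2 * M := by rw [ha2]; exact mul_pos (by positivity) (by linarith)
    have h34 : 2 * r * q * (q - |a|) = 2 * r * (q ^ 2) - 2 * r * q * |a| := by ring
    rw [h34, hq2]
    nlinarith
  have key : (r - M) * k < 2 * r * q * E := by
    have h4 : 0 < r ^ 2 + 2 * a ^ 2 := by positivity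
    have h5 : k * ((r - M) * (r ^ 2 + 2 * a ^ 2)) < k * (2 * r * q * (q - |a|)) := by gcongr
    have h6 : 2 * r * q * (k * (q - |a|)) ≤ 2 * r * q * ((r ^ 2 + 2 * a ^ 2) * E) := by gcongr
    have h7 : (r ^ 2 + 2 * a ^ 2) * ((r - M) * k) < (r ^ 2 + 2 * a ^ 2) * (2 * r * q * E) := by
      nlinarith
    exact lt_of_mul_lt_mul_left h7 h4.le
  nlinarith

lemma AreNullIntegrals.admissible {M a E L Q : ℝ} (ha : 0 < |a|) (hM : |a| < M)
    (h : AreNullIntegrals M a E L Q) : Admissible a E L (Q + (L - a * E) ^ 2) := by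
  obtain ⟨x, v, hx, hn, rfl, rfl, rfl⟩ := h
  have h1 := rMinus_pos ha hM
  have h2 := rMinus_lt_rPlus hM
  have : carterQ M a x v + (angMom M a x v - a * energy M a x v) ^ 2 = carterK M a x v := by
    rw [carterQ]; ring
  rw [this]
  rcases hx with hx | hx
  · have hx : rPlus M a < rad x := hx
    exact admissible_of_isNull (by linarith) (Delta_pos hM hx).ne' hn
  · have hx : rMinus M a < rad x ∧ rad x < rPlus M a := hx
    exact admissible_of_isNull (by linarith) (Delta_neg hM hx.1 hx.2).ne hn

lemma IsDoubleZero.eqs {M a E L Q r : ℝ} (h : IsDoubleZero M a E L Q r) :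
    ((r ^ 2 + a ^ 2) * E - a * L) ^ 2 = Delta M a r * (Q + (L - a * E) ^ 2) ∧
      radialSlope M a E L (Q + (L - a * E) ^ 2) r = 0 := by
  refine ⟨sub_eq_zero.1 h.1, ?_⟩
  rw [radialSlope, ← (hasDerivAt_radialPotential M a E L Q r).deriv]
  exact h.2

/-- With `Δ < 0` and `K ≥ 0`, `P² = Δ K` forces `P = K = 0`. Not even simple zeros occur. -/
lemma Admissible.not_zero_between {M a E L K r : ℝ} (h : Admissible a E L K)
    (ha : 0 < |a|) (hM : |a| < M) (h1 : rMinus M a < r) (h2 : r < rPlus M a)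
    (hR : ((r ^ 2 + a ^ 2) * E - a * L) ^ 2 = Delta M a r * K) : False := by
  have hΔ := Delta_neg hM h1 h2
  have hP : ((r ^ 2 + a ^ 2) * E - a * L) ^ 2 = 0 := by
    nlinarith [sq_nonneg ((r ^ 2 + a ^ 2) * E - a * L), h.1]
  have hK : K = 0 := by
    rw [hP] at hR
    exact (mul_eq_zero.1 hR.symm).resolve_left hΔ.ne
  subst hK
  exact h.radialP_ne_zero ((rMinus_pos ha hM).trans h1) (pow_eq_zero_iff two_ne_zero |>.1 hP)

/-- On a horizon `Δ = 0`, so a zero of `R` has `P = 0` and its slope is `-2 (r - M) K`. As `r ≠ M`,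
a double zero would force `K = 0` as well, which `radialP_ne_zero` forbids. -/
lemma Admissible.rPlus_lt_of_double_zero {M a E L K r : ℝ} (h : Admissible a E L K)
    (ha : 0 < |a|) (hM : |a| < M) (h1 : rMinus M a ≤ r)
    (hR : ((r ^ 2 + a ^ 2) * E - a * L) ^ 2 = Delta M a r * K)
    (hR' : radialSlope M a E L K r = 0) : rPlus M a < r := by
  have h0 := rMinus_pos ha hM
  have hlt := rMinus_lt_rPlus hM
  by_contra! h2
  have hΔ0 : Delta M a r = 0 → r ≠ M → False := by
    intro hΔ hrM
    rw [hΔ, zero_mul] at hR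
    have hP := pow_eq_zero_iff two_ne_zero |>.1 hR
    have hK : K = 0 := by
      rw [radialSlope, hP] at hR'
      have : (r - M) * K = 0 := by linarith
      exact (mul_eq_zero.1 this).resolve_left (sub_ne_zero.2 hrM)
    subst hK
    exact h.radialP_ne_zero (by linarith) hP
  rcases h1.eq_or_lt with h1 | h1
  · refine hΔ0 (by rw [Delta_eq hM, h1]; ring) ?_
    have := sqrt_horizon_pos hM
    rw [← h1, rMinus]
    linarith
  rcases h2.eq_or_lt with h2 | h2
  · refine hΔ0 (by rw [Delta_eq hM, h2]; ring) ?_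
    rw [h2]
    exact (lt_rPlus hM).ne'
  exact h.not_zero_between ha hM h1 h2 hR

lemma Admissible.double_zero_mem {M a E L K r : ℝ} (h : Admissible a E L K)
    (ha : 0 < |a|) (hM : |a| < M) (h1 : rPlus M a < r)
    (hR : ((r ^ 2 + a ^ 2) * E - a * L) ^ 2 = Delta M a r * K)
    (hR' : radialSlope M a E L K r = 0) :
    r ∈ Set.Ioo (3 * M - 4 * |a|) (3 * M + 2 * |a|) := by
  wlog hP : 0 ≤ (r ^ 2 + a ^ 2) * E - a * L generalizing E L
  · refine this (E := -E) (L := -L) h.neg ?_ ?_ (by linarith)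
    · rw [← hR]; ring
    · rw [← hR']; simp only [radialSlope]; ring
  constructor
  · by_contra! h3
    exact (radialSlope_neg h ha hM h1 h3 hP hR).ne hR'
  · by_contra! h3
    exact (radialSlope_pos h ha hM h3 hP hR).2.ne' hR'

/-- At a double zero with `P ≥ 0`, `(r - M) k = 2 r √Δ E` with `√Δ < r`. Since `r` is within
`4M/100` of `3M`, `2 r² ≤ 20 M²` and `r - M ≥ 19M/10`; the ratio `200/19` is below `11`. The bound
for `L` follows from `|L| ≤ k + |a| |E|`. -/
lemma Admissible.bounds_of_double_zero {M a E L K r : ℝ} (h : Admissible a E L K)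
    (ha : 0 < |a|) (hM : 100 * |a| ≤ M) (h1 : rPlus M a < r)
    (hR : ((r ^ 2 + a ^ 2) * E - a * L) ^ 2 = Delta M a r * K)
    (hR' : radialSlope M a E L K r = 0) :
    K ≤ (11 * M * |E|) ^ 2 ∧ |L| ≤ 12 * M * |E| := by
  have hM' : |a| < M := by linarith
  have hM0 : 0 < M := by linarith
  wlog hP : 0 ≤ (r ^ 2 + a ^ 2) * E - a * L generalizing E L
  · rw [← abs_neg E, ← abs_neg L]
    refine this (E := -E) (L := -L) h.neg ?_ ?_ (by linarith)
    · rw [← hR]; ring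
    · rw [← hR']; simp only [radialSlope]; ring
  obtain ⟨hr1, hr2⟩ := h.double_zero_mem ha hM' h1 hR hR'
  have hr0 : 0 < r := by linarith
  have hΔ := Delta_pos hM' h1
  obtain ⟨k, hk, rfl, hPk⟩ := h.exists_sqrt hr0 hΔ hP hR
  have hL := h.abs_angMom_le hk.le
  set q := √(Delta M a r) with hq
  have hq0 : 0 < q := Real.sqrt_pos.2 hΔ
  have hq2 : q ^ 2 = r ^ 2 - 2 * M * r + a ^ 2 := Real.sq_sqrt hΔ.le
  have ha2 : a ^ 2 = |a| ^ 2 := (sq_abs a).symm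
  have hqr : q < r := by nlinarith
  rw [radialSlope, hPk] at hR'
  have h2 : 2 * r * q * E = (r - M) * k := by
    have : (2 * k) * (2 * r * q * E - (r - M) * k) = 0 := by linarith
    have := (mul_eq_zero.1 this).resolve_left (by positivity)
    linarith
  have hE : 0 < E := by
    have : 0 < 2 * r * q * E := by rw [h2]; exact mul_pos (by linarith) hk
    exact pos_of_mul_pos_right this (by positivity)
  rw [abs_of_pos hE] at *
  have hkE : k ≤ 11 * M * E := by
    have h3 : 2 * r * q * E ≤ 2 * r * r * E := by gcongr
    have h4 : 2 * r * r ≤ 20 * M ^ 2 := by nlinarith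
    have h5 : 2 * r * r * E ≤ 20 * M ^ 2 * E := by gcongr
    have h6 : 19 / 10 * M * k ≤ (r - M) * k := by gcongr; linarith
    have h7 : M * (19 / 10 * k) ≤ M * (20 * M * E) := by linarith
    have h8 := le_of_mul_le_mul_left h7 hM0
    nlinarith [mul_pos hM0 hE]
  refine ⟨by gcongr, ?_⟩
  have : |a| * E ≤ M * E := by gcongr
  linarith

/-! ### The region where both Killing fields are timelike -/

/-- Beyond `2M` one has `ρ² ≥ r² > 2 M r`, so the point lies outside the ergoregion. -/
lemma isTimelike_vI {M a : ℝ} (hM : 0 < M) {x : Pt} (hr : 2 * M < rad x) :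
    IsTimelike M a x vI := by
  have hr0 : 0 < rad x := by linarith
  have hρ := rhoSq_pos a hr0
  have h : metric M a x vI vI = -(1 - 2 * M * rad x / rhoSq a x) := by
    rw [vI, metric_dT]; simp [dT, sinSqDphi]
  rw [IsTimelike, h, neg_lt_zero, sub_pos, div_lt_one hρ, rhoSq]
  nlinarith [sq_nonneg (a * cosTheta x)]

/-- Near `3M` the term from `∂_t` is at most `-(1 - 7/10)`. The cross term has a favourable sign
because `a Ω_H ≥ 0`, and the term quadratic in `Ω_H` is at most `11 Ω_H² M² ≤ 11 / 10000`. -/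
lemma isTimelike_vH {M a : ℝ} (ha : 0 < |a|) (hM : 100 * |a| ≤ M) {x : Pt}
    (h1 : 29 / 10 * M < rad x) (h2 : rad x < 31 / 10 * M) :
    IsTimelike M a x (vH M a x) := by
  have hM' : |a| < M := by linarith
  have hM0 : 0 < M := by linarith
  have hr0 : 0 < rad x := by linarith
  have hρ := rhoSq_pos a hr0
  have hc := cosTheta_sq_le_one hr0
  have hΩ : omegaH M a ^ 2 * M ^ 2 ≤ 1 / 10000 := by
    have hd : M ^ 2 ≤ rPlus M a ^ 2 + a ^ 2 := by
      have := lt_rPlus hM'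
      nlinarith [sq_nonneg a]
    have hd0 : 0 < rPlus M a ^ 2 + a ^ 2 := by nlinarith
    rw [omegaH, div_pow, div_mul_eq_mul_div, div_le_iff₀ (by positivity)]
    have h3 : a ^ 2 ≤ (M / 100) ^ 2 := by
      rw [← sq_abs]; gcongr; linarith
    have h4 : (M ^ 2) ^ 2 ≤ (rPlus M a ^ 2 + a ^ 2) ^ 2 := by gcongr
    nlinarith [sq_nonneg M]
  have haΩ : 0 ≤ a * omegaH M a := by
    rw [omegaH, ← mul_div_assoc]
    exact div_nonneg (mul_self_nonneg a) (by positivity)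
  have hm : metric M a x (vH M a x) (vH M a x) = -(1 - 2 * M * rad x / rhoSq a x)
      - 4 * (a * omegaH M a) * M * rad x / rhoSq a x * (1 - cosTheta x ^ 2)
      + omegaH M a ^ 2 * (rhoSq a x
        + a ^ 2 * (1 + 2 * M * rad x / rhoSq a x) * (1 - cosTheta x ^ 2)) * (1 - cosTheta x ^ 2) := by
    have e : vH M a x = omegaH M a • dPhi x + dT := by rw [vH, add_comm]
    have e1 : sinSqDphi x dT = 0 := by simp [sinSqDphi, dT]
    have e2 : dPhi x 0 = 0 := by simp [dPhi]
    have e3 : dT 0 = 1 := by simp [dT]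
    rw [e, metric_smul_add_left, metric_comm _ _ _ (dPhi x), metric_comm _ _ _ dT,
      metric_smul_add_left, metric_smul_add_left, metric_dPhi M a hr0, metric_dPhi M a hr0,
      metric_dT, metric_dT, sinSqDphi_dPhi hr0, e1, e2, e3]
    ring
  rw [IsTimelike, hm]
  set σ := 1 - cosTheta x ^ 2 with hσ
  have hσ0 : 0 ≤ σ := by linarith
  have hσ1 : σ ≤ 1 := by linarith [sq_nonneg (cosTheta x)]
  have ha2 : a ^ 2 ≤ (M / 100) ^ 2 := by rw [← sq_abs]; gcongr; linarith
  have hρ1 : rad x ^ 2 ≤ rhoSq a x := by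
    rw [rhoSq]; nlinarith [sq_nonneg (a * cosTheta x)]
  have hρ2 : rhoSq a x ≤ 10 * M ^ 2 := by
    have : a ^ 2 * cosTheta x ^ 2 ≤ a ^ 2 := mul_le_of_le_one_right (sq_nonneg a) hc
    rw [rhoSq]; nlinarith
  have hu : 2 * M * rad x / rhoSq a x ≤ 7 / 10 := by
    rw [div_le_iff₀ hρ]; nlinarith
  have hu0 : 0 ≤ 2 * M * rad x / rhoSq a x := by positivity
  have hx : 0 ≤ 4 * (a * omegaH M a) * M * rad x / rhoSq a x * σ := by positivity
  have h3 : a ^ 2 * (1 + 2 * M * rad x / rhoSq a x) * σ ≤ (M / 100) ^ 2 * (1 + 7 / 10) * 1 := by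
    gcongr
  have h4 : omegaH M a ^ 2 * (rhoSq a x + a ^ 2 * (1 + 2 * M * rad x / rhoSq a x) * σ) * σ
      ≤ omegaH M a ^ 2 * (11 * M ^ 2) * 1 := by
    gcongr
    nlinarith
  nlinarith

lemma eventually_isTimelike {M a : ℝ} (ha : 0 < |a|) (hM : 100 * |a| ≤ M) {x : Pt}
    (h1 : 29 / 10 * M < rad x) (h2 : rad x < 31 / 10 * M) :
    ∀ᶠ y in 𝓝 x, IsTimelike M a y (vH M a y) ∧ IsTimelike M a y vI := by
  have hc : Continuous rad := by unfold rad; fun_prop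
  filter_upwards [hc.continuousAt.eventually (Ioo_mem_nhds h1 h2)] with y hy
  exact ⟨isTimelike_vH ha hM hy.1 hy.2, isTimelike_vI (by linarith) (by linarith [hy.1])⟩

/-! ### Double zeros -/

theorem not_isDoubleZero_between {M a E L Q r : ℝ} (ha : 0 < |a|) (hM : |a| < M)
    (h : AreNullIntegrals M a E L Q) (h1 : rMinus M a < r) (h2 : r < rPlus M a) :
    ¬ IsDoubleZero M a E L Q r :=
  fun hd => (h.admissible ha hM).not_zero_between ha hM h1 h2 hd.eqs.1

theorem isDoubleZero_location {M a E L Q r : ℝ} (ha : 0 < |a|) (hM : 100 * |a| ≤ M)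
    (h : AreNullIntegrals M a E L Q) (hE : E ≠ 0) (h1 : rMinus M a ≤ r)
    (hd : IsDoubleZero M a E L Q r) :
    r ∈ Set.Icc (3 * M - 500 * |a|) (3 * M + 500 * |a|) ∧
      |L / E| ≤ 500 * M ∧ |Q / E ^ 2| ≤ 500 * M ^ 2 := by
  have hM' : |a| < M := by linarith
  have hM0 : 0 < M := by linarith
  have hA := h.admissible ha hM'
  obtain ⟨e1, e2⟩ := hd.eqs
  have hr := hA.rPlus_lt_of_double_zero ha hM' h1 e1 e2
  obtain ⟨hr1, hr2⟩ := hA.double_zero_mem ha hM' hr e1 e2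
  obtain ⟨hK, hL⟩ := hA.bounds_of_double_zero ha hM hr e1 e2
  have hE' := abs_pos.2 hE
  refine ⟨⟨by linarith, by linarith⟩, ?_, ?_⟩
  · rw [abs_div, div_le_iff₀ hE']
    nlinarith [mul_pos hM0 hE']
  -- Since `Q = K - (L - a E)²`, the bounds `121` and `169` for the two terms, in units of `M² E²`,
  -- leave ample room below `500`.
  · have h3 : |L - a * E| ≤ 13 * M * |E| := by
      calc |L - a * E| ≤ |L| + |a * E| := abs_sub _ _
        _ = |L| + |a| * |E| := by rw [abs_mul]
        _ ≤ 12 * M * |E| + M * |E| := by gcongr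
        _ = _ := by ring
    have h4 : (L - a * E) ^ 2 ≤ (13 * M * |E|) ^ 2 := by rw [← sq_abs]; gcongr
    have h5 : E ^ 2 = |E| ^ 2 := (sq_abs E).symm
    have h6 : 0 < (M * |E|) ^ 2 := by positivity
    rw [abs_div, abs_of_pos (by positivity : 0 < E ^ 2), div_le_iff₀ (by positivity), abs_le, h5]
    constructor <;> nlinarith [hA.1]

theorem isTimelike_of_isDoubleZero {M a E L Q : ℝ} (ha : 0 < |a|) (hM : 100 * |a| ≤ M)
    (h : AreNullIntegrals M a E L Q) {x : Pt} (h1 : rPlus M a ≤ rad x)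
    (hd : IsDoubleZero M a E L Q (rad x)) :
    x ∈ exterior M a ∧ (IsTimelike M a x (vH M a x) ∧ IsFutureDirected (vH M a x)) ∧
      (IsTimelike M a x vI ∧ IsFutureDirected vI) := by
  have hM' : |a| < M := by linarith
  have hA := h.admissible ha hM'
  obtain ⟨e1, e2⟩ := hd.eqs
  have hr := hA.rPlus_lt_of_double_zero ha hM' ((rMinus_lt_rPlus hM').le.trans h1) e1 e2
  obtain ⟨hr1, hr2⟩ := hA.double_zero_mem ha hM' hr e1 e2
  exact ⟨hr, ⟨isTimelike_vH ha hM (by linarith) (by linarith), by simp [IsFutureDirected, vH, dT, dPhi]⟩,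
    isTimelike_vI (by linarith) (by linarith), by simp [IsFutureDirected, vI, dT]⟩

end Kerr

namespace Kerr

/-! ### Ordinary differential equations and monotonicity -/

/-- A solution of an autonomous equation on `]a, b[` which stays in a compact subset of the domain
of the vector field extends beyond `b`. -/
theorem exists_solution_extension {E : Type*} [NormedAddCommGroup E] [NormedSpace ℝ E]
    [CompleteSpace E] {F : E → E} {U C : Set E} (hU : IsOpen U) (hF : ContDiffOn ℝ 1 F U)
    (hC : IsCompact C) (hCU : C ⊆ U) {y : ℝ → E} {a b : ℝ} (hab : a < b)
    (hy : ∀ s ∈ Set.Ioo a b, HasDerivAt y (F (y s)) s) (hyC : ∀ s ∈ Set.Ioo a b, y s ∈ C) :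
    ∃ b' > b, ∃ z : ℝ → E, (∀ s ∈ Set.Ioo a b', z s ∈ U ∧ HasDerivAt z (F (z s)) s) ∧
      Set.EqOn z y (Set.Ioo a b) := by
  obtain ⟨A, hA⟩ := hC.exists_bound_of_continuousOn (hF.continuousOn.mono hCU)
  have hlip : LipschitzOnWith (Real.toNNReal A) y (Set.Ioo a b) := by
    refine Convex.lipschitzOnWith_of_nnnorm_hasDerivWithin_le (convex_Ioo a b)
      (fun s hs => (hy s hs).hasDerivWithinAt) fun s hs => ?_
    rw [← NNReal.coe_le_coe]
    exact (hA _ (hyC s hs)).trans (Real.le_coe_toNNReal A)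
  have hmem : Set.Ioo a b ∈ 𝓝[<] b := Ioo_mem_nhdsLT hab
  -- The field is bounded on `C`, so `y` is Lipschitz and has a limit `p ∈ C` at `b`. A local
  -- solution through `p` is glued on there.
  have hcau : Cauchy (map y (𝓝[<] b)) :=
    (cauchy_nhds.mono nhdsWithin_le_nhds).map_of_le hlip.uniformContinuousOn
      (le_principal_iff.2 hmem)
  obtain ⟨p, hp⟩ := CompleteSpace.complete hcau
  have hp : Tendsto y (𝓝[<] b) (𝓝 p) := hp
  have hpC : p ∈ C := hC.isClosed.mem_of_tendsto hp (by filter_upwards [hmem] with s hs using hyC s hs)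
  have hFp : ContDiffAt ℝ 1 F p := hF.contDiffAt (hU.mem_nhds (hCU hpC))
  obtain ⟨α, hαb, ε, hε, hα⟩ :=
    hFp.exists_forall_mem_closedBall_exists_eq_forall_mem_Ioo_hasDerivAt₀ b
  have hα0 : HasDerivAt α (F p) b := by
    have := hα b ⟨by linarith, by linarith⟩
    rwa [hαb] at this
  have hαU : ∀ᶠ s in 𝓝 b, α s ∈ U :=
    hα0.continuousAt.eventually_mem (hU.mem_nhds (hαb ▸ hCU hpC))
  obtain ⟨δ, hδ, hδU⟩ := Metric.eventually_nhds_iff.1 hαU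
  set z : ℝ → E := fun s => if s < b then y s else α s with hz
  have hzy : ∀ s, s < b → z s = y s := fun s hs => if_pos hs
  have hzα : ∀ s, b ≤ s → z s = α s := fun s hs => if_neg (not_lt.2 hs)
  have hzp : z b = p := (hzα b le_rfl).trans hαb
  refine ⟨b + min ε δ, by have := lt_min hε hδ; linarith, z, fun s hs => ?_,
    fun s hs => hzy s hs.2⟩
  have hs2 : s < b + min ε δ := hs.2
  have hε' := min_le_left ε δ
  have hδ' := min_le_right ε δ
  rcases lt_trichotomy s b with h | rfl | h
  · have hev : z =ᶠ[𝓝 s] y := by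
      filter_upwards [Iio_mem_nhds h] with u hu using hzy u hu
    rw [hzy s h]
    exact ⟨hCU (hyC s ⟨hs.1, h⟩), (hy s ⟨hs.1, h⟩).congr_of_eventuallyEq hev⟩
  · rw [hzp]
    refine ⟨hCU hpC, ?_⟩
    -- At the junction the left derivative is the limit of the derivatives `F (y u)`, which tend to
    -- `F p` by continuity.
    have hleft : HasDerivWithinAt z (F p) (Set.Iic s) s := by
      have hzd : ∀ u ∈ Set.Ioo a s, HasDerivAt z (F (y u)) u := fun u hu =>
        (hy u hu).congr_of_eventuallyEq
          (by filter_upwards [Iio_mem_nhds hu.2] with w hw using hzy w hw)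
      refine hasDerivWithinAt_Iic_of_tendsto_deriv (s := Set.Ioo a s)
        (fun u hu => (hzd u hu).differentiableAt.differentiableWithinAt) ?_ hmem ?_
      · rw [ContinuousWithinAt, hzp]
        refine (hp.mono_left (nhdsWithin_mono _ fun u hu => hu.2)).congr' ?_
        filter_upwards [self_mem_nhdsWithin] with u hu using (hzy u hu.2).symm
      · refine (hFp.continuousAt.tendsto.comp hp).congr' ?_
        filter_upwards [hmem] with u hu using (hzd u hu).deriv.symm
    have hright : HasDerivWithinAt z (F p) (Set.Ici s) s :=
      hα0.hasDerivWithinAt.congr (fun u hu => hzα u hu) (hzα s le_rfl)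
    have := hleft.union hright
    rwa [Set.Iic_union_Ici, hasDerivWithinAt_univ] at this
  · have hev : z =ᶠ[𝓝 s] α := by
      filter_upwards [Ioi_mem_nhds h] with u hu using hzα u (le_of_lt hu)
    rw [hzα s h.le]
    refine ⟨hδU ?_, (hα s ⟨by linarith, by linarith⟩).congr_of_eventuallyEq hev⟩
    rw [Real.dist_eq, abs_lt]
    constructor <;> linarith

/-- A function with negative derivative at its zeros has at most one zero. -/
lemma eq_zero_unique_of_deriv_neg {f f' : ℝ → ℝ} {a b : ℝ} (hab : a < b)
    (hf : ∀ s ∈ Set.Icc a b, HasDerivAt f (f' s) s)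
    (hneg : ∀ s ∈ Set.Icc a b, f s = 0 → f' s < 0) (ha : f a = 0) : f b ≠ 0 := by
  intro hb
  have hle : ∀ ⦃s⦄, s ∈ Set.Icc a b → f s ≤ 0 :=
    image_le_of_deriv_right_lt_deriv_boundary (B := fun _ => 0) (B' := fun _ => 0)
      (fun s hs => (hf s hs).continuousAt.continuousWithinAt)
      (fun s hs => (hf s (Set.Ico_subset_Icc_self hs)).hasDerivWithinAt) ha.le
      (fun s => hasDerivAt_const s 0) fun s hs => hneg s (Set.Ico_subset_Icc_self hs)
  have hbI : b ∈ Set.Icc a b := ⟨hab.le, le_rfl⟩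
  have h1 := hasDerivAt_iff_tendsto_slope_left_right.1 (hf b hbI) |>.1
  -- A zero at `b` with negative derivative makes `f` positive just to its left, contradicting `f ≤
  -- 0`.
  have h2 : ∀ᶠ s in 𝓝[<] b, slope f b s < 0 := h1.eventually_lt_const (hneg b hbI hb)
  obtain ⟨s, hs, hs'⟩ := (h2.and (Ioo_mem_nhdsLT hab)).exists
  rw [slope_def_field, hb, sub_zero] at hs
  have := hle ⟨hs'.1.le, hs'.2.le⟩
  exact absurd hs (not_lt.2 (div_nonneg_of_nonpos this (by linarith [hs'.2])))

/-- A continuous function with at most one zero has a constant sign near the lower end. -/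
lemma exists_sign_of_eq_zero_unique {f : ℝ → ℝ} {J : Set ℝ} (hJ : J.OrdConnected)
    (hne : J.Nonempty) (hf : ContinuousOn f J)
    (h : ∀ a ∈ J, ∀ b ∈ J, a < b → f a = 0 → f b ≠ 0) :
    ∃ s₁ ∈ J, (∀ s ∈ J, s < s₁ → 0 < f s) ∨ (∀ s ∈ J, s < s₁ → f s < 0) := by
  obtain ⟨s₁, h1, h2⟩ : ∃ s₁ ∈ J, ∀ s ∈ J, s < s₁ → f s ≠ 0 := by
    by_cases hz : ∃ s ∈ J, f s = 0
    · obtain ⟨s₁, h1, h2⟩ := hz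
      exact ⟨s₁, h1, fun s hs hlt h0 => h s hs s₁ h1 hlt h0 h2⟩
    · push Not at hz
      obtain ⟨s₁, h1⟩ := hne
      exact ⟨s₁, h1, fun s hs _ => hz s hs⟩
  refine ⟨s₁, h1, ?_⟩
  by_contra! hcon
  obtain ⟨⟨u, hu, hu1, hu2⟩, w, hw, hw1, hw2⟩ := hcon
  have hsub : Set.uIcc u w ⊆ J := hJ.uIcc_subset hu hw
  obtain ⟨c, hc, hc0⟩ := intermediate_value_uIcc (hf.mono hsub) (Set.mem_uIcc.2 (.inl ⟨hu2, hw2⟩))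
  refine h2 c (hsub hc) ?_ hc0
  rcases Set.mem_uIcc.1 hc with hc | hc <;> linarith [hc.2]

/-- A function on a half-line whose derivative is bounded below is unbounded. -/
lemma not_bounded_of_deriv_ge {f f' : ℝ → ℝ} {c B s₁ : ℝ} (hc : 0 < c)
    (hf : ∀ s < s₁, HasDerivAt f (f' s) s) (hf' : ∀ s < s₁, c ≤ f' s)
    (hB : ∀ s < s₁, |f s| ≤ B) : False := by
  set u := s₁ - 1 with hu
  -- The length is chosen so that `f` increases by at least `2B + 1` from `w` to `u`, more than `|f|
  -- ≤ B` allows.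
  set w := u - (2 * B + 1) / c with hw
  have hB0 : 0 ≤ B := (abs_nonneg _).trans (hB u (by linarith))
  have hpos : 0 < (2 * B + 1) / c := by positivity
  have h1 := (convex_Icc w u).mul_sub_le_image_sub_of_le_deriv (f := f) (C := c)
    (fun s hs => (hf s (by linarith [hs.2])).continuousAt.continuousWithinAt)
    (fun s hs => (hf s (by linarith [(interior_subset hs).2])).differentiableAt.differentiableWithinAt)
    (fun s hs => by
      have hlt : s < s₁ := by linarith [(interior_subset hs).2]
      rw [(hf s hlt).deriv]
      exact hf' s hlt) w ⟨le_rfl, by linarith⟩ u ⟨by linarith, le_rfl⟩ (by linarith)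
  have h2 : c * (u - w) = 2 * B + 1 := by rw [hw]; field_simp; ring
  have h3 := abs_le.1 (hB u (by linarith))
  have h4 := abs_le.1 (hB w (by linarith))
  linarith

end Kerr

namespace Kerr

/-! ### Smoothness of the metric and the Euler-Lagrange identity -/

lemma metricComp_comm (M a : ℝ) (i j : Fin 4) : metricComp M a i j = metricComp M a j i :=
  funext fun _ => metric_comm M a _ _ _

lemma metric_eq_sum (M a : ℝ) (x v w : Pt) :
    metric M a x v w = ∑ i, ∑ j, metricComp M a i j x * v i * w j := by
  simp only [Fin.sum_univ_four, metricComp, metric, sphereMetric, sinSqDphi, dr]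
  simp
  ring

lemma isOpen_exterior (M a : ℝ) : IsOpen (exterior M a) := by
  have hc : Continuous rad := by unfold rad; fun_prop
  exact isOpen_lt continuous_const hc

section Exterior

variable {M a : ℝ} {x : Pt}

lemma rad_pos_of_mem (h : |a| < M) (hx : x ∈ exterior M a) : 0 < rad x := by
  have h1 : rPlus M a < rad x := hx
  linarith [lt_rPlus h, abs_nonneg a]

lemma Delta_pos_of_mem (h : |a| < M) (hx : x ∈ exterior M a) : 0 < Delta M a (rad x) :=
  Delta_pos h hx

lemma contDiffAt_rad (hr : 0 < rad x) : ContDiffAt ℝ 2 rad x := by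
  have h : x 1 ^ 2 + x 2 ^ 2 + x 3 ^ 2 ≠ 0 := by rw [← rad_sq]; positivity
  unfold rad
  refine ContDiffAt.sqrt ?_ h
  fun_prop

lemma contDiffAt_metricComp (h : |a| < M) (hx : x ∈ exterior M a) (i j : Fin 4) :
    ContDiffAt ℝ 2 (metricComp M a i j) x := by
  have hr := rad_pos_of_mem h hx
  have hr0 := hr.ne'
  have hr2 : rad x ^ 2 ≠ 0 := pow_ne_zero 2 hr0
  have hΔ := (Delta_pos_of_mem h hx).ne'
  have hρ := (rhoSq_pos a hr).ne'
  have hrad := contDiffAt_rad hr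
  have hdr (v : Pt) : ContDiffAt ℝ 2 (fun x => dr x v) x := by
    unfold dr
    exact ContDiffAt.div (by fun_prop) hrad hr0
  have hb (v : Pt) : ContDiffAt ℝ 2 (fun x => sinSqDphi x v) x := by
    unfold sinSqDphi
    exact ContDiffAt.div (by fun_prop) (hrad.pow 2) hr2
  have hS (v w : Pt) : ContDiffAt ℝ 2 (fun x => sphereMetric x v w) x := by
    unfold sphereMetric
    exact ContDiffAt.div (contDiffAt_const.sub ((hdr v).mul (hdr w))) (hrad.pow 2) hr2
  have hρ' : ContDiffAt ℝ 2 (rhoSq a) x := by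
    unfold rhoSq cosTheta
    exact (hrad.pow 2).add (contDiffAt_const.mul ((ContDiffAt.div (by fun_prop) hrad hr0).pow 2))
  have hΔ' : ContDiffAt ℝ 2 (fun x => Delta M a (rad x)) x := by
    unfold Delta
    exact ((hrad.pow 2).sub (contDiffAt_const.mul hrad)).add contDiffAt_const
  have hu (k : ℝ) : ContDiffAt ℝ 2 (fun x => k * rad x / rhoSq a x) x :=
    (contDiffAt_const.mul hrad).div hρ' hρ
  unfold metricComp metric
  exact (((((contDiffAt_const.sub (hu _)).neg.mul contDiffAt_const).sub
    ((hu _).mul ((contDiffAt_const.mul (hb _)).add (contDiffAt_const.mul (hb _))))).add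
    ((hρ'.div hΔ' hΔ).mul ((hdr _).mul (hdr _)))).add (hρ'.mul (hS _ _))).add
    ((contDiffAt_const.mul (contDiffAt_const.add (hu _))).mul ((hb _).mul (hb _)))

lemma hasDerivAt_metricComp (h : |a| < M) {y : ℝ → Pt} {u : Pt} {s : ℝ}
    (hx : y s ∈ exterior M a) (hy : HasDerivAt y u s) (i j : Fin 4) :
    HasDerivAt (fun s => metricComp M a i j (y s))
      (∑ k, u k * partialDeriv k (metricComp M a i j) (y s)) s := by
  have hd := ((contDiffAt_metricComp h hx i j).differentiableAt (by norm_num)).hasFDerivAt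
  refine (hd.comp_hasDerivAt s hy).congr_deriv ?_
  conv_lhs => rw [pi_eq_sum_univ' u]
  simp [partialDeriv, map_sum]

lemma hasDerivAt_metric (h : |a| < M) {y v w : ℝ → Pt} {y' v' w' : Pt} {s : ℝ}
    (hx : y s ∈ exterior M a) (hy : HasDerivAt y y' s) (hv : HasDerivAt v v' s)
    (hw : HasDerivAt w w' s) :
    HasDerivAt (fun s => metric M a (y s) (v s) (w s))
      (∑ i, ∑ j, (((∑ k, y' k * partialDeriv k (metricComp M a i j) (y s)) * v s i
        + metricComp M a i j (y s) * v' i) * w s j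
        + metricComp M a i j (y s) * v s i * w' j)) s := by
  simp only [metric_eq_sum]
  refine HasDerivAt.fun_sum fun i _ => HasDerivAt.fun_sum fun j _ => ?_
  exact ((hasDerivAt_metricComp h hx hy i j).mul (hasDerivAt_pi.1 hv i)).mul (hasDerivAt_pi.1 hw j)

end Exterior

variable {M a : ℝ}

lemma IsGeodesicOn.hasDerivAt {γ : ℝ → Pt} {J : Set ℝ} (hJ : IsOpen J)
    (hg : IsGeodesicOn M a γ J) {s : ℝ} (hs : s ∈ J) : HasDerivAt γ (deriv γ s) s :=
  ((hg.2.1.contDiffAt (hJ.mem_nhds hs)).differentiableAt (by norm_num)).hasDerivAt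

lemma IsGeodesicOn.hasDerivAt_deriv {γ : ℝ → Pt} {J : Set ℝ} (hJ : IsOpen J)
    (hg : IsGeodesicOn M a γ J) {s : ℝ} (hs : s ∈ J) :
    HasDerivAt (deriv γ) (deriv (deriv γ) s) s := by
  have h : ContDiffOn ℝ (1 + 1) γ J := by simpa [one_add_one_eq_two] using hg.2.1
  have h1 := ((contDiffOn_succ_iff_deriv_of_isOpen hJ).1 h).2.2
  exact ((h1.contDiffAt (hJ.mem_nhds hs)).differentiableAt (by norm_num)).hasDerivAt

/-- The Euler-Lagrange identity `d/ds g(X, γ') = ½ (𝓛_X g)(γ', γ')` for an affine vector field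
`X = b + B x`. -/
theorem IsGeodesicOn.hasDerivAt_metric_affine (h : |a| < M) {γ : ℝ → Pt} {J : Set ℝ}
    (hJ : IsOpen J) (hg : IsGeodesicOn M a γ J) {s : ℝ} (hs : s ∈ J) (b : Pt) (B : Pt →L[ℝ] Pt)
    {D : ℝ} (hD : HasDerivAt (fun ε : ℝ => metric M a (γ s + ε • (b + B (γ s)))
      (deriv γ s + ε • B (deriv γ s)) (deriv γ s + ε • B (deriv γ s))) D 0) :
    HasDerivAt (fun s => metric M a (γ s) (b + B (γ s)) (deriv γ s)) (D / 2) s := by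
  have hγ := hg.hasDerivAt hJ hs
  have hγ' := hg.hasDerivAt_deriv hJ hs
  have hB : HasDerivAt (fun s => b + B (γ s)) (B (deriv γ s)) s :=
    (B.hasFDerivAt.comp_hasDerivAt s hγ).const_add b
  have h1 := hasDerivAt_metric h (hg.1 s hs) hγ hB hγ'
  have hlin (p q : Pt) : HasDerivAt (fun ε : ℝ => p + ε • q) q 0 := by
    simpa using ((hasDerivAt_id (0 : ℝ)).smul_const q).const_add p
  have h2 := hasDerivAt_metric h (y := fun ε : ℝ => γ s + ε • (b + B (γ s))) (s := 0)
    (by simpa using hg.1 s hs) (hlin _ _) (hlin (deriv γ s) (B (deriv γ s)))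
    (hlin (deriv γ s) (B (deriv γ s)))
  have h3 := hD.unique h2
  refine h1.congr_deriv ?_
  have g0 := hg.2.2 s hs 0
  have g1 := hg.2.2 s hs 1
  have g2 := hg.2.2 s hs 2
  have g3 := hg.2.2 s hs 3
  -- The two derivatives differ by the geodesic equation contracted with `X`: the derivative of
  -- `g(X, γ')` contains `g(X, γ'')`, which the Christoffel terms replace by half the derivative of
  -- `g` along `X`.
  rw [h3]
  simp only [zero_smul, add_zero]
  simp only [christoffel, Fin.sum_univ_four, metricComp_comm M a 1 0, metricComp_comm M a 2 0,
    metricComp_comm M a 3 0, metricComp_comm M a 2 1, metricComp_comm M a 3 1,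
    metricComp_comm M a 3 2] at g0 g1 g2 g3 ⊢
  generalize b + B (γ s) = X at *
  generalize B (deriv γ s) = Bv at *
  linear_combination X 0 * g0 + X 1 * g1 + X 2 * g2 + X 3 * g3

end Kerr

namespace Kerr

/-! ### The geodesic equation as a first order system -/

lemma contDiffAt_det {E ι : Type*} [NormedAddCommGroup E] [NormedSpace ℝ E] [Fintype ι]
    [DecidableEq ι] {n : WithTop ℕ∞} {A : E → Matrix ι ι ℝ} {x : E}
    (hA : ∀ i j, ContDiffAt ℝ n (fun y => A y i j) x) : ContDiffAt ℝ n (fun y => (A y).det) x := by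
  simp only [Matrix.det_apply]
  exact ContDiffAt.sum fun σ _ => (contDiffAt_prod fun i _ => hA _ _).const_smul _

lemma contDiffAt_matrix_inv {E ι : Type*} [NormedAddCommGroup E] [NormedSpace ℝ E] [Fintype ι]
    [DecidableEq ι] {n : WithTop ℕ∞} {A : E → Matrix ι ι ℝ} {x : E}
    (hA : ∀ i j, ContDiffAt ℝ n (fun y => A y i j) x) (hdet : (A x).det ≠ 0) (i j : ι) :
    ContDiffAt ℝ n (fun y => (A y)⁻¹ i j) x := by
  simp only [Matrix.inv_def, Matrix.smul_apply, Ring.inverse_eq_inv', Matrix.adjugate_apply,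
    smul_eq_mul]
  refine ((contDiffAt_det hA).inv hdet).mul (contDiffAt_det fun k l => ?_)
  by_cases hk : k = j
  · subst hk
    simp only [Matrix.updateRow_self]
    exact contDiffAt_const
  · simp only [Matrix.updateRow_ne hk]
    exact hA k l

/-- The matrix of the metric. -/
noncomputable def metricMatrix (M a : ℝ) (x : Pt) : Matrix (Fin 4) (Fin 4) ℝ :=
  fun i j => metricComp M a i j x

section Exterior

variable {M a : ℝ} {x : Pt}

/-- The Kerr metric is nondegenerate. -/
lemma eq_zero_of_metric_eq_zero (h : |a| < M) (hx : x ∈ exterior M a) {w : Pt}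
    (hw : ∀ u, metric M a x u w = 0) : w = 0 := by
  have hr := rad_pos_of_mem h hx
  have hΔ := (Delta_pos_of_mem h hx).ne'
  have hρ := (rhoSq_pos a hr).ne'
  have hE : energy M a x w = 0 := by rw [energy, hw, neg_zero]
  have hL : angMom M a x w = 0 := hw _
  have h2 := radialP_eq M a hr w
  have h3 := angMom_sub M a hr w
  rw [hE, hL] at h2 h3
  have h4 : w 0 = a * sinSqDphi x w := by
    have : Delta M a (rad x) * (w 0 - a * sinSqDphi x w) = 0 := by rw [← h2]; ring
    linarith [(mul_eq_zero.1 this).resolve_left hΔ]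
  have hb : sinSqDphi x w = 0 := by
    have : rhoSq a x * sinSqDphi x w = 0 := by
      rw [h4] at h3
      rw [rhoSq]
      linear_combination -h3
    exact (mul_eq_zero.1 this).resolve_left hρ
  have h0 : w 0 = 0 := by rw [h4, hb, mul_zero]
  have hp : dr x w = 0 := by
    have := hw (dR x)
    rw [metric_dR M a hr] at this
    exact (mul_eq_zero.1 this).resolve_left (div_ne_zero hρ hΔ)
  refine eq_zero_of_components hr h0 hp ?_
  -- Testing against `∂_t`, `∂_φ` and `∂_r` has removed all but the spherical part, on which the
  -- metric is definite.
  have := hw w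
  rw [metric, h0, hp, hb] at this
  exact (mul_eq_zero.1 (by linarith : rhoSq a x * sphereMetric x w w = 0)).resolve_left hρ

lemma det_metricMatrix_ne_zero (h : |a| < M) (hx : x ∈ exterior M a) :
    (metricMatrix M a x).det ≠ 0 := by
  intro hdet
  obtain ⟨w, hw0, hw⟩ := Matrix.exists_mulVec_eq_zero_iff.2 hdet
  refine hw0 (eq_zero_of_metric_eq_zero h hx fun u => ?_)
  rw [metric_eq_sum]
  refine Finset.sum_eq_zero fun i _ => ?_
  have hi : ∑ j, metricComp M a i j x * w j = 0 := congrFun hw i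
  calc ∑ j, metricComp M a i j x * u i * w j = u i * ∑ j, metricComp M a i j x * w j := by
        rw [Finset.mul_sum]
        exact Finset.sum_congr rfl fun j _ => by ring
    _ = 0 := by rw [hi, mul_zero]

lemma contDiffAt_christoffel (h : |a| < M) (hx : x ∈ exterior M a) (k i j : Fin 4) :
    ContDiffAt ℝ 1 (christoffel M a k i j) x := by
  have hp (m i j : Fin 4) : ContDiffAt ℝ 1 (partialDeriv m (metricComp M a i j)) x :=
    ((contDiffAt_metricComp h hx i j).fderiv_right (m := 1) (by norm_num)).clm_apply
      contDiffAt_const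
  unfold christoffel
  exact (((hp _ _ _).add (hp _ _ _)).sub (hp _ _ _)).div_const 2

end Exterior

/-- The covector `Γ_{k,ij} vⁱ vʲ`. -/
noncomputable def christoffelForm (M a : ℝ) (z : Pt × Pt) : Pt :=
  fun k => ∑ i, ∑ j, christoffel M a k i j z.1 * z.2 i * z.2 j

/-- The geodesic vector field on the tangent bundle. -/
noncomputable def geodesicField (M a : ℝ) (z : Pt × Pt) : Pt × Pt :=
  (z.2, -((metricMatrix M a z.1)⁻¹.mulVec (christoffelForm M a z)))

lemma contDiffOn_geodesicField {M a : ℝ} (h : |a| < M) :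
    ContDiffOn ℝ 1 (geodesicField M a) (exterior M a ×ˢ Set.univ) := by
  rintro ⟨x, v⟩ ⟨hx, -⟩
  have hx : x ∈ exterior M a := hx
  refine ContDiffAt.contDiffWithinAt (contDiffAt_snd.prodMk (contDiffAt_pi.2 fun k => ?_))
  have hinv (l : Fin 4) :
      ContDiffAt ℝ 1 (fun z : Pt × Pt => (metricMatrix M a z.1)⁻¹ k l) (x, v) :=
    ContDiffAt.comp (x, v) (g := fun x => (metricMatrix M a x)⁻¹ k l)
      (contDiffAt_matrix_inv (fun i j => (contDiffAt_metricComp h hx i j).of_le (by norm_num))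
        (det_metricMatrix_ne_zero h hx) k l) contDiffAt_fst
  have hv (i : Fin 4) : ContDiffAt ℝ 1 (fun z : Pt × Pt => z.2 i) (x, v) := by fun_prop
  have hform (l : Fin 4) : ContDiffAt ℝ 1 (fun z => christoffelForm M a z l) (x, v) :=
    ContDiffAt.sum fun i _ => ContDiffAt.sum fun j _ =>
      ((ContDiffAt.comp (x, v) (g := christoffel M a l i j) (contDiffAt_christoffel h hx l i j)
        contDiffAt_fst).mul (hv i)).mul (hv j)
  simp only [Pi.neg_apply, Matrix.mulVec, dotProduct]
  exact (ContDiffAt.sum fun l _ => (hinv l).mul (hform l)).neg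

/-! ### Geodesics as integral curves in phase space, and their extension -/

section Geodesic

variable {M a : ℝ} {γ : ℝ → Pt} {J : Set ℝ}

lemma IsGeodesicOn.hasDerivAt_phase (h : |a| < M) (hJ : IsOpen J) (hg : IsGeodesicOn M a γ J)
    {s : ℝ} (hs : s ∈ J) :
    HasDerivAt (fun s => (γ s, deriv γ s)) (geodesicField M a (γ s, deriv γ s)) s := by
  refine ((hg.hasDerivAt hJ hs).prodMk (hg.hasDerivAt_deriv hJ hs)).congr_deriv ?_
  refine Prod.ext rfl ?_
  have hdet := det_metricMatrix_ne_zero h (hg.1 s hs)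
  have h1 : (metricMatrix M a (γ s)).mulVec (deriv (deriv γ) s)
      = -christoffelForm M a (γ s, deriv γ s) := by
    ext k
    exact eq_neg_of_add_eq_zero_left (hg.2.2 s hs k)
  have h2 := congrArg ((metricMatrix M a (γ s))⁻¹.mulVec) h1
  rw [Matrix.mulVec_mulVec, Matrix.nonsing_inv_mul _ (isUnit_iff_ne_zero.2 hdet),
    Matrix.one_mulVec, Matrix.mulVec_neg] at h2
  exact h2

lemma isGeodesicOn_of_hasDerivAt_phase (h : |a| < M) (hJ : IsOpen J) {z : ℝ → Pt × Pt}
    (hz : ∀ s ∈ J, z s ∈ exterior M a ×ˢ (Set.univ : Set Pt) ∧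
      HasDerivAt z (geodesicField M a (z s)) s) : IsGeodesicOn M a (fun s => (z s).1) J := by
  have h1 : ∀ s ∈ J, HasDerivAt (fun s => (z s).1) (z s).2 s := fun s hs =>
    ((hz s hs).2.fst : _)
  have h2 : ∀ s ∈ J, HasDerivAt (fun s => (z s).2) (geodesicField M a (z s)).2 s := fun s hs =>
    ((hz s hs).2.snd : _)
  have hd1 : ∀ s ∈ J, deriv (fun s => (z s).1) s = (z s).2 := fun s hs => (h1 s hs).deriv
  have hd2 : ∀ s ∈ J, deriv (deriv fun s => (z s).1) s = (geodesicField M a (z s)).2 := by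
    intro s hs
    have : deriv (fun s => (z s).1) =ᶠ[𝓝 s] fun s => (z s).2 := by
      filter_upwards [hJ.mem_nhds hs] with u hu using hd1 u hu
    rw [this.deriv_eq]
    exact (h2 s hs).deriv
  have hzc : ContinuousOn z J := fun s hs => (hz s hs).2.continuousAt.continuousWithinAt
  have hFc : ContinuousOn (fun s => geodesicField M a (z s)) J :=
    (contDiffOn_geodesicField h).continuousOn.comp hzc fun s hs => (hz s hs).1
  refine ⟨fun s hs => (hz s hs).1.1, ?_, fun s hs k => ?_⟩
  · have hz1 : ContDiffOn ℝ 1 (fun s => (z s).2) J := by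
      have : ContDiffOn ℝ (0 + 1) (fun s => (z s).2) J := by
        refine (contDiffOn_succ_iff_deriv_of_isOpen hJ).2
          ⟨fun s hs => (h2 s hs).differentiableAt.differentiableWithinAt, by simp, ?_⟩
        refine contDiffOn_zero.2 (hFc.snd.congr fun s hs => ?_)
        exact (h2 s hs).deriv
      simpa using this
    have : ContDiffOn ℝ (1 + 1) (fun s => (z s).1) J :=
      (contDiffOn_succ_iff_deriv_of_isOpen hJ).2
        ⟨fun s hs => (h1 s hs).differentiableAt.differentiableWithinAt, by simp,
          hz1.congr fun s hs => hd1 s hs⟩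
    simpa [one_add_one_eq_two] using this
  · have hdet := det_metricMatrix_ne_zero h (hz s hs).1.1
    have h3 : (metricMatrix M a (z s).1).mulVec (geodesicField M a (z s)).2
        = -christoffelForm M a (z s) := by
      rw [geodesicField, Matrix.mulVec_neg, Matrix.mulVec_mulVec,
        Matrix.mul_nonsing_inv _ (isUnit_iff_ne_zero.2 hdet), Matrix.one_mulVec]
    rw [hd1 s hs, hd2 s hs]
    have h4 := congrFun h3 k
    rw [Pi.neg_apply] at h4
    exact eq_neg_iff_add_eq_zero.1 h4

/-- Being a geodesic is a local condition, so a curve glued from two geodesics that agree on an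
overlap is again one. -/
lemma isGeodesicOn_of_locally (hl : ∀ s ∈ J, ∃ β : ℝ → Pt, ∃ V, IsOpen V ∧ s ∈ V ∧
    IsGeodesicOn M a β V ∧ Set.EqOn γ β V) : IsGeodesicOn M a γ J := by
  refine ⟨fun s hs => ?_, fun s hs => ?_, fun s hs k => ?_⟩
  all_goals
    obtain ⟨β, V, hV, hsV, hβ, hEq⟩ := hl s hs
    have hev : γ =ᶠ[𝓝 s] β := hEq.eventuallyEq_of_mem (hV.mem_nhds hsV)
  · rw [hEq hsV]
    exact hβ.1 s hsV
  · exact ((hβ.2.1.contDiffAt (hV.mem_nhds hsV)).congr_of_eventuallyEq hev).contDiffWithinAt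
  · rw [hev.deriv_eq, hev.deriv.deriv_eq, hev.eq_of_nhds]
    exact hβ.2.2 s hsV k

lemma IsGeodesicOn.comp_neg (hg : IsGeodesicOn M a γ J) :
    IsGeodesicOn M a (fun s => γ (-s)) (Neg.neg ⁻¹' J) := by
  have h1 : deriv (fun s => γ (-s)) = fun s => -deriv γ (-s) := funext fun s => deriv_comp_neg γ s
  have h2 : deriv (deriv fun s => γ (-s)) = fun s => deriv (deriv γ) (-s) := by
    rw [h1]
    funext s
    rw [deriv.fun_neg, deriv_comp_neg, neg_neg]
  refine ⟨fun s hs => hg.1 _ hs, hg.2.1.comp contDiff_neg.contDiffOn fun s hs => hs,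
    fun s hs k => ?_⟩
  rw [h2, h1]
  simpa using hg.2.2 (-s) hs k

lemma isOpen_interval (sm sp : EReal) : IsOpen (interval sm sp) :=
  isOpen_Ioo.preimage continuous_coe_real_ereal

lemma ordConnected_interval (sm sp : EReal) : (interval sm sp).OrdConnected :=
  ⟨fun _ hx _ hy _ hz => ⟨hx.1.trans_le (EReal.coe_le_coe_iff.2 hz.1),
    (EReal.coe_le_coe_iff.2 hz.2).trans_lt hy.2⟩⟩

lemma nonempty_interval {sm sp : EReal} (h : sm < sp) : (interval sm sp).Nonempty := by
  obtain ⟨s, h1, h2⟩ := EReal.lt_iff_exists_real_btwn.1 h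
  exact ⟨s, h1, h2⟩

lemma neg_mem_interval {sm sp : EReal} {s : ℝ} : -s ∈ interval sm sp ↔ s ∈ interval (-sp) (-sm) := by
  simp only [interval, Set.mem_ofPred_eq, EReal.coe_neg]
  rw [EReal.lt_neg_comm, EReal.neg_lt_comm, and_comm]

/-- A geodesic which stays in a compact part of phase space as its affine parameter tends to a
finite value is extendible. -/
theorem IsGeodesicOn.exists_extension (h : |a| < M) {sm : EReal} {b s₀ : ℝ}
    (hg : IsGeodesicOn M a γ (interval sm b)) (hs₀ : s₀ ∈ interval sm b) {C : Set (Pt × Pt)}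
    (hC : IsCompact C) (hCU : C ⊆ exterior M a ×ˢ Set.univ)
    (hγC : ∀ s ∈ Set.Ioo s₀ b, (γ s, deriv γ s) ∈ C) :
    ∃ b' > b, ∃ δ : ℝ → Pt, IsGeodesicOn M a δ (interval sm (b' : ℝ)) ∧
      Set.EqOn δ γ (interval sm b) := by
  have hs₀b : s₀ < b := EReal.coe_lt_coe_iff.1 hs₀.2
  have hsub : Set.Ioo s₀ b ⊆ interval sm b := fun s hs =>
    ⟨hs₀.1.trans (EReal.coe_lt_coe_iff.2 hs.1), EReal.coe_lt_coe_iff.2 hs.2⟩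
  obtain ⟨b', hb', z, hz, hzy⟩ := exists_solution_extension
    ((isOpen_exterior M a).prod isOpen_univ) (contDiffOn_geodesicField h) hC hCU hs₀b
    (fun s hs => hg.hasDerivAt_phase h (isOpen_interval _ _) (hsub hs)) hγC
  have hzg := isGeodesicOn_of_hasDerivAt_phase h isOpen_Ioo hz
  set δ : ℝ → Pt := fun s => if s < b then γ s else (z s).1 with hδ
  have hδγ : ∀ s, s < b → δ s = γ s := fun s hs => if_pos hs
  refine ⟨b', hb', δ, isGeodesicOn_of_locally fun s hs => ?_,
    fun s hs => hδγ s (EReal.coe_lt_coe_iff.1 hs.2)⟩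
  rcases lt_or_ge s b with hsb | hsb
  · exact ⟨γ, interval sm b, isOpen_interval _ _, ⟨hs.1, EReal.coe_lt_coe_iff.2 hsb⟩, hg,
      fun u hu => hδγ u (EReal.coe_lt_coe_iff.1 hu.2)⟩
  · refine ⟨_, Set.Ioo s₀ b', isOpen_Ioo, ⟨hs₀b.trans_le hsb, EReal.coe_lt_coe_iff.1 hs.2⟩, hzg,
      fun u hu => ?_⟩
    rcases lt_or_ge u b with hub | hub
    · rw [hδγ u hub, hzy ⟨hu.1, hub⟩]
    · exact if_neg (not_lt.2 hub)

end Geodesic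

/-- `γ` is a null geodesic which is maximal in the exterior. -/
structure IsMaximalNullGeodesic (M a : ℝ) (γ : ℝ → Pt) (sm sp : EReal) : Prop where
  lt : sm < sp
  geodesic : IsGeodesicOn M a γ (interval sm sp)
  null : ∀ s ∈ interval sm sp, IsNull M a (γ s) (deriv γ s)
  maximal : ∀ (δ : ℝ → Pt) (um up : EReal), um ≤ sm → sp ≤ up →
    IsGeodesicOn M a δ (interval um up) → Set.EqOn δ γ (interval sm sp) → um = sm ∧ up = sp

section Maximal

variable {M a : ℝ} {γ : ℝ → Pt} {sm sp : EReal}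

lemma IsFutureNullGeodesic.isMaximal (h : IsFutureNullGeodesic M a γ sm sp) :
    IsMaximalNullGeodesic M a γ sm sp :=
  ⟨h.lt, h.geodesic, h.null, h.maximal⟩

lemma IsMaximalNullGeodesic.comp_neg (h : IsMaximalNullGeodesic M a γ sm sp) :
    IsMaximalNullGeodesic M a (fun s => γ (-s)) (-sp) (-sm) := by
  have hpre (um up : EReal) : Neg.neg ⁻¹' interval um up = interval (-up) (-um) :=
    Set.ext fun _ => neg_mem_interval
  refine ⟨EReal.neg_lt_neg_iff.2 h.lt, hpre sm sp ▸ h.geodesic.comp_neg, fun s hs => ?_,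
    fun δ um up hum hup hδ hEq => ?_⟩
  · have := h.null (-s) (neg_mem_interval.2 hs)
    rw [deriv_comp_neg]
    exact ⟨neg_ne_zero.2 this.1, by rw [metric_neg_neg]; exact this.2⟩
  · have h1 := h.maximal (fun s => δ (-s)) (-up) (-um) (EReal.neg_le.1 hup) (EReal.le_neg.1 hum)
      (hpre um up ▸ hδ.comp_neg) fun s hs => by
        have := hEq (x := -s) (neg_mem_interval.1 (by simpa using hs))
        simpa using this
    exact ⟨by rw [← h1.2, neg_neg], by rw [← h1.1, neg_neg]⟩

lemma IsMaximalNullGeodesic.false_of_compact (hM : |a| < M)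
    {b s₀ : ℝ} (h : IsMaximalNullGeodesic M a γ sm b) (hs₀ : s₀ ∈ interval sm b)
    {C : Set (Pt × Pt)} (hC : IsCompact C) (hCU : C ⊆ exterior M a ×ˢ Set.univ)
    (hγC : ∀ s ∈ Set.Ioo s₀ b, (γ s, deriv γ s) ∈ C) : False := by
  obtain ⟨b', hb', δ, hδ, hEq⟩ := h.geodesic.exists_extension hM hs₀ hC hCU hγC
  have := (h.maximal δ sm b' le_rfl (EReal.coe_le_coe_iff.2 hb'.le) hδ hEq).2
  exact hb'.ne' (EReal.coe_eq_coe_iff.1 this)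

end Maximal

end Kerr

namespace Kerr

/-! ### First integrals of null geodesics -/

lemma hasDerivAt_rad {y : ℝ → Pt} {v : Pt} {s : ℝ} (hy : HasDerivAt y v s) (hr : 0 < rad (y s)) :
    HasDerivAt (fun s => rad (y s)) (dr (y s) v) s := by
  have hc (i : Fin 4) : HasDerivAt (fun s => y s i) (v i) s := hasDerivAt_pi.1 hy i
  have h0 : y s 1 ^ 2 + y s 2 ^ 2 + y s 3 ^ 2 ≠ 0 := by rw [← rad_sq]; positivity
  have h := ((((hc 1).pow 2).add ((hc 2).pow 2)).add ((hc 3).pow 2)).sqrt h0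
  refine h.congr_deriv ?_
  have : √(y s 1 ^ 2 + y s 2 ^ 2 + y s 3 ^ 2) = rad (y s) := rfl
  simp only [Pi.add_apply, Pi.pow_apply, this, dr]
  field_simp
  push_cast
  ring

/-- The generator `∂_φ` of rotations as a linear map. -/
noncomputable def rotationMap : Pt →L[ℝ] Pt :=
  LinearMap.toContinuousLinearMap
    { toFun := dPhi
      map_add' := fun x y => by ext i; fin_cases i <;> simp [dPhi]; ring
      map_smul' := fun c x => by ext i; fin_cases i <;> simp [dPhi] }

lemma rotationMap_apply (x : Pt) : rotationMap x = dPhi x := rfl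

/-- The generator `r ∂_r` of spatial dilations. -/
def dilationField (x : Pt) : Pt := ![0, x 1, x 2, x 3]

/-- The generator of spatial dilations as a linear map. -/
noncomputable def dilationMap : Pt →L[ℝ] Pt :=
  LinearMap.toContinuousLinearMap
    { toFun := dilationField
      map_add' := fun x y => by ext i; fin_cases i <;> simp [dilationField]
      map_smul' := fun c x => by ext i; fin_cases i <;> simp [dilationField] }

lemma dilationMap_apply (x : Pt) : dilationMap x = dilationField x := rfl

lemma metric_dilationField (M a : ℝ) {x : Pt} (hr : 0 < rad x) (v : Pt) :
    metric M a x (dilationField x) v = rhoSq a x / Delta M a (rad x) * (rad x * dr x v) := by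
  have h : dilationField x = rad x • dR x + 0 := by
    ext i
    fin_cases i <;> simp [dilationField, dR] <;> field_simp
  have h0 : metric M a x 0 v = 0 := by simp [metric, sphereMetric, sinSqDphi, dr]
  rw [h, metric_smul_add_left, metric_dR M a hr, h0]
  ring

/-- The metric along the flow of `∂_t`. -/
lemma metric_add_smul_dT (M a ε : ℝ) (x v w : Pt) :
    metric M a (x + ε • dT) v w = metric M a x v w := by
  have h (i : Fin 4) (hi : i ≠ 0) : (x + ε • dT) i = x i := by
    fin_cases i <;> simp_all [dT]
  simp only [metric, rhoSq, cosTheta, sphereMetric, sinSqDphi, dr, rad,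
    h 1 (by decide), h 2 (by decide), h 3 (by decide)]

/-- The segment `x + ε ∂_φ` is not an orbit of the rotations and leaves the sphere, but only at
second order. Evenness in `ε` is enough: it makes the derivative at `0` vanish. -/
lemma metric_add_smul_dPhi_even (M a ε : ℝ) (x v : Pt) :
    metric M a (x + (-ε) • dPhi x) (v + (-ε) • dPhi v) (v + (-ε) • dPhi v)
      = metric M a (x + ε • dPhi x) (v + ε • dPhi v) (v + ε • dPhi v) := by
  have hrad : rad (x + (-ε) • dPhi x) = rad (x + ε • dPhi x) := by
    simp only [rad, dPhi]
    congr 1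
    simp
    ring
  have h3 : (x + (-ε) • dPhi x) 3 = (x + ε • dPhi x) 3 := by simp [dPhi]
  have h0 : (v + (-ε) • dPhi v) 0 = (v + ε • dPhi v) 0 := by simp [dPhi]
  have hdr : dr (x + (-ε) • dPhi x) (v + (-ε) • dPhi v) = dr (x + ε • dPhi x) (v + ε • dPhi v) := by
    simp only [dr, hrad]
    congr 1
    simp [dPhi]
    ring
  have hb : sinSqDphi (x + (-ε) • dPhi x) (v + (-ε) • dPhi v)
      = sinSqDphi (x + ε • dPhi x) (v + ε • dPhi v) := by
    simp only [sinSqDphi, hrad]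
    congr 1
    simp [dPhi]
    ring
  have hS : sphereMetric (x + (-ε) • dPhi x) (v + (-ε) • dPhi v) (v + (-ε) • dPhi v)
      = sphereMetric (x + ε • dPhi x) (v + ε • dPhi v) (v + ε • dPhi v) := by
    simp only [sphereMetric, hrad, hdr]
    congr 2
    simp [dPhi]
    ring
  simp only [metric, rhoSq, cosTheta, hrad, h3, h0, hdr, hb, hS]

/-- The metric along the flow of spatial dilations. -/
lemma metric_add_smul_dilationField (M a : ℝ) {ε : ℝ} (hε : -1 < ε) {x : Pt} (hr : 0 < rad x)
    (v : Pt) :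
    metric M a (x + ε • dilationField x) (v + ε • dilationField v) (v + ε • dilationField v)
      = -(v 0 ^ 2)
        + 2 * M * ((1 + ε) * rad x) / (((1 + ε) * rad x) ^ 2 + a ^ 2 * cosTheta x ^ 2)
          * (v 0 - a * sinSqDphi x v) ^ 2
        + (((1 + ε) * rad x) ^ 2 + a ^ 2 * cosTheta x ^ 2) / Delta M a ((1 + ε) * rad x)
          * ((1 + ε) * dr x v) ^ 2
        + (((1 + ε) * rad x) ^ 2 + a ^ 2 * cosTheta x ^ 2) * sphereMetric x v v
        + a ^ 2 * sinSqDphi x v ^ 2 := by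
  have hε' : 0 < 1 + ε := by linarith
  have hx (i : Fin 4) (hi : i ≠ 0) (y : Pt) : (y + ε • dilationField y) i = (1 + ε) * y i := by
    fin_cases i <;> simp_all [dilationField] <;> ring
  have h0 : (v + ε • dilationField v) 0 = v 0 := by simp [dilationField]
  have hrad : rad (x + ε • dilationField x) = (1 + ε) * rad x := by
    simp only [rad, hx 1 (by decide), hx 2 (by decide), hx 3 (by decide)]
    rw [show ((1 + ε) * x 1) ^ 2 + ((1 + ε) * x 2) ^ 2 + ((1 + ε) * x 3) ^ 2
      = (1 + ε) ^ 2 * (x 1 ^ 2 + x 2 ^ 2 + x 3 ^ 2) by ring, Real.sqrt_mul (sq_nonneg _),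
      Real.sqrt_sq hε'.le]
  have hc : cosTheta (x + ε • dilationField x) = cosTheta x := by
    simp only [cosTheta, hrad, hx 3 (by decide)]
    field_simp
  have hdr : dr (x + ε • dilationField x) (v + ε • dilationField v) = (1 + ε) * dr x v := by
    simp only [dr, hrad, hx 1 (by decide), hx 2 (by decide), hx 3 (by decide)]
    field_simp
  have hb : sinSqDphi (x + ε • dilationField x) (v + ε • dilationField v) = sinSqDphi x v := by
    simp only [sinSqDphi, hrad, hx 1 (by decide), hx 2 (by decide)]
    field_simp
  have hS : sphereMetric (x + ε • dilationField x) (v + ε • dilationField v)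
      (v + ε • dilationField v) = sphereMetric x v v := by
    simp only [sphereMetric, hrad, hdr, hx 1 (by decide), hx 2 (by decide), hx 3 (by decide)]
    field_simp
  simp only [metric, rhoSq, hrad, hc, h0, hdr, hb, hS]
  ring

/-- The derivative of the metric along the flow of spatial dilations. -/
lemma hasDerivAt_metric_dilation (M a : ℝ) {x : Pt} (hr : 0 < rad x)
    (hΔ : Delta M a (rad x) ≠ 0) (v : Pt) :
    HasDerivAt (fun ε : ℝ => metric M a (x + ε • dilationField x) (v + ε • dilationField v)
      (v + ε • dilationField v))
      (2 * M * rad x * (rhoSq a x - 2 * rad x ^ 2) / rhoSq a x ^ 2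
          * (v 0 - a * sinSqDphi x v) ^ 2
        + (2 * rad x ^ 2 / Delta M a (rad x)
          - rhoSq a x * ((2 * rad x - 2 * M) * rad x) / Delta M a (rad x) ^ 2
          + 2 * rhoSq a x / Delta M a (rad x)) * dr x v ^ 2
        + 2 * rad x ^ 2 * sphereMetric x v v) 0 := by
  have hρ := (rhoSq_pos a hr).ne'
  have hev : ∀ᶠ ε : ℝ in 𝓝 0, -1 < ε := Ioi_mem_nhds (by norm_num)
  have h1 : HasDerivAt (fun ε : ℝ => (1 + ε) * rad x) (rad x) 0 := by
    simpa using ((hasDerivAt_id (0 : ℝ)).const_add 1).mul_const (rad x)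
  have h2 : HasDerivAt (fun ε : ℝ => ((1 + ε) * rad x) ^ 2 + a ^ 2 * cosTheta x ^ 2)
      (2 * rad x ^ 2) 0 := by
    refine ((h1.pow 2).add_const _).congr_deriv ?_
    push_cast
    ring
  have h3 : HasDerivAt (fun ε : ℝ => Delta M a ((1 + ε) * rad x)) ((2 * rad x - 2 * M) * rad x)
      0 := by
    unfold Delta
    refine (((h1.pow 2).sub (h1.const_mul (2 * M))).add_const _).congr_deriv ?_
    push_cast
    ring
  have h4 : HasDerivAt (fun ε : ℝ => (1 + ε) * dr x v) (dr x v) 0 := by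
    simpa using ((hasDerivAt_id (0 : ℝ)).const_add 1).mul_const (dr x v)
  have hρ0 : ((1 + (0 : ℝ)) * rad x) ^ 2 + a ^ 2 * cosTheta x ^ 2 = rhoSq a x := by
    rw [rhoSq]; ring
  have hr0 : (1 + (0 : ℝ)) * rad x = rad x := by ring
  have h5 := ((((((h1.const_mul (2 * M)).fun_div h2 (by rw [hρ0]; exact hρ)).mul_const
    ((v 0 - a * sinSqDphi x v) ^ 2)).const_add (-(v 0 ^ 2))).add
    ((h2.fun_div h3 (by rw [hr0]; exact hΔ)).mul (h4.fun_pow 2))).add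
    (h2.mul_const (sphereMetric x v v))).add_const (a ^ 2 * sinSqDphi x v ^ 2)
  refine (h5.congr_of_eventuallyEq ?_).congr_deriv ?_
  · filter_upwards [hev] with ε hε
    rw [metric_add_smul_dilationField M a hε hr v]
    rfl
  · rw [hρ0, hr0]
    push_cast
    field_simp
    ring

/-- The radial component of the geodesic equation. -/
lemma radial_algebra {M a r ρ Δ t b p S E P K : ℝ} (hr : r ≠ 0) (hρ : ρ ≠ 0) (hΔ : Δ ≠ 0)
    (hE : E = (1 - 2 * M * r / ρ) * t + 2 * a * M * r / ρ * b)
    (hP : P = Δ * (t - a * b)) (hK : Δ * K = P ^ 2 - (ρ * p) ^ 2)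
    (hn : -(1 - 2 * M * r / ρ) * (t * t) - 2 * a * M * r / ρ * (t * b + t * b)
      + ρ / Δ * (p * p) + ρ * S + a ^ 2 * (1 + 2 * M * r / ρ) * (b * b) = 0) :
    (2 * M * r * (ρ - 2 * r ^ 2) / ρ ^ 2 * (t - a * b) ^ 2
        + (2 * r ^ 2 / Δ - ρ * ((2 * r - 2 * M) * r) / Δ ^ 2 + 2 * ρ / Δ) * p ^ 2
        + 2 * r ^ 2 * S) / 2 * (Δ / r)
      + ρ / Δ * (r * p) * (((2 * r - 2 * M) * p * r - Δ * p) / r ^ 2)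
      = (4 * r * E * P - 2 * (r - M) * K) / (2 * ρ) := by
  -- Eliminating `K` by the radial identity and `S` by the null condition leaves a rational identity
  -- in the free components `t`, `b`, `p`.
  have hK' : K = (P ^ 2 - (ρ * p) ^ 2) / Δ := by rw [← hK]; field_simp
  have hS : S = ((1 - 2 * M * r / ρ) * (t * t) + 2 * a * M * r / ρ * (t * b + t * b)
      - ρ / Δ * (p * p) - a ^ 2 * (1 + 2 * M * r / ρ) * (b * b)) / ρ := by
    rw [eq_div_iff hρ]; linear_combination hn
  rw [hK', hP, hE, hS]
  field_simp
  ring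

end Kerr

namespace Kerr

/-! ### Conservation laws and the radial equation along null geodesics -/

section Conservation

variable {M a : ℝ} {γ : ℝ → Pt} {J : Set ℝ}

lemma IsGeodesicOn.hasDerivAt_energy (h : |a| < M) (hJ : IsOpen J) (hg : IsGeodesicOn M a γ J)
    {s : ℝ} (hs : s ∈ J) : HasDerivAt (fun s => energy M a (γ s) (deriv γ s)) 0 s := by
  have h1 := hg.hasDerivAt_metric_affine h hJ hs dT 0 (D := 0) (by
    simp only [_root_.zero_apply, add_zero, smul_zero, metric_add_smul_dT]
    exact hasDerivAt_const _ _)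
  simp only [_root_.zero_apply, add_zero, zero_div] at h1
  exact h1.fun_neg.congr_deriv neg_zero

lemma IsGeodesicOn.hasDerivAt_angMom (h : |a| < M) (hJ : IsOpen J) (hg : IsGeodesicOn M a γ J)
    {s : ℝ} (hs : s ∈ J) : HasDerivAt (fun s => angMom M a (γ s) (deriv γ s)) 0 s := by
  set f : ℝ → ℝ := fun ε => metric M a (γ s + ε • dPhi (γ s))
    (deriv γ s + ε • dPhi (deriv γ s)) (deriv γ s + ε • dPhi (deriv γ s)) with hf
  have hlin (p q : Pt) : HasDerivAt (fun ε : ℝ => p + ε • q) q 0 := by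
    simpa using ((hasDerivAt_id (0 : ℝ)).smul_const q).const_add p
  have hd := hasDerivAt_metric h (y := fun ε : ℝ => γ s + ε • dPhi (γ s)) (s := 0)
    (by simpa using hg.1 s hs) (hlin _ _) (hlin (deriv γ s) (dPhi (deriv γ s)))
    (hlin (deriv γ s) (dPhi (deriv γ s)))
  have heven : (fun ε => f (-ε)) = f := funext fun ε => metric_add_smul_dPhi_even M a ε _ _
  have h0 : deriv f 0 = 0 := by
    have := deriv_comp_neg f 0
    rw [heven, neg_zero] at this
    linarith
  have hf0 : HasDerivAt f 0 0 := hd.differentiableAt.hasDerivAt.congr_deriv h0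
  have h1 := hg.hasDerivAt_metric_affine h hJ hs 0 rotationMap (D := 0) (by
    simp only [zero_add, rotationMap_apply]
    exact hf0)
  simp only [zero_add, rotationMap_apply, zero_div] at h1
  exact h1

/-- The momentum conjugate to `r`, rescaled to `ρ² r'`. -/
noncomputable def radialMomentum (a : ℝ) (x v : Pt) : ℝ := rhoSq a x * dr x v

lemma radialMomentum_sq {x v : Pt} (hr : 0 < rad x) (hΔ : Delta M a (rad x) ≠ 0)
    (hn : metric M a x v v = 0) :
    radialMomentum a x v ^ 2
      = ((rad x ^ 2 + a ^ 2) * energy M a x v - a * angMom M a x v) ^ 2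
        - Delta M a (rad x) * carterK M a x v := by
  have := carterK_eq M a hr hΔ v
  rw [hn] at this
  rw [radialMomentum]
  linarith

/-- The radial equation `ρ² d/ds (ρ² r') = R'(r) / 2`. -/
lemma IsGeodesicOn.hasDerivAt_radialMomentum (h : |a| < M) (hJ : IsOpen J)
    (hg : IsGeodesicOn M a γ J) {s : ℝ} (hs : s ∈ J)
    (hn : metric M a (γ s) (deriv γ s) (deriv γ s) = 0) :
    HasDerivAt (fun s => radialMomentum a (γ s) (deriv γ s))
      (radialSlope M a (energy M a (γ s) (deriv γ s)) (angMom M a (γ s) (deriv γ s))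
        (carterK M a (γ s) (deriv γ s)) (rad (γ s)) / (2 * rhoSq a (γ s))) s := by
  have hr := rad_pos_of_mem h (hg.1 s hs)
  have hΔ := (Delta_pos_of_mem h (hg.1 s hs)).ne'
  have hρ := (rhoSq_pos a hr).ne'
  have hp := hg.hasDerivAt_metric_affine h hJ hs 0 dilationMap (by
    simp only [zero_add, dilationMap_apply]
    exact hasDerivAt_metric_dilation M a hr hΔ (deriv γ s))
  simp only [zero_add, dilationMap_apply] at hp
  have hrad := hasDerivAt_rad (hg.hasDerivAt hJ hs) hr
  have hquot : HasDerivAt (fun s => Delta M a (rad (γ s)) / rad (γ s))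
      (((2 * rad (γ s) - 2 * M) * dr (γ s) (deriv γ s) * rad (γ s)
        - Delta M a (rad (γ s)) * dr (γ s) (deriv γ s)) / rad (γ s) ^ 2) s := by
    have hD : HasDerivAt (fun s => Delta M a (rad (γ s)))
        ((2 * rad (γ s) - 2 * M) * dr (γ s) (deriv γ s)) s := by
      unfold Delta
      refine (((hrad.pow 2).sub (hrad.const_mul (2 * M))).add_const _).congr_deriv ?_
      push_cast
      ring
    exact hD.fun_div hrad hr.ne'
  -- The dilation field is `r ∂_r`, so `g(r ∂_r, γ') = ρ² r r' / Δ`; the factor `Δ / r` recovers `ρ²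
  -- r'`.
  have hW : (fun s => radialMomentum a (γ s) (deriv γ s)) =ᶠ[𝓝 s] fun s =>
      metric M a (γ s) (dilationField (γ s)) (deriv γ s)
        * (Delta M a (rad (γ s)) / rad (γ s)) := by
    filter_upwards [hJ.mem_nhds hs] with u hu
    have hru := (rad_pos_of_mem h (hg.1 u hu)).ne'
    have hΔu := (Delta_pos_of_mem h (hg.1 u hu)).ne'
    rw [metric_dilationField M a (rad_pos_of_mem h (hg.1 u hu)), radialMomentum]
    field_simp
  refine ((hp.fun_mul hquot).congr_of_eventuallyEq hW).congr_deriv ?_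
  rw [metric_dilationField M a hr, radialSlope]
  have hK := carterK_eq M a hr hΔ (deriv γ s)
  rw [hn, mul_zero, sub_zero] at hK
  refine radial_algebra hr.ne' hρ hΔ ?_ (radialP_eq M a hr _) hK ?_
  · rw [energy, metric_dT]
    ring
  · exact hn

/-- The energy, the angular momentum and the Carter constant are constant along a null geodesic. -/
theorem IsGeodesicOn.exists_integrals (h : |a| < M) (hJ : IsOpen J) (hJ' : J.OrdConnected)
    (hne : J.Nonempty) (hg : IsGeodesicOn M a γ J)
    (hn : ∀ s ∈ J, IsNull M a (γ s) (deriv γ s)) :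
    ∃ E L K, Admissible a E L K ∧ ∀ s ∈ J, energy M a (γ s) (deriv γ s) = E ∧
      angMom M a (γ s) (deriv γ s) = L ∧ carterK M a (γ s) (deriv γ s) = K := by
  obtain ⟨s₀, hs₀⟩ := hne
  have hconst {f : ℝ → ℝ} (hf : ∀ s ∈ J, HasDerivAt f 0 s) : ∀ s ∈ J, f s = f s₀ := fun s hs =>
    hJ.is_const_of_deriv_eq_zero hJ'.isPreconnected
      (fun u hu => (hf u hu).differentiableAt.differentiableWithinAt)
      (fun u hu => (hf u hu).deriv) hs hs₀
  have hE := hconst fun s hs => hg.hasDerivAt_energy h hJ hs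
  have hL := hconst fun s hs => hg.hasDerivAt_angMom h hJ hs
  -- With `W = ρ² r'` and `K = (P² - W²) / Δ`, one has `Δ K' = 2 P P' - 2 W W' - Δ' r' K`. The
  -- radial equation gives `2 W W' = r' (4 r E P - Δ' K)`, and `2 P P' = 4 r E P r'`, so everything
  -- cancels.
  have hK : ∀ s ∈ J, HasDerivAt (fun s => carterK M a (γ s) (deriv γ s)) 0 s := by
    intro s hs
    have hr := rad_pos_of_mem h (hg.1 s hs)
    have hΔ := (Delta_pos_of_mem h (hg.1 s hs)).ne'
    have hρ := (rhoSq_pos a hr).ne'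
    have hrad := hasDerivAt_rad (hg.hasDerivAt hJ hs) hr
    have hW := hg.hasDerivAt_radialMomentum h hJ hs (hn s hs).2
    have hD : HasDerivAt (fun s => Delta M a (rad (γ s)))
        ((2 * rad (γ s) - 2 * M) * dr (γ s) (deriv γ s)) s := by
      unfold Delta
      refine (((hrad.pow 2).sub (hrad.const_mul (2 * M))).add_const _).congr_deriv ?_
      push_cast
      ring
    have hP : HasDerivAt (fun u => (rad (γ u) ^ 2 + a ^ 2) * energy M a (γ s) (deriv γ s)
        - a * angMom M a (γ s) (deriv γ s))
        (2 * rad (γ s) * dr (γ s) (deriv γ s) * energy M a (γ s) (deriv γ s)) s := by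
      refine ((((hrad.pow 2).add_const _).mul_const _).sub_const _).congr_deriv ?_
      push_cast
      ring
    have hq := ((hP.fun_pow 2).fun_sub (hW.fun_pow 2)).fun_div hD hΔ
    have hev : (fun s => carterK M a (γ s) (deriv γ s)) =ᶠ[𝓝 s] fun u =>
        (((rad (γ u) ^ 2 + a ^ 2) * energy M a (γ s) (deriv γ s)
          - a * angMom M a (γ s) (deriv γ s)) ^ 2
          - radialMomentum a (γ u) (deriv γ u) ^ 2) / Delta M a (rad (γ u)) := by
      filter_upwards [hJ.mem_nhds hs] with u hu
      have hΔu := (Delta_pos_of_mem h (hg.1 u hu)).ne'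
      rw [radialMomentum_sq (rad_pos_of_mem h (hg.1 u hu)) hΔu (hn u hu).2, hE u hu, hL u hu,
        hE s hs, hL s hs, eq_div_iff hΔu]
      ring
    refine (hq.congr_of_eventuallyEq hev).congr_deriv ?_
    rw [radialMomentum_sq hr hΔ (hn s hs).2, radialMomentum, radialSlope]
    field_simp
    push_cast
    ring
  have hK := hconst hK
  exact ⟨_, _, _, admissible_of_isNull (rad_pos_of_mem h (hg.1 s₀ hs₀))
    (Delta_pos_of_mem h (hg.1 s₀ hs₀)).ne' (hn s₀ hs₀),
    fun s hs => ⟨hE s hs, hL s hs, hK s hs⟩⟩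

end Conservation

end Kerr

namespace Kerr

/-! ### Bounds on the components of null vectors -/

section Bounds

variable {M a : ℝ} {x v : Pt}

lemma time_component (hr : 0 < rad x) :
    Delta M a (rad x) * (rhoSq a x * v 0)
      = (rad x ^ 2 + a ^ 2) * ((rad x ^ 2 + a ^ 2) * energy M a x v - a * angMom M a x v)
        + a * Delta M a (rad x)
          * (angMom M a x v - a * energy M a x v * (1 - cosTheta x ^ 2)) := by
  rw [radialP_eq M a hr, angMom_sub M a hr, rhoSq]
  ring

lemma carterK_mul_Delta_le (hr : 0 < rad x) (hΔ : 0 < Delta M a (rad x))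
    (hn : metric M a x v v = 0) :
    Delta M a (rad x) * carterK M a x v
      ≤ ((rad x ^ 2 + a ^ 2) * energy M a x v - a * angMom M a x v) ^ 2 := by
  have := radialMomentum_sq hr hΔ.ne' hn
  nlinarith [sq_nonneg (radialMomentum a x v)]

lemma polar_sq_le (hr : 0 < rad x) (hΔ : 0 < Delta M a (rad x)) (hn : metric M a x v v = 0) :
    (angMom M a x v - a * energy M a x v * (1 - cosTheta x ^ 2)) ^ 2 ≤ carterK M a x v := by
  have h1 := carterK_mul_sinSq M a hr hΔ.ne' hn
  have h2 : carterK M a x v * (1 - cosTheta x ^ 2) ≤ carterK M a x v :=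
    mul_le_of_le_one_right (carterK_nonneg M a hr hΔ.ne' hn) (by linarith [sq_nonneg (cosTheta x)])
  linarith [sq_nonneg (rhoSq a x * dCosTheta x v)]

/-- This controls the error term in `time_component`. The polar and radial identities give `√Δ |L -
a E sin² θ| ≤ √(Δ K) ≤ |P|`, and `|a| √Δ ≤ (a² + Δ) / 2`. -/
lemma polar_mul_Delta_le (hr : 0 < rad x) (hΔ : 0 < Delta M a (rad x))
    (hn : metric M a x v v = 0) :
    |a| * Delta M a (rad x) * |angMom M a x v - a * energy M a x v * (1 - cosTheta x ^ 2)|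
      ≤ (a ^ 2 + Delta M a (rad x)) / 2
        * |(rad x ^ 2 + a ^ 2) * energy M a x v - a * angMom M a x v| := by
  set D := angMom M a x v - a * energy M a x v * (1 - cosTheta x ^ 2)
  set P := (rad x ^ 2 + a ^ 2) * energy M a x v - a * angMom M a x v
  set Δ := Delta M a (rad x)
  have h1 : (√Δ * |D|) ^ 2 ≤ |P| ^ 2 := by
    rw [mul_pow, Real.sq_sqrt hΔ.le, sq_abs, sq_abs]
    exact (mul_le_mul_of_nonneg_left (polar_sq_le hr hΔ hn) hΔ.le).trans
      (carterK_mul_Delta_le hr hΔ hn)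
  have h2 : √Δ * |D| ≤ |P| := (le_abs_self _).trans (abs_le_of_sq_le_sq h1 (abs_nonneg _))
  have h3 : √Δ ^ 2 = Δ := Real.sq_sqrt hΔ.le
  have h4 : |a| * √Δ ≤ (a ^ 2 + Δ) / 2 := by
    rw [← sq_abs]; nlinarith [sq_nonneg (|a| - √Δ)]
  calc |a| * Δ * |D| = |a| * √Δ * (√Δ * |D|) := by linear_combination -|a| * |D| * h3
    _ ≤ (a ^ 2 + Δ) / 2 * |P| := by gcongr

/-- The main term `(r² + a²) P` of `time_component` beats the error `(a² + Δ) |P| / 2`: as `Δ ≤ r² +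
a²`, at least `r² |P| / 2` remains. -/
lemma time_component_ge (hM : |a| < M) (hx : x ∈ exterior M a) (hn : metric M a x v v = 0) :
    rad x ^ 2 * |(rad x ^ 2 + a ^ 2) * energy M a x v - a * angMom M a x v|
      ≤ 2 * Delta M a (rad x) * (rhoSq a x * |v 0|) := by
  have hr := rad_pos_of_mem hM hx
  have hΔ := Delta_pos_of_mem hM hx
  have hρ := rhoSq_pos a hr
  have h1 := time_component (M := M) (a := a) (v := v) hr
  have h2 := polar_mul_Delta_le hr hΔ hn
  set D := angMom M a x v - a * energy M a x v * (1 - cosTheta x ^ 2)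
  set P := (rad x ^ 2 + a ^ 2) * energy M a x v - a * angMom M a x v
  have h3 : (rad x ^ 2 + a ^ 2) * |P|
      ≤ Delta M a (rad x) * (rhoSq a x * |v 0|) + |a| * Delta M a (rad x) * |D| := by
    have e : (rad x ^ 2 + a ^ 2) * P
        = Delta M a (rad x) * (rhoSq a x * v 0) - a * Delta M a (rad x) * D := by linarith
    calc (rad x ^ 2 + a ^ 2) * |P| = |(rad x ^ 2 + a ^ 2) * P| := by
          rw [abs_mul, abs_of_pos (by positivity : 0 < rad x ^ 2 + a ^ 2)]
      _ ≤ |Delta M a (rad x) * (rhoSq a x * v 0)| + |a * Delta M a (rad x) * D| := by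
          rw [e]; exact abs_sub _ _
      _ = _ := by rw [abs_mul, abs_mul, abs_mul, abs_mul, abs_of_pos hΔ, abs_of_pos hρ]
  have h4 : a ^ 2 + Delta M a (rad x) ≤ rad x ^ 2 + 2 * a ^ 2 := by
    have : 0 ≤ 2 * M * rad x := by
      have : 0 < M := (abs_nonneg a).trans_lt hM
      positivity
    rw [Delta]
    linarith
  have h5 : (a ^ 2 + Delta M a (rad x)) / 2 * |P| ≤ (rad x ^ 2 + 2 * a ^ 2) / 2 * |P| := by gcongr
  linarith

lemma abs_radialMomentum_le (hM : |a| < M) (hx : x ∈ exterior M a) (hn : metric M a x v v = 0) :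
    |rhoSq a x * dr x v| ≤ |(rad x ^ 2 + a ^ 2) * energy M a x v - a * angMom M a x v| := by
  have hr := rad_pos_of_mem hM hx
  have hΔ := Delta_pos_of_mem hM hx
  apply sq_le_sq.1
  have h1 := radialMomentum_sq hr hΔ.ne' hn
  have h2 := mul_nonneg hΔ.le (carterK_nonneg M a hr hΔ.ne' hn)
  rw [radialMomentum] at h1
  linarith

/-- The radial speed of light with respect to `t` is at most `2 (r - r₊) / M`. -/
lemma abs_dr_le (ha : 0 < |a|) (hM : |a| < M) (hx : x ∈ exterior M a)
    (hn : metric M a x v v = 0) : |dr x v| ≤ 2 / M * (rad x - rPlus M a) * |v 0| := by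
  have hx' : rPlus M a < rad x := hx
  have hr := rad_pos_of_mem hM hx
  have hρ := rhoSq_pos a hr
  have h1 := time_component_ge hM hx hn
  have h2 := abs_radialMomentum_le hM hx hn
  rw [abs_mul, abs_of_pos hρ] at h2
  have h3 : rad x ^ 2 * (rhoSq a x * |dr x v|) ≤ 2 * Delta M a (rad x) * (rhoSq a x * |v 0|) :=
    (mul_le_mul_of_nonneg_left h2 (sq_nonneg _)).trans h1
  have h4 : rad x ^ 2 * |dr x v| ≤ 2 * Delta M a (rad x) * |v 0| := by
    refine le_of_mul_le_mul_left ?_ hρ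
    linarith
  have hM0 : 0 < M := ha.trans hM
  have h5 : Delta M a (rad x) ≤ (rad x - rPlus M a) * rad x := by
    rw [Delta_eq hM]
    have := rMinus_pos ha hM
    exact mul_le_mul_of_nonneg_left (by linarith) (by linarith)
  have h6 : rad x * |dr x v| ≤ 2 * (rad x - rPlus M a) * |v 0| := by
    refine le_of_mul_le_mul_left ?_ hr
    calc rad x * (rad x * |dr x v|) = rad x ^ 2 * |dr x v| := by ring
      _ ≤ 2 * Delta M a (rad x) * |v 0| := h4
      _ ≤ 2 * ((rad x - rPlus M a) * rad x) * |v 0| := by gcongr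
      _ = _ := by ring
  have h7 : M * |dr x v| ≤ rad x * |dr x v| := by
    have := lt_rPlus hM
    gcongr
    linarith
  rw [div_mul_eq_mul_div, div_mul_eq_mul_div, le_div_iff₀ hM0]
  linarith

/-- `P` dominates the expression for `Δ ρ² t'`, since `r² + a² > (a² + Δ) / 2`; hence `t'` and `P`
cannot have opposite signs. -/
lemma radialP_nonneg_of_future (hM : |a| < M) (hx : x ∈ exterior M a)
    (hn : metric M a x v v = 0) (hv : 0 < v 0) :
    0 ≤ (rad x ^ 2 + a ^ 2) * energy M a x v - a * angMom M a x v := by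
  have hr := rad_pos_of_mem hM hx
  have hΔ := Delta_pos_of_mem hM hx
  have hρ := rhoSq_pos a hr
  have h1 := time_component (M := M) (a := a) (v := v) hr
  have h2 := polar_mul_Delta_le hr hΔ hn
  set D := angMom M a x v - a * energy M a x v * (1 - cosTheta x ^ 2)
  set P := (rad x ^ 2 + a ^ 2) * energy M a x v - a * angMom M a x v
  by_contra! hP
  rw [abs_of_neg hP] at h2
  have h3 : a * Delta M a (rad x) * D ≤ |a| * Delta M a (rad x) * |D| := by
    calc a * Delta M a (rad x) * D ≤ |a * Delta M a (rad x) * D| := le_abs_self _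
      _ = _ := by rw [abs_mul, abs_mul, abs_of_pos hΔ]
  have h4 : 0 < Delta M a (rad x) * (rhoSq a x * v 0) := by positivity
  have h5 : 0 < (rad x ^ 2 + a ^ 2) - (a ^ 2 + Delta M a (rad x)) / 2 := by
    have hM0 : 0 < M := (abs_nonneg a).trans_lt hM
    have : 0 < 2 * M * rad x := by positivity
    rw [Delta]
    nlinarith [sq_nonneg (rad x)]
  nlinarith

/-- The geometry of a radial shell. -/
lemma shell_le (hM : |a| < M) {r₁ r₂ : ℝ} (hr₁ : rPlus M a < r₁) (hx₁ : r₁ ≤ rad x)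
    (hx₂ : rad x ≤ r₂) :
    Delta M a r₁ ≤ Delta M a (rad x) ∧ Delta M a (rad x) ≤ r₂ ^ 2 ∧ r₁ ^ 2 ≤ rhoSq a x ∧
      rhoSq a x ≤ r₂ ^ 2 + a ^ 2 := by
  have hM0 : 0 < M := (abs_nonneg a).trans_lt hM
  have hMr : M < r₁ := (lt_rPlus hM).trans hr₁
  have hr : 0 < rad x := by linarith
  have hc := cosTheta_sq_le_one hr
  have hr₁2 : r₁ ^ 2 ≤ rad x ^ 2 := by gcongr; linarith
  have hr₂2 : rad x ^ 2 ≤ r₂ ^ 2 := by gcongr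
  refine ⟨?_, ?_, ?_, ?_⟩
  · rw [Delta, Delta]
    nlinarith
  · rw [Delta]
    have : a ^ 2 < M ^ 2 := by rw [← sq_abs]; gcongr
    nlinarith
  · rw [rhoSq]
    nlinarith [sq_nonneg (a * cosTheta x)]
  · rw [rhoSq]
    nlinarith [sq_nonneg a]

/-- The energy at infinity measured along the principal directions is bounded below outside a
neighbourhood of the horizon. -/
lemma Admissible.exists_le_radialP {E L K r₁ : ℝ} (hA : Admissible a E L K) (hM : |a| < M)
    (hr₁ : rPlus M a < r₁) :
    ∃ k, 0 < k ∧ ∀ r, r₁ ≤ r → Delta M a r * K ≤ ((r ^ 2 + a ^ 2) * E - a * L) ^ 2 →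
      k ≤ |(r ^ 2 + a ^ 2) * E - a * L| := by
  have hMr : M < r₁ := (lt_rPlus hM).trans hr₁
  have hr₁0 : 0 < r₁ := by linarith [abs_nonneg a]
  have hΔ₁ := Delta_pos hM hr₁
  obtain ⟨h0, hE, σ, hσ0, hσ1, hσ⟩ := hA
  -- If `K = 0`, then `P = (r² + a² (1 - σ)) E` with `E ≠ 0`; if `K > 0`, then `|P| ≥ √(Δ K)` and
  -- `Δ` increases with `r`.
  rcases h0.eq_or_lt with hK | hK
  · refine ⟨r₁ ^ 2 * |E|, mul_pos (by positivity) (abs_pos.2 (hE hK.symm)), fun r hr _ => ?_⟩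
    rw [← hK, zero_mul] at hσ
    have hL : L = a * E * σ := by nlinarith [sq_nonneg (L - a * E * σ)]
    have e : (r ^ 2 + a ^ 2) * E - a * L = (r ^ 2 + a ^ 2 * (1 - σ)) * E := by rw [hL]; ring
    have h3 : 0 ≤ a ^ 2 * (1 - σ) := mul_nonneg (sq_nonneg a) (by linarith)
    have h4 : r₁ ^ 2 ≤ r ^ 2 := by gcongr
    rw [e, abs_mul, abs_of_nonneg (by positivity : 0 ≤ r ^ 2 + a ^ 2 * (1 - σ))]
    gcongr
    linarith
  · refine ⟨√(Delta M a r₁ * K), Real.sqrt_pos.2 (mul_pos hΔ₁ hK), fun r hr h => ?_⟩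
    rw [← Real.sqrt_sq_eq_abs]
    refine Real.sqrt_le_sqrt (le_trans ?_ h)
    have : Delta M a r₁ ≤ Delta M a r := by
      rw [Delta, Delta]
      nlinarith
    gcongr

/-- On a radial shell, the `t`-component of null vectors with given first integrals is bounded
away from zero. -/
theorem exists_le_time_component (hM : |a| < M) {E L K r₁ r₂ : ℝ} (hA : Admissible a E L K)
    (hr₁ : rPlus M a < r₁) (hr₁₂ : r₁ ≤ r₂) :
    ∃ c, 0 < c ∧ ∀ x v : Pt, rad x ∈ Set.Icc r₁ r₂ → metric M a x v v = 0 →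
      energy M a x v = E → angMom M a x v = L → carterK M a x v = K → c ≤ |v 0| := by
  have hr₁0 : 0 < r₁ := by linarith [lt_rPlus hM, abs_nonneg a]
  have hr₂0 : 0 < r₂ := by linarith
  obtain ⟨k, hk0, hk⟩ := hA.exists_le_radialP hM hr₁
  refine ⟨k * r₁ ^ 2 / (2 * (r₂ ^ 2) * (r₂ ^ 2 + a ^ 2)), by positivity, ?_⟩
  rintro x v ⟨hx₁, hx₂⟩ hn rfl rfl rfl
  have hx : x ∈ exterior M a := hr₁.trans_le hx₁
  obtain ⟨-, hΔr, -, hρ₂⟩ := shell_le hM hr₁ hx₁ hx₂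
  have hr := rad_pos_of_mem hM hx
  have hΔ := Delta_pos_of_mem hM hx
  have hkP := hk (rad x) hx₁ (carterK_mul_Delta_le hr hΔ hn)
  have h1 := time_component_ge hM hx hn
  have hρv : 0 ≤ rhoSq a x * |v 0| := mul_nonneg (rhoSq_pos a hr).le (abs_nonneg _)
  rw [div_le_iff₀ (by positivity)]
  calc k * r₁ ^ 2 ≤ |(rad x ^ 2 + a ^ 2) * energy M a x v - a * angMom M a x v| * rad x ^ 2 := by
        gcongr
    _ ≤ 2 * Delta M a (rad x) * (rhoSq a x * |v 0|) := by linarith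
    _ ≤ 2 * r₂ ^ 2 * ((r₂ ^ 2 + a ^ 2) * |v 0|) := by gcongr
    _ = _ := by ring

/-- On a radial shell, null vectors with given first integrals are bounded. -/
theorem exists_norm_le (hM : |a| < M) (E L K : ℝ) {r₁ r₂ : ℝ} (hr₁ : rPlus M a < r₁) :
    ∃ C, ∀ x v : Pt, rad x ∈ Set.Icc r₁ r₂ → metric M a x v v = 0 →
      energy M a x v = E → angMom M a x v = L → carterK M a x v = K → ‖v‖ ≤ C := by
  have hr₁0 : 0 < r₁ := by linarith [lt_rPlus hM, abs_nonneg a]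
  have hΔ₁ := Delta_pos hM hr₁
  obtain ⟨d, hd⟩ : ∃ d, d = Delta M a r₁ := ⟨_, rfl⟩
  rw [← hd] at hΔ₁
  -- On the shell `A` bounds `|P|`, so `A / d` bounds `|t' - a sin² θ φ'|`; `B` bounds `|sin² θ
  -- φ'|`, `S₀` the spherical part and `N` the Euclidean length of the spatial part.
  obtain ⟨A, hA⟩ : ∃ A, A = (r₂ ^ 2 + a ^ 2) * |E| + |a| * |L| := ⟨_, rfl⟩
  have hA0 : 0 ≤ A := by rw [hA]; positivity
  obtain ⟨B, hB⟩ : ∃ B, B = (√K + |a| * (A / d)) / r₁ ^ 2 := ⟨_, rfl⟩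
  have hB0 : 0 ≤ B := by rw [hB]; positivity
  obtain ⟨S₀, hS₀⟩ : ∃ S₀, S₀ = (K + |a| * (A / d) * (√K + (r₂ ^ 2 + a ^ 2) * B)) / r₁ ^ 4 :=
    ⟨_, rfl⟩
  obtain ⟨N, hN⟩ : ∃ N, N = A / r₁ ^ 2 + |r₂| * √S₀ := ⟨_, rfl⟩
  have hN0 : 0 ≤ N := by rw [hN]; positivity
  refine ⟨A / d + |a| * B + N, ?_⟩
  rintro x v ⟨hx₁, hx₂⟩ hn rfl rfl rfl
  have hx : x ∈ exterior M a := hr₁.trans_le hx₁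
  have hr := rad_pos_of_mem hM hx
  have hΔ := Delta_pos_of_mem hM hx
  have hρ := rhoSq_pos a hr
  obtain ⟨hdΔ, -, hρ₁, hρ₂⟩ := shell_le hM hr₁ hx₁ hx₂
  rw [← hd] at hdΔ
  have hc := cosTheta_sq_le_one hr
  have hσ0 : 0 ≤ 1 - cosTheta x ^ 2 := by linarith
  have hσ1 : 1 - cosTheta x ^ 2 ≤ 1 := by linarith [sq_nonneg (cosTheta x)]
  have hP : |(rad x ^ 2 + a ^ 2) * energy M a x v - a * angMom M a x v| ≤ A := by
    calc _ ≤ |(rad x ^ 2 + a ^ 2) * energy M a x v| + |a * angMom M a x v| := abs_sub _ _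
      _ = (rad x ^ 2 + a ^ 2) * |energy M a x v| + |a| * |angMom M a x v| := by
        rw [abs_mul, abs_mul, abs_of_pos (by positivity : 0 < rad x ^ 2 + a ^ 2)]
      _ ≤ A := by rw [hA]; gcongr
  have hD : |angMom M a x v - a * energy M a x v * (1 - cosTheta x ^ 2)| ≤ √(carterK M a x v) :=
    Real.abs_le_sqrt (polar_sq_le hr hΔ hn)
  have hu : |v 0 - a * sinSqDphi x v| ≤ A / d := by
    rw [radialP_eq M a hr v, abs_mul, abs_of_pos hΔ] at hP
    rw [le_div_iff₀ hΔ₁]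
    calc |v 0 - a * sinSqDphi x v| * d ≤ |v 0 - a * sinSqDphi x v| * Delta M a (rad x) := by gcongr
      _ ≤ A := by linarith
  have hb : |sinSqDphi x v| ≤ B := by
    have e : rhoSq a x * sinSqDphi x v
        = (angMom M a x v - a * energy M a x v * (1 - cosTheta x ^ 2))
        + a * ((1 - cosTheta x ^ 2) * (v 0 - a * sinSqDphi x v)) := by
      rw [angMom_sub M a hr, rhoSq]
      ring
    have h1 : |rhoSq a x * sinSqDphi x v| ≤ √(carterK M a x v) + |a| * (A / d) := by
      rw [e]
      refine (abs_add_le _ _).trans (add_le_add hD ?_)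
      rw [abs_mul, abs_mul, abs_of_nonneg hσ0]
      gcongr
      calc (1 - cosTheta x ^ 2) * |v 0 - a * sinSqDphi x v| ≤ 1 * (A / d) := by gcongr
        _ = _ := one_mul _
    rw [abs_mul, abs_of_pos hρ] at h1
    rw [hB, le_div_iff₀ (by positivity)]
    calc |sinSqDphi x v| * r₁ ^ 2 ≤ |sinSqDphi x v| * rhoSq a x := by gcongr
      _ ≤ _ := by linarith
  have h0 : |v 0| ≤ A / d + |a| * B := by
    calc |v 0| = |(v 0 - a * sinSqDphi x v) + a * sinSqDphi x v| := by ring_nf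
      _ ≤ |v 0 - a * sinSqDphi x v| + |a * sinSqDphi x v| := abs_add_le _ _
      _ ≤ _ := by rw [abs_mul]; gcongr
  have hp : |dr x v| ≤ A / r₁ ^ 2 := by
    have := abs_radialMomentum_le hM hx hn
    rw [abs_mul, abs_of_pos hρ] at this
    rw [le_div_iff₀ (by positivity)]
    calc |dr x v| * r₁ ^ 2 ≤ |dr x v| * rhoSq a x := by gcongr
      _ ≤ A := by linarith
  have hSnn := sphereMetric_self_nonneg hr v
  have hS : sphereMetric x v v ≤ S₀ := by
    have e := carterK_eq_sphere M a hr hΔ.ne' hn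
    rw [← angMom_sub M a hr] at e
    have h1 : |a * (v 0 - a * sinSqDphi x v)
        * (angMom M a x v - a * energy M a x v * (1 - cosTheta x ^ 2)
          + rhoSq a x * sinSqDphi x v)|
        ≤ |a| * (A / d) * (√(carterK M a x v) + (r₂ ^ 2 + a ^ 2) * B) := by
      rw [abs_mul, abs_mul]
      gcongr
      refine (abs_add_le _ _).trans (add_le_add hD ?_)
      rw [abs_mul, abs_of_pos hρ]
      gcongr
    have h2 : rhoSq a x ^ 2 * sphereMetric x v v
        ≤ carterK M a x v + |a| * (A / d) * (√(carterK M a x v) + (r₂ ^ 2 + a ^ 2) * B) := by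
      have := (le_abs_self _).trans h1
      linarith
    rw [hS₀, le_div_iff₀ (by positivity)]
    calc sphereMetric x v v * r₁ ^ 4 = (r₁ ^ 2) ^ 2 * sphereMetric x v v := by ring
      _ ≤ rhoSq a x ^ 2 * sphereMetric x v v := by gcongr
      _ ≤ _ := h2
  have hbd : v 1 ^ 2 + v 2 ^ 2 + v 3 ^ 2 ≤ N ^ 2 := by
    have h1 : dr x v ^ 2 ≤ (A / r₁ ^ 2) ^ 2 := by rw [← sq_abs]; gcongr
    have h2 : rad x ^ 2 * sphereMetric x v v ≤ (|r₂| * √S₀) ^ 2 := by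
      rw [mul_pow, Real.sq_sqrt (hSnn.trans hS), sq_abs]
      gcongr
    have h3 : 0 ≤ A / r₁ ^ 2 * (|r₂| * √S₀) := by positivity
    rw [norm_sq_spatial hr v, hN, add_sq]
    linarith
  have hnn1 : 0 ≤ A / d + |a| * B := (abs_nonneg _).trans h0
  have hi (w : ℝ) (hw : w ^ 2 ≤ N ^ 2) : |w| ≤ A / d + |a| * B + N := by
    have := abs_le_of_sq_le_sq hw hN0
    linarith
  refine (pi_norm_le_iff_of_nonneg (by linarith)).2 fun i => ?_
  rw [Real.norm_eq_abs]
  have q1 := sq_nonneg (v 1)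
  have q2 := sq_nonneg (v 2)
  have q3 := sq_nonneg (v 3)
  fin_cases i
  · exact h0.trans (by linarith)
  · exact hi (v 1) (by linarith)
  · exact hi (v 2) (by linarith)
  · exact hi (v 3) (by linarith)

end Bounds

end Kerr

namespace Kerr

/-! ### The behaviour of `t` at the ends of a null geodesic -/

lemma monotoneOn_of_hasDerivAt_nonneg {f f' : ℝ → ℝ} {J : Set ℝ} (hJ' : J.OrdConnected)
    (hf : ∀ s ∈ J, HasDerivAt f (f' s) s) (h0 : ∀ s ∈ J, 0 ≤ f' s) : MonotoneOn f J :=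
  monotoneOn_of_deriv_nonneg hJ'.convex (fun s hs => (hf s hs).continuousAt.continuousWithinAt)
    (fun s hs => (hf s (interior_subset hs)).differentiableAt.differentiableWithinAt)
    fun s hs => by rw [(hf s (interior_subset hs)).deriv]; exact h0 s (interior_subset hs)

lemma antitoneOn_of_hasDerivAt_nonpos {f f' : ℝ → ℝ} {J : Set ℝ} (hJ' : J.OrdConnected)
    (hf : ∀ s ∈ J, HasDerivAt f (f' s) s) (h0 : ∀ s ∈ J, f' s ≤ 0) : AntitoneOn f J :=
  antitoneOn_of_deriv_nonpos hJ'.convex (fun s hs => (hf s hs).continuousAt.continuousWithinAt)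
    (fun s hs => (hf s (interior_subset hs)).differentiableAt.differentiableWithinAt)
    fun s hs => by rw [(hf s (interior_subset hs)).deriv]; exact h0 s (interior_subset hs)

lemma abs_coord_le_rad (x : Pt) : |x 1| ≤ rad x ∧ |x 2| ≤ rad x ∧ |x 3| ≤ rad x := by
  have h := rad_sq x
  have h0 : 0 ≤ rad x := Real.sqrt_nonneg _
  refine ⟨abs_le_of_sq_le_sq ?_ h0, abs_le_of_sq_le_sq ?_ h0, abs_le_of_sq_le_sq ?_ h0⟩ <;>
    nlinarith [sq_nonneg (x 1), sq_nonneg (x 2), sq_nonneg (x 3)]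

/-- Bounded pieces of radial shells are compact. -/
lemma isCompact_shell (r₁ r₂ B : ℝ) : IsCompact {x : Pt | rad x ∈ Set.Icc r₁ r₂ ∧ |x 0| ≤ B} := by
  have hc : Continuous rad := by unfold rad; fun_prop
  refine Metric.isCompact_of_isClosed_isBounded ?_ ?_
  · exact (isClosed_Icc.preimage hc).inter (isClosed_le (continuous_apply (0 : Fin 4)).abs continuous_const)
  · refine (Metric.isBounded_closedBall (x := (0 : Pt)) (r := |r₂| + |B|)).subset ?_
    rintro x ⟨⟨-, hx⟩, hB⟩
    obtain ⟨h1, h2, h3⟩ := abs_coord_le_rad x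
    have hx' : rad x ≤ |r₂| + |B| := by linarith [le_abs_self r₂, abs_nonneg B]
    rw [mem_closedBall_zero_iff]
    refine (pi_norm_le_iff_of_nonneg (by positivity)).2 fun i => ?_
    rw [Real.norm_eq_abs]
    fin_cases i
    · exact hB.trans (by linarith [le_abs_self B, abs_nonneg r₂])
    · exact h1.trans hx'
    · exact h2.trans hx'
    · exact h3.trans hx'

section Maximal

variable {M a : ℝ} {γ : ℝ → Pt} {sm sp : EReal}

/-- While `t` stays bounded along a null geodesic, `r` stays in a compact subset of `]r₊, ∞[`. -/
lemma exists_shell_of_time_le (ha : 0 < |a|) (hM : |a| < M) {J : Set ℝ} (hJ : IsOpen J)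
    (hJ' : J.OrdConnected) (hg : IsGeodesicOn M a γ J)
    (hn : ∀ s ∈ J, IsNull M a (γ s) (deriv γ s)) {ε : ℝ} (hε : |ε| = 1)
    (hf : ∀ s ∈ J, 0 < ε * deriv γ s 0) {T s₀ : ℝ} (hs₀ : s₀ ∈ J)
    (hT : ∀ s ∈ J, ε * γ s 0 ≤ T) :
    ∃ r₁ r₂, rPlus M a < r₁ ∧ r₁ ≤ r₂ ∧ ∀ s ∈ J, s₀ ≤ s → rad (γ s) ∈ Set.Icc r₁ r₂ := by
  have hM0 : 0 < M := ha.trans hM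
  have hpos : ∀ s ∈ J, 0 < rad (γ s) - rPlus M a := fun s hs => sub_pos.2 (hg.1 s hs)
  have hτ : ∀ s ∈ J, HasDerivAt (fun s => ε * γ s 0) (ε * deriv γ s 0) s := fun s hs =>
    (hasDerivAt_pi.1 (hg.hasDerivAt hJ hs) 0).const_mul ε
  have hl : ∀ s ∈ J, HasDerivAt (fun s => Real.log (rad (γ s) - rPlus M a))
      (dr (γ s) (deriv γ s) / (rad (γ s) - rPlus M a)) s := fun s hs =>
    ((hasDerivAt_rad (hg.hasDerivAt hJ hs) (rad_pos_of_mem hM (hg.1 s hs))).sub_const _).log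
      (hpos s hs).ne'
  have hbd : ∀ s ∈ J, |dr (γ s) (deriv γ s) / (rad (γ s) - rPlus M a)|
      ≤ 2 / M * (ε * deriv γ s 0) := by
    intro s hs
    have h1 := abs_dr_le ha hM (hg.1 s hs) (hn s hs).2
    have h2 : |deriv γ s 0| = ε * deriv γ s 0 := by
      rw [← abs_of_pos (hf s hs), abs_mul, hε, one_mul]
    rw [h2] at h1
    rw [abs_div, abs_of_pos (hpos s hs), div_le_iff₀ (hpos s hs)]
    linarith
  -- Both `log (r - r₊) + (2 / M) ε t` and `-(log (r - r₊) - (2 / M) ε t)` increase, so `log (r -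
  -- r₊)` changes by at most `2 / M` times the change of `t`.
  have hmono := monotoneOn_of_hasDerivAt_nonneg hJ'
    (fun s hs => (hl s hs).fun_add ((hτ s hs).const_mul (2 / M)))
    (fun s hs => by linarith [(abs_le.1 (hbd s hs)).1])
  have hanti := antitoneOn_of_hasDerivAt_nonpos hJ'
    (fun s hs => (hl s hs).fun_sub ((hτ s hs).const_mul (2 / M)))
    (fun s hs => by linarith [(abs_le.1 (hbd s hs)).2])
  set l₀ := Real.log (rad (γ s₀) - rPlus M a) with hl₀
  set w := 2 / M * (T - ε * γ s₀ 0) with hw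
  have hw0 : 0 ≤ w := mul_nonneg (by positivity) (sub_nonneg.2 (hT s₀ hs₀))
  refine ⟨rPlus M a + Real.exp (l₀ - w), rPlus M a + Real.exp (l₀ + w),
    by linarith [Real.exp_pos (l₀ - w)], by gcongr; linarith, fun s hs hle => ?_⟩
  have h1 := hmono hs₀ hs hle
  have h2 := hanti hs₀ hs hle
  have h3 : 2 / M * (ε * γ s 0) ≤ 2 / M * T := mul_le_mul_of_nonneg_left (hT s hs) (by positivity)
  have h4 : Real.exp (Real.log (rad (γ s) - rPlus M a)) = rad (γ s) - rPlus M a :=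
    Real.exp_log (hpos s hs)
  simp only at h1 h2
  constructor
  · have : Real.exp (l₀ - w) ≤ Real.exp (Real.log (rad (γ s) - rPlus M a)) :=
      Real.exp_le_exp.2 (by rw [hw]; linarith)
    linarith
  · have : Real.exp (Real.log (rad (γ s) - rPlus M a)) ≤ Real.exp (l₀ + w) :=
      Real.exp_le_exp.2 (by rw [hw]; linarith)
    linarith

lemma IsMaximalNullGeodesic.exists_integrals (h : IsMaximalNullGeodesic M a γ sm sp)
    (hM : |a| < M) :
    ∃ E L K, Admissible a E L K ∧ ∀ s ∈ interval sm sp, energy M a (γ s) (deriv γ s) = E ∧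
      angMom M a (γ s) (deriv γ s) = L ∧ carterK M a (γ s) (deriv γ s) = K :=
  h.geodesic.exists_integrals hM (isOpen_interval _ _) (ordConnected_interval _ _)
    (nonempty_interval h.lt) h.null

/-- Along a maximal null geodesic on which `ε t` increases, `ε t` is unbounded above. -/
theorem IsMaximalNullGeodesic.exists_time_ge (h : IsMaximalNullGeodesic M a γ sm sp)
    (ha : 0 < |a|) (hM : |a| < M) {ε : ℝ} (hε : |ε| = 1)
    (hf : ∀ s ∈ interval sm sp, 0 < ε * deriv γ s 0) (T : ℝ) :
    ∃ s₁ ∈ interval sm sp, ∀ s ∈ interval sm sp, s₁ ≤ s → T ≤ ε * γ s 0 := by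
  have hJ := isOpen_interval sm sp
  have hJ' := ordConnected_interval sm sp
  have hτ : ∀ s ∈ interval sm sp, HasDerivAt (fun s => ε * γ s 0) (ε * deriv γ s 0) s :=
    fun s hs => (hasDerivAt_pi.1 (h.geodesic.hasDerivAt hJ hs) 0).const_mul ε
  have hτmono := monotoneOn_of_hasDerivAt_nonneg hJ' hτ fun s hs => (hf s hs).le
  by_contra! hcon
  have hT : ∀ s ∈ interval sm sp, ε * γ s 0 ≤ T := fun s hs => by
    obtain ⟨u, hu, hle, hlt⟩ := hcon s hs
    exact (hτmono hs hu hle).trans hlt.le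
  obtain ⟨s₀, hs₀⟩ := nonempty_interval h.lt
  obtain ⟨r₁, r₂, hr₁, hr₁₂, hr⟩ :=
    exists_shell_of_time_le ha hM hJ hJ' h.geodesic h.null hε hf hs₀ hT
  obtain ⟨E, L, K, hA, hELK⟩ := h.exists_integrals hM
  obtain ⟨c, hc0, hc⟩ := exists_le_time_component hM hA hr₁ hr₁₂
  obtain ⟨C, hC⟩ := exists_norm_le (a := a) hM E L K (r₂ := r₂) hr₁
  have habs : ∀ s ∈ interval sm sp, |deriv γ s 0| = ε * deriv γ s 0 := fun s hs => by
    rw [← abs_of_pos (hf s hs), abs_mul, hε, one_mul]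
  have hsub : Set.Ici s₀ ∩ interval sm sp ⊆ interval sm sp := Set.inter_subset_right
  -- As `ε t` grows at rate at least `c` and is bounded by `T`, the upper end of the parameter
  -- interval is finite.
  have hlin := monotoneOn_of_hasDerivAt_nonneg (Set.ordConnected_Ici.inter hJ')
    (fun s hs => (hτ s (hsub hs)).fun_sub ((hasDerivAt_id s).const_mul c)) fun s hs => by
      obtain ⟨e1, e2, e3⟩ := hELK s hs.2
      have := hc _ _ (hr s hs.2 hs.1) (h.null s hs.2).2 e1 e2 e3
      rw [habs s hs.2] at this
      linarith
  have hupper : ∀ s ∈ interval sm sp, s₀ ≤ s → s ≤ s₀ + (T - ε * γ s₀ 0) / c := by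
    intro s hs hle
    have h1 := hlin ⟨le_refl s₀, hs₀⟩ ⟨hle, hs⟩ hle
    simp only [id] at h1
    have h2 := hT s hs
    rw [← sub_le_iff_le_add', le_div_iff₀ hc0]
    linarith
  have hsp : sp ≤ ((s₀ + (T - ε * γ s₀ 0) / c : ℝ) : EReal) := by
    by_contra! hlt
    obtain ⟨u, hu1, hu2⟩ := EReal.lt_iff_exists_real_btwn.1 hlt
    have hu1 := EReal.coe_lt_coe_iff.1 hu1
    have hpos : 0 ≤ (T - ε * γ s₀ 0) / c := div_nonneg (sub_nonneg.2 (hT s₀ hs₀)) hc0.le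
    have := hupper u ⟨hs₀.1.trans (EReal.coe_lt_coe_iff.2 (by linarith)), hu2⟩ (by linarith)
    linarith
  obtain ⟨b, rfl⟩ : ∃ b : ℝ, sp = b := by
    have h1 : sp ≠ ⊤ := fun he => by rw [he] at hsp; exact (EReal.coe_lt_top _).not_ge hsp
    have h2 : sp ≠ ⊥ := fun he => by rw [he] at h; exact not_lt_bot h.lt
    exact ⟨sp.toReal, (EReal.coe_toReal h1 h2).symm⟩
  have hcompact := (isCompact_shell r₁ r₂ (|T| + |γ s₀ 0|)).prod
    (isCompact_closedBall (0 : Pt) C)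
  refine h.false_of_compact hM hs₀ hcompact
    (fun z hz => ⟨hr₁.trans_le hz.1.1.1, trivial⟩) fun s hs => ?_
  have hsJ : s ∈ interval sm b :=
    ⟨hs₀.1.trans (EReal.coe_lt_coe_iff.2 hs.1), EReal.coe_lt_coe_iff.2 hs.2⟩
  obtain ⟨e1, e2, e3⟩ := hELK s hsJ
  refine ⟨⟨hr s hsJ hs.1.le, ?_⟩, mem_closedBall_zero_iff.2
    (hC _ _ (hr s hsJ hs.1.le) (h.null s hsJ).2 e1 e2 e3)⟩
  have h1 : |γ s 0| = |ε * γ s 0| := by rw [abs_mul, hε, one_mul]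
  have h2 : |γ s₀ 0| = |ε * γ s₀ 0| := by rw [abs_mul, hε, one_mul]
  have h3 := hτmono hs₀ hsJ hs.1.le
  have h4 := hT s hsJ
  rw [h1, h2, abs_le]
  constructor
  · linarith [neg_abs_le (ε * γ s₀ 0), abs_nonneg T]
  · linarith [le_abs_self T, abs_nonneg (ε * γ s₀ 0)]

lemma eventually_futureEnd {s₁ : ℝ} (hs₁ : s₁ ∈ interval sm sp) :
    ∀ᶠ s in futureEnd sp, s ∈ interval sm sp ∧ s₁ ≤ s := by
  filter_upwards [preimage_mem_comap (Ioo_mem_nhdsLT hs₁.2)] with s hs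
  exact ⟨⟨hs₁.1.trans hs.1, hs.2⟩, (EReal.coe_lt_coe_iff.1 hs.1).le⟩

lemma eventually_pastEnd {s₁ : ℝ} (hs₁ : s₁ ∈ interval sm sp) :
    ∀ᶠ s in pastEnd sm, s ∈ interval sm sp ∧ s ≤ s₁ := by
  filter_upwards [preimage_mem_comap (Ioo_mem_nhdsGT hs₁.1)] with s hs
  exact ⟨⟨hs.1, hs.2.trans hs₁.2⟩, (EReal.coe_lt_coe_iff.1 hs.2).le⟩

lemma IsFutureNullGeodesic.exists_time_le (h : IsFutureNullGeodesic M a γ sm sp)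
    (ha : 0 < |a|) (hM : |a| < M) (T : ℝ) :
    ∃ s₁ ∈ interval sm sp, ∀ s ∈ interval sm sp, s ≤ s₁ → γ s 0 ≤ T := by
  -- Reversing the parameter exchanges the two ends; along the reversed geodesic `-t` increases,
  -- hence `ε = -1`.
  obtain ⟨s₁, hs₁, hT⟩ := h.isMaximal.comp_neg.exists_time_ge ha hM (ε := -1) (by simp)
    (fun s hs => by
      have : 0 < deriv γ (-s) 0 := h.future (-s) (neg_mem_interval.2 hs)
      simpa [deriv_comp_neg] using this) (-T)
  refine ⟨-s₁, neg_mem_interval.2 hs₁, fun s hs hle => ?_⟩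
  have := hT (-s) (neg_mem_interval.1 (by simpa using hs)) (by linarith)
  simp only [neg_neg] at this
  linarith

theorem IsFutureNullGeodesic.tendsto_time_futureEnd (h : IsFutureNullGeodesic M a γ sm sp)
    (ha : 0 < |a|) (hM : |a| < M) : Tendsto (fun s => γ s 0) (futureEnd sp) atTop := by
  refine tendsto_atTop.2 fun T => ?_
  obtain ⟨s₁, hs₁, hT⟩ := h.isMaximal.exists_time_ge ha hM (ε := 1) (by simp)
    (fun s hs => by rw [one_mul]; exact h.future s hs) T
  filter_upwards [eventually_futureEnd hs₁] with s hs
  simpa using hT s hs.1 hs.2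

theorem IsFutureNullGeodesic.tendsto_time_pastEnd (h : IsFutureNullGeodesic M a γ sm sp)
    (ha : 0 < |a|) (hM : |a| < M) : Tendsto (fun s => γ s 0) (pastEnd sm) atBot := by
  refine tendsto_atBot.2 fun T => ?_
  obtain ⟨s₁, hs₁, hT⟩ := h.exists_time_le ha hM T
  filter_upwards [eventually_pastEnd hs₁] with s hs using hT s hs.1 hs.2

theorem tendsto_tortoise (ha : 0 < |a|) (hM : |a| < M) :
    Tendsto (tortoise M a) (𝓝[≠] rPlus M a) atBot := by
  have hlt := rMinus_lt_rPlus hM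
  have hκ : 0 < 1 / (2 * kappaPlus M a) := by
    have h1 : 0 < rPlus M a := (rMinus_pos ha hM).trans hlt
    have h2 : 0 < rPlus M a - rMinus M a := by linarith
    rw [kappaPlus]
    positivity
  have hlog : Tendsto (fun r => Real.log |r - rPlus M a|) (𝓝[≠] rPlus M a) atBot := by
    simp only [Real.log_abs]
    refine Real.tendsto_log_nhdsNE_zero.comp (tendsto_nhdsWithin_iff.2 ⟨?_, ?_⟩)
    · have : ContinuousAt (fun r => r - rPlus M a) (rPlus M a) := by fun_prop
      have := this.tendsto
      rw [sub_self] at this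
      exact this.mono_left nhdsWithin_le_nhds
    · filter_upwards [self_mem_nhdsWithin] with r hr using sub_ne_zero.2 hr
  have hrest : ContinuousAt (fun r => r + 1 / (2 * kappaMinus M a) * Real.log |r - rMinus M a|)
      (rPlus M a) := by
    have h0 : |rPlus M a - rMinus M a| ≠ 0 := abs_ne_zero.2 (by linarith)
    exact continuousAt_id.add (continuousAt_const.mul
      (ContinuousAt.log (by fun_prop) h0))
  have := (hlog.const_mul_atBot hκ).atBot_add (hrest.tendsto.mono_left nhdsWithin_le_nhds)
  refine this.congr fun r => ?_
  rw [tortoise]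
  ring

theorem IsFutureNullGeodesic.tendsto_tStar_pastEnd (h : IsFutureNullGeodesic M a γ sm sp)
    (ha : 0 < |a|) (hM : |a| < M) (hs : StartsAtHorizon M a γ sm) :
    Tendsto (fun s => tStar M a (γ s)) (pastEnd sm) atBot := by
  obtain ⟨s₀, hs₀⟩ := nonempty_interval h.lt
  -- The tortoise coordinate diverges only on a punctured neighbourhood of `r₊`; the orbit never
  -- reaches `r₊` itself.
  have hne : Tendsto (fun s => rad (γ s)) (pastEnd sm) (𝓝[≠] rPlus M a) := by
    refine tendsto_nhdsWithin_iff.2 ⟨hs, ?_⟩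
    filter_upwards [eventually_pastEnd hs₀] with s hs
    exact ne_of_gt (h.geodesic.1 s hs.1)
  exact (h.tendsto_time_pastEnd ha hM).atBot_add_atBot ((tendsto_tortoise ha hM).comp hne)

end Maximal

end Kerr

namespace Kerr

/-! ### Geodesics which start neither at the horizon nor at infinity -/

/-- `f` tends to `l` at the lower end of `J`. -/
def TendsToAtLowerEnd (J : Set ℝ) (f : ℝ → ℝ) (l : ℝ) : Prop :=
  ∀ U ∈ 𝓝 l, ∃ s₁ ∈ J, ∀ s ∈ J, s ≤ s₁ → f s ∈ U

lemma TendsToAtLowerEnd.mem {J A : Set ℝ} {f : ℝ → ℝ} {l s₂ : ℝ} (h : TendsToAtLowerEnd J f l)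
    (hs₂ : s₂ ∈ J) (hA : IsClosed A)
    (hf : ∀ s ∈ J, s ≤ s₂ → f s ∈ A) : l ∈ A := by
  by_contra hl
  obtain ⟨s₁, hs₁, h1⟩ := h Aᶜ (hA.isOpen_compl.mem_nhds hl)
  have hmem : min s₁ s₂ ∈ J := by
    rcases min_choice s₁ s₂ with e | e <;> rw [e] <;> assumption
  exact h1 _ hmem (min_le_left _ _) (hf _ hmem (min_le_right _ _))

/-- A monotone function which is bounded below has a limit at the lower end. -/
lemma exists_tendsToAtLowerEnd {J : Set ℝ} {f : ℝ → ℝ} {s₂ m : ℝ} (hs₂ : s₂ ∈ J)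
    (hf : MonotoneOn f (J ∩ Set.Iic s₂)) (hm : ∀ s ∈ J, s ≤ s₂ → m ≤ f s) :
    ∃ l, m ≤ l ∧ (∀ s ∈ J, s ≤ s₂ → l ≤ f s) ∧ TendsToAtLowerEnd J f l := by
  have hne : (f '' (J ∩ Set.Iic s₂)).Nonempty := ⟨_, s₂, ⟨hs₂, le_refl s₂⟩, rfl⟩
  have hlow : ∀ y ∈ f '' (J ∩ Set.Iic s₂), m ≤ y := by
    rintro y ⟨s, hs, rfl⟩
    exact hm s hs.1 hs.2
  have hbdd : BddBelow (f '' (J ∩ Set.Iic s₂)) := ⟨m, hlow⟩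
  have hle : ∀ s ∈ J, s ≤ s₂ → sInf (f '' (J ∩ Set.Iic s₂)) ≤ f s := fun s hs hs' =>
    csInf_le hbdd ⟨s, ⟨hs, hs'⟩, rfl⟩
  refine ⟨sInf (f '' (J ∩ Set.Iic s₂)), le_csInf hne hlow, hle, fun U hU => ?_⟩
  obtain ⟨δ, hδ, hball⟩ := Metric.mem_nhds_iff.1 hU
  obtain ⟨_, ⟨s₁, hs₁, rfl⟩, hlt⟩ := exists_lt_of_csInf_lt hne (lt_add_of_pos_right _ hδ)
  refine ⟨s₁, hs₁.1, fun s hs hss => hball ?_⟩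
  have h1 := hle s hs (hss.trans hs₁.2)
  have h2 := hf ⟨hs, hss.trans hs₁.2⟩ hs₁ hss
  rw [Metric.mem_ball, Real.dist_eq, abs_lt]
  constructor <;> linarith

section Orbit

variable {M a : ℝ} {γ : ℝ → Pt} {sm sp : EReal}

lemma TendsToAtLowerEnd.tendsto_pastEnd {f : ℝ → ℝ} {l : ℝ}
    (h : TendsToAtLowerEnd (interval sm sp) f l) : Tendsto f (pastEnd sm) (𝓝 l) := fun U hU => by
  obtain ⟨s₁, hs₁, h1⟩ := h U hU
  change ∀ᶠ s in pastEnd sm, f s ∈ U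
  filter_upwards [eventually_pastEnd hs₁] with s hs using h1 s hs.1 hs.2

/-- The radial motion cannot converge to a point of the exterior which is not a double zero of the
radial potential. -/
lemma IsFutureNullGeodesic.false_of_tendsTo (h : IsFutureNullGeodesic M a γ sm sp)
    (ha : 0 < |a|) (hM : |a| < M) {E L K : ℝ}
    (hELK : ∀ s ∈ interval sm sp, energy M a (γ s) (deriv γ s) = E ∧
      angMom M a (γ s) (deriv γ s) = L ∧ carterK M a (γ s) (deriv γ s) = K)
    {r₁ r₂ l s₂ η : ℝ} (hs₂ : s₂ ∈ interval sm sp) (hr₁ : rPlus M a < r₁)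
    (hr : ∀ s ∈ interval sm sp, s ≤ s₂ → rad (γ s) ∈ Set.Icc r₁ r₂)
    (hl : TendsToAtLowerEnd (interval sm sp) (fun s => rad (γ s)) l)
    (hη : |η| = 1)
    (hsign : ∀ s ∈ interval sm sp, s ≤ s₂ → 0 ≤ η * radialMomentum a (γ s) (deriv γ s))
    (hslope : 0 ≤ (l ^ 2 + a ^ 2) * E - a * L →
      ((l ^ 2 + a ^ 2) * E - a * L) ^ 2 = Delta M a l * K → radialSlope M a E L K l ≠ 0) :
    False := by
  have hJ := isOpen_interval sm sp
  have hJ' := ordConnected_interval sm sp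
  have hr₁0 : 0 < r₁ := by linarith [lt_rPlus hM, abs_nonneg a]
  have hr₁₂ : r₁ ≤ r₂ := (hr s₂ hs₂ le_rfl).1.trans (hr s₂ hs₂ le_rfl).2
  have hposE := fun s hs => rad_pos_of_mem hM (h.geodesic.1 s hs)
  have hΔE := fun s hs => Delta_pos_of_mem hM (h.geodesic.1 s hs)
  -- the parameter interval is unbounded below
  obtain ⟨C, hC⟩ := exists_norm_le (a := a) hM E L K (r₂ := r₂) hr₁
  have hbot : sm = ⊥ := by
    by_contra hne
    have htop : sm ≠ ⊤ := fun he => by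
      have := h.lt
      rw [he] at this
      exact not_top_lt this
    obtain ⟨m, hm⟩ : ∃ m : ℝ, sm = m := ⟨sm.toReal, (EReal.coe_toReal htop hne).symm⟩
    have hC0 : 0 ≤ C := by
      obtain ⟨e1, e2, e3⟩ := hELK s₂ hs₂
      exact (norm_nonneg _).trans (hC _ _ (hr s₂ hs₂ le_rfl) (h.null s₂ hs₂).2 e1 e2 e3)
    -- On the shell `t' ≤ C`, so over a parameter range shorter than `s₂ - m` the time can drop by
    -- at most `C (s₂ - m)`, whereas `t → -∞`.
    obtain ⟨s₁, hs₁, hT⟩ := h.exists_time_le ha hM (γ s₂ 0 - C * (s₂ - m) - 1)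
    have hmono := monotoneOn_of_hasDerivAt_nonneg (hJ'.inter (Set.ordConnected_Iic (a := s₂)))
      (fun s hs => ((hasDerivAt_id s).const_mul C).fun_sub
        (hasDerivAt_pi.1 (h.geodesic.hasDerivAt hJ hs.1) 0)) fun s hs => by
        obtain ⟨e1, e2, e3⟩ := hELK s hs.1
        have h1 := hC _ _ (hr s hs.1 hs.2) (h.null s hs.1).2 e1 e2 e3
        have h2 := (norm_le_pi_norm (deriv γ s) 0).trans h1
        have h3 := (le_abs_self _).trans h2
        linarith
    have hmem : min s₁ s₂ ∈ interval sm sp := by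
      rcases min_choice s₁ s₂ with e | e <;> rw [e] <;> assumption
    have h1 := hmono ⟨hmem, (min_le_right _ _ : min s₁ s₂ ≤ s₂)⟩ ⟨hs₂, le_refl s₂⟩ (min_le_right _ _)
    have h2 := hT _ hmem (min_le_left _ _)
    have h3 : m < min s₁ s₂ := EReal.coe_lt_coe_iff.1 (hm ▸ hmem.1)
    have h4 : C * m ≤ C * min s₁ s₂ := by gcongr
    simp only [id] at h1
    linarith
  have hIic : ∀ s, s ≤ s₂ → s ∈ interval sm sp := fun s hs =>
    ⟨by rw [hbot]; exact EReal.bot_lt_coe s, (EReal.coe_le_coe_iff.2 hs).trans_lt hs₂.2⟩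
  -- the radial equations
  have hW : ∀ s ∈ interval sm sp, HasDerivAt (fun s => radialMomentum a (γ s) (deriv γ s))
      (radialSlope M a E L K (rad (γ s)) / (2 * rhoSq a (γ s))) s := fun s hs => by
    obtain ⟨e1, e2, e3⟩ := hELK s hs
    have := h.geodesic.hasDerivAt_radialMomentum hM hJ hs (h.null s hs).2
    rwa [e1, e2, e3] at this
  have hW2 : ∀ s ∈ interval sm sp, radialMomentum a (γ s) (deriv γ s) ^ 2
      = ((rad (γ s) ^ 2 + a ^ 2) * E - a * L) ^ 2 - Delta M a (rad (γ s)) * K := fun s hs => by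
    obtain ⟨e1, e2, e3⟩ := hELK s hs
    rw [radialMomentum_sq (hposE s hs) (hΔE s hs).ne' (h.null s hs).2, e1, e2, e3]
  have hrad : ∀ s ∈ interval sm sp, HasDerivAt (fun s => rad (γ s))
      (radialMomentum a (γ s) (deriv γ s) / rhoSq a (γ s)) s := fun s hs => by
    refine (hasDerivAt_rad (h.geodesic.hasDerivAt hJ hs) (hposE s hs)).congr_deriv ?_
    rw [radialMomentum, mul_div_cancel_left₀ _ (rhoSq_pos a (hposE s hs)).ne']
  have hcP : Continuous fun r : ℝ => (r ^ 2 + a ^ 2) * E - a * L := by fun_prop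
  have hcR : Continuous fun r : ℝ => ((r ^ 2 + a ^ 2) * E - a * L) ^ 2 - Delta M a r * K := by
    unfold Delta; fun_prop
  have hcS : Continuous (radialSlope M a E L K) := by unfold radialSlope; fun_prop
  have hPl : 0 ≤ (l ^ 2 + a ^ 2) * E - a * L :=
    hl.mem hs₂ (isClosed_le continuous_const hcP) fun s hs _ => by
      obtain ⟨e1, e2, e3⟩ := hELK s hs
      have := radialP_nonneg_of_future hM (h.geodesic.1 s hs) (h.null s hs).2 (h.future s hs)
      rwa [e1, e2] at this
  have hRl : 0 ≤ ((l ^ 2 + a ^ 2) * E - a * L) ^ 2 - Delta M a l * K :=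
    hl.mem hs₂ (isClosed_le continuous_const hcR) fun s hs _ => by
      have := hW2 s hs
      change 0 ≤ ((rad (γ s) ^ 2 + a ^ 2) * E - a * L) ^ 2 - Delta M a (rad (γ s)) * K
      rw [← this]
      positivity
  set N := r₂ ^ 2 + a ^ 2 with hN
  have hN0 : 0 < N := by
    have : 0 < r₂ := by linarith
    positivity
  have hρN : ∀ s, s ≤ s₂ → 0 < rhoSq a (γ s) ∧ rhoSq a (γ s) ≤ N := fun s hs =>
    ⟨rhoSq_pos a (hposE s (hIic s hs)),
      (shell_le hM hr₁ (hr s (hIic s hs) hs).1 (hr s (hIic s hs) hs).2).2.2.2⟩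
  have hηη : η * η = 1 := by rw [← abs_mul_abs_self, hη, one_mul]
  rcases hRl.eq_or_lt with hR | hR
  -- Case `R(l) = 0`: the slope at `l` is nonzero, so `(ρ² r')'` is bounded away from zero with a
  -- fixed sign on an infinite parameter range, although `(ρ² r')² = R(r)` stays below `1`.
  · have hne := hslope hPl (by linarith)
    obtain ⟨ζ, hζ, hζpos⟩ : ∃ ζ : ℝ, |ζ| = 1 ∧ 0 < ζ * radialSlope M a E L K l := by
      rcases hne.lt_or_gt with hlt | hgt
      · exact ⟨-1, by simp, by linarith⟩
      · exact ⟨1, by simp, by linarith⟩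
    set κ := ζ * radialSlope M a E L K l with hκ
    have hU1 : ∀ᶠ r in 𝓝 l, κ / 2 < ζ * radialSlope M a E L K r :=
      (hcS.const_smul ζ).continuousAt.eventually (lt_mem_nhds (half_lt_self hζpos))
    have hU2 : ∀ᶠ r in 𝓝 l, ((r ^ 2 + a ^ 2) * E - a * L) ^ 2 - Delta M a r * K < 1 :=
      hcR.continuousAt.eventually (gt_mem_nhds (by simpa only [← hR] using zero_lt_one))
    obtain ⟨s₁, -, hs₁⟩ := hl _ (hU1.and hU2)
    have hlow : ∀ s < min s₁ s₂, s ∈ interval sm sp ∧ s ≤ s₁ ∧ s ≤ s₂ := fun s hs =>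
      ⟨hIic s (hs.le.trans (min_le_right _ _)), hs.le.trans (min_le_left _ _),
        hs.le.trans (min_le_right _ _)⟩
    refine not_bounded_of_deriv_ge (s₁ := min s₁ s₂) (c := κ / 2 / (2 * N)) (B := 1)
      (by positivity) (fun s hs => (hW s (hlow s hs).1).const_mul ζ) (fun s hs => ?_)
      fun s hs => ?_
    · obtain ⟨hsJ, hs1, hs2⟩ := hlow s hs
      have h1 : κ / 2 < ζ * radialSlope M a E L K (rad (γ s)) := (hs₁ s hsJ hs1).1
      obtain ⟨h2, h3⟩ := hρN s hs2
      have h4 : 0 ≤ ζ * radialSlope M a E L K (rad (γ s)) := (half_pos hζpos).le.trans h1.le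
      rw [← mul_div_assoc]
      gcongr
    · obtain ⟨hsJ, hs1, hs2⟩ := hlow s hs
      have h1 : ((rad (γ s) ^ 2 + a ^ 2) * E - a * L) ^ 2 - Delta M a (rad (γ s)) * K < 1 :=
        (hs₁ s hsJ hs1).2
      rw [abs_mul, hζ, one_mul]
      refine abs_le_of_sq_le_sq ?_ zero_le_one
      rw [hW2 s hsJ]
      linarith
  -- Case `R(l) > 0`: `|r'|` is bounded away from zero with a fixed sign on an infinite parameter
  -- range, although `r ≤ r₂`.
  · set R₀ := ((l ^ 2 + a ^ 2) * E - a * L) ^ 2 - Delta M a l * K with hR₀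
    have hU : ∀ᶠ r in 𝓝 l, R₀ / 2 < ((r ^ 2 + a ^ 2) * E - a * L) ^ 2 - Delta M a r * K :=
      hcR.continuousAt.eventually (lt_mem_nhds (half_lt_self hR))
    obtain ⟨s₁, -, hs₁⟩ := hl _ hU
    have hlow : ∀ s < min s₁ s₂, s ∈ interval sm sp ∧ s ≤ s₁ ∧ s ≤ s₂ := fun s hs =>
      ⟨hIic s (hs.le.trans (min_le_right _ _)), hs.le.trans (min_le_left _ _),
        hs.le.trans (min_le_right _ _)⟩
    refine not_bounded_of_deriv_ge (s₁ := min s₁ s₂) (c := √(R₀ / 2) / N) (B := r₂)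
      (by positivity) (fun s hs => (hrad s (hlow s hs).1).const_mul η) (fun s hs => ?_)
      fun s hs => ?_
    · obtain ⟨hsJ, hs1, hs2⟩ := hlow s hs
      have h1 : R₀ / 2 < ((rad (γ s) ^ 2 + a ^ 2) * E - a * L) ^ 2 - Delta M a (rad (γ s)) * K :=
        hs₁ s hsJ hs1
      obtain ⟨h2, h3⟩ := hρN s hs2
      have h4 := hsign s hsJ hs2
      have h5 : √(R₀ / 2) ≤ η * radialMomentum a (γ s) (deriv γ s) := by
        refine Real.sqrt_le_iff.2 ⟨h4, ?_⟩
        have e : (η * radialMomentum a (γ s) (deriv γ s)) ^ 2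
            = η * η * radialMomentum a (γ s) (deriv γ s) ^ 2 := by ring
        rw [e, hηη, hW2 s hsJ]
        linarith
      rw [← mul_div_assoc]
      gcongr
    · obtain ⟨hsJ, hs1, hs2⟩ := hlow s hs
      rw [abs_mul, hη, one_mul, abs_of_pos (hposE s hsJ)]
      exact (hr s hsJ hs2).2

/-- If all turning points of the radial motion in a closed set containing the orbit are of the same
type, then the geodesic starts at the horizon or at infinity. -/
theorem IsFutureNullGeodesic.startsAt (h : IsFutureNullGeodesic M a γ sm sp)
    (ha : 0 < |a|) (hM : |a| < M) {E L K : ℝ}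
    (hELK : ∀ s ∈ interval sm sp, energy M a (γ s) (deriv γ s) = E ∧
      angMom M a (γ s) (deriv γ s) = L ∧ carterK M a (γ s) (deriv γ s) = K)
    {Z : Set ℝ} (hZ : IsClosed Z) (hγZ : ∀ s ∈ interval sm sp, rad (γ s) ∈ Z) {ζ : ℝ}
    (hslope : ∀ r ∈ Z, rPlus M a < r → 0 ≤ (r ^ 2 + a ^ 2) * E - a * L →
      ((r ^ 2 + a ^ 2) * E - a * L) ^ 2 = Delta M a r * K → ζ * radialSlope M a E L K r < 0) :
    StartsAtHorizon M a γ sm ∨ StartsAtInfinity γ sm := by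
  have hJ := isOpen_interval sm sp
  have hJ' := ordConnected_interval sm sp
  have hposE := fun s hs => rad_pos_of_mem hM (h.geodesic.1 s hs)
  have hΔE := fun s hs => Delta_pos_of_mem hM (h.geodesic.1 s hs)
  have hρE := fun s hs => rhoSq_pos a (hposE s hs)
  set W : ℝ → ℝ := fun s => radialMomentum a (γ s) (deriv γ s) with hWdef
  have hW : ∀ s ∈ interval sm sp, HasDerivAt W
      (radialSlope M a E L K (rad (γ s)) / (2 * rhoSq a (γ s))) s := fun s hs => by
    obtain ⟨e1, e2, e3⟩ := hELK s hs
    have := h.geodesic.hasDerivAt_radialMomentum hM hJ hs (h.null s hs).2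
    rwa [e1, e2, e3] at this
  have hrad : ∀ s ∈ interval sm sp, HasDerivAt (fun s => rad (γ s))
      (W s / rhoSq a (γ s)) s := fun s hs => by
    refine (hasDerivAt_rad (h.geodesic.hasDerivAt hJ hs) (hposE s hs)).congr_deriv ?_
    simp only [hWdef, radialMomentum]
    rw [mul_div_cancel_left₀ _ (hρE s hs).ne']
  have hzero : ∀ s ∈ interval sm sp, W s = 0 →
      ζ * (radialSlope M a E L K (rad (γ s)) / (2 * rhoSq a (γ s))) < 0 := fun s hs h0 => by
    obtain ⟨e1, e2, e3⟩ := hELK s hs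
    have hP := radialP_nonneg_of_future hM (h.geodesic.1 s hs) (h.null s hs).2 (h.future s hs)
    have hR := radialMomentum_sq (hposE s hs) (hΔE s hs).ne' (h.null s hs).2
    have h0' : radialMomentum a (γ s) (deriv γ s) = 0 := h0
    rw [h0', e1, e2, e3] at hR
    rw [e1, e2] at hP
    rw [← mul_div_assoc]
    exact div_neg_of_neg_of_pos (hslope _ (hγZ s hs) (h.geodesic.1 s hs) hP (by linarith))
      (mul_pos two_pos (hρE s hs))
  have hζ : ∀ s ∈ interval sm sp, W s = 0 → ζ ≠ 0 := fun s hs h0 hz => by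
    have := hzero s hs h0
    rw [hz, zero_mul] at this
    exact lt_irrefl _ this
  -- At each zero of `ζ ρ² r'` the derivative is negative, because all turning points are of one
  -- type; so there is at most one.
  have huniq : ∀ u ∈ interval sm sp, ∀ w ∈ interval sm sp, u < w → W u = 0 → W w ≠ 0 := by
    intro u hu w hw huw hu0 hw0
    have hsub : Set.Icc u w ⊆ interval sm sp := hJ'.out hu hw
    refine eq_zero_unique_of_deriv_neg huw (fun s hs => (hW s (hsub hs)).const_mul ζ)
      (fun s hs hs0 => hzero s (hsub hs) ?_) (by rw [hu0, mul_zero]) (by rw [hw0, mul_zero])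
    exact (mul_eq_zero.1 hs0).resolve_left (hζ u hu hu0)
  obtain ⟨s₁, hs₁, hsgn⟩ := exists_sign_of_eq_zero_unique hJ' (nonempty_interval h.lt)
    (fun s hs => (hW s hs).continuousAt.continuousWithinAt) huniq
  -- Moving strictly below `s₁` gives `ρ² r'` a strict sign on the whole closed initial piece `s ≤
  -- s₂`.
  obtain ⟨s₂, hs₂, hs₂₁⟩ : ∃ s₂ ∈ interval sm sp, s₂ < s₁ := by
    obtain ⟨s₂, h1, h2⟩ := EReal.lt_iff_exists_real_btwn.1 hs₁.1
    exact ⟨s₂, ⟨h1, h2.trans hs₁.2⟩, EReal.coe_lt_coe_iff.1 h2⟩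
  have hconn : (interval sm sp ∩ Set.Iic s₂).OrdConnected := hJ'.inter Set.ordConnected_Iic
  have hlimit {l : ℝ} (hl : TendsToAtLowerEnd (interval sm sp) (fun s => rad (γ s)) l)
      (hlr : rPlus M a < l) : 0 ≤ (l ^ 2 + a ^ 2) * E - a * L →
      ((l ^ 2 + a ^ 2) * E - a * L) ^ 2 = Delta M a l * K → radialSlope M a E L K l ≠ 0 := by
    intro h1 h2 h3
    have := hslope l (hl.mem hs₂ hZ fun s hs _ => hγZ s hs) hlr h1 h2
    rw [h3, mul_zero] at this
    exact lt_irrefl _ this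
  rcases hsgn with hpos | hneg
  · have hmono : MonotoneOn (fun s => rad (γ s)) (interval sm sp ∩ Set.Iic s₂) :=
      monotoneOn_of_hasDerivAt_nonneg hconn (fun s hs => hrad s hs.1) fun s hs =>
        div_nonneg (hpos s hs.1 (hs.2.trans_lt hs₂₁)).le (hρE s hs.1).le
    obtain ⟨l, hl1, hl2, hl3⟩ := exists_tendsToAtLowerEnd hs₂ hmono
      (fun s hs _ => (h.geodesic.1 s hs : rPlus M a < rad (γ s)).le)
    left
    rcases hl1.eq_or_lt with he | hlt
    · rw [StartsAtHorizon, he]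
      exact hl3.tendsto_pastEnd
    · exact (h.false_of_tendsTo ha hM hELK (r₂ := rad (γ s₂)) (η := 1) hs₂ hlt
        (fun s hs hle => ⟨hl2 s hs hle, hmono ⟨hs, hle⟩ ⟨hs₂, le_refl s₂⟩ hle⟩) hl3 (by simp)
        (fun s hs hle => by
          rw [one_mul]; exact (hpos s hs (hle.trans_lt hs₂₁)).le) (hlimit hl3 hlt)).elim
  · have hanti : AntitoneOn (fun s => rad (γ s)) (interval sm sp ∩ Set.Iic s₂) :=
      antitoneOn_of_hasDerivAt_nonpos hconn (fun s hs => hrad s hs.1) fun s hs =>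
        div_nonpos_of_nonpos_of_nonneg (hneg s hs.1 (hs.2.trans_lt hs₂₁)).le (hρE s hs.1).le
    right
    -- Going backwards `r` increases: it either converges to a finite radius, which is excluded, or
    -- is unbounded and then tends to infinity by monotonicity.
    by_cases hbd : ∃ B, ∀ s ∈ interval sm sp, s ≤ s₂ → rad (γ s) ≤ B
    · obtain ⟨B, hB⟩ := hbd
      obtain ⟨l, hl1, hl2, hl3⟩ := exists_tendsToAtLowerEnd (f := fun s => -rad (γ s)) (m := -B)
        hs₂ hanti.neg (fun s hs hle => neg_le_neg (hB s hs hle))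
      have hl3' : TendsToAtLowerEnd (interval sm sp) (fun s => rad (γ s)) (-l) := fun U hU => by
        obtain ⟨s₃, hs₃, h3⟩ := hl3 (Neg.neg ⁻¹' U)
          (continuous_neg.continuousAt.preimage_mem_nhds hU)
        exact ⟨s₃, hs₃, fun s hs hle => by simpa using h3 s hs hle⟩
      have hlow : ∀ s ∈ interval sm sp, s ≤ s₂ → rad (γ s₂) ≤ rad (γ s) := fun s hs hle =>
        hanti ⟨hs, hle⟩ ⟨hs₂, le_refl s₂⟩ hle
      have hlt : rPlus M a < -l := by
        have h1 : rPlus M a < rad (γ s₂) := h.geodesic.1 s₂ hs₂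
        have h2 : -l ∈ Set.Ici (rad (γ s₂)) := hl3'.mem hs₂ isClosed_Ici hlow
        exact h1.trans_le h2
      exact (h.false_of_tendsTo ha hM hELK (r₂ := -l) (η := -1) hs₂ (h.geodesic.1 s₂ hs₂)
        (fun s hs hle => ⟨hlow s hs hle, by have := hl2 s hs hle; linarith⟩) hl3' (by simp)
        (fun s hs hle => by
          have : W s < 0 := hneg s hs (hle.trans_lt hs₂₁)
          linarith) (hlimit hl3' hlt)).elim
    · push Not at hbd
      refine tendsto_atTop.2 fun B => ?_
      obtain ⟨s₃, hs₃, hle₃, hB⟩ := hbd B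
      filter_upwards [eventually_pastEnd hs₃] with s hs
      exact hB.le.trans (hanti ⟨hs.1, hs.2.trans hle₃⟩ ⟨hs₃, hle₃⟩ hs.2)

/-- For slow rotation, a geodesic starting neither at the horizon nor at infinity crosses the
region where both Killing fields are timelike. -/
theorem IsFutureNullGeodesic.exists_eventually_isTimelike (h : IsFutureNullGeodesic M a γ sm sp)
    (ha : 0 < |a|) (hM : 100 * |a| ≤ M) (h1 : ¬ StartsAtHorizon M a γ sm)
    (h2 : ¬ StartsAtInfinity γ sm) :
    ∃ s ∈ interval sm sp, ∀ᶠ x in 𝓝 (γ s), IsTimelike M a x (vH M a x) ∧ IsTimelike M a x vI := by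
  have hM' : |a| < M := by linarith
  by_contra hcon
  have hJ' := ordConnected_interval sm sp
  have hout : ∀ s ∈ interval sm sp, 29 / 10 * M < rad (γ s) → 31 / 10 * M ≤ rad (γ s) := by
    intro s hs h3
    by_contra! h4
    exact hcon ⟨s, hs, eventually_isTimelike ha hM h3 h4⟩
  obtain ⟨E, L, K, hA, hELK⟩ := h.isMaximal.exists_integrals hM'
  by_cases hin : ∀ s ∈ interval sm sp, rad (γ s) ≤ 29 / 10 * M
  · rcases h.startsAt ha hM' hELK (Z := Set.Iic (29 / 10 * M)) (ζ := 1) isClosed_Iic hin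
      (fun r hr hrp hP hR => by
        rw [one_mul]
        have hr : r ≤ 29 / 10 * M := hr
        exact radialSlope_neg hA ha hM' hrp (by linarith) hP hR) with h3 | h3
    exacts [h1 h3, h2 h3]
  · push Not at hin
    obtain ⟨u, hu, hu'⟩ := hin
    -- An orbit with points on both sides of the forbidden band would cross `r = 3M` by continuity.
    have hall : ∀ s ∈ interval sm sp, 31 / 10 * M ≤ rad (γ s) := by
      intro s hs
      by_contra! hlt
      have hlt' : rad (γ s) ≤ 29 / 10 * M := by
        by_contra! h3
        exact absurd (hout s hs h3) (not_le.2 hlt)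
      have hsub : Set.uIcc s u ⊆ interval sm sp := hJ'.uIcc_subset hs hu
      have hcont : ContinuousOn (fun s => rad (γ s)) (Set.uIcc s u) := fun w hw =>
        (hasDerivAt_rad (h.geodesic.hasDerivAt (isOpen_interval _ _) (hsub hw))
          (rad_pos_of_mem hM' (h.geodesic.1 w (hsub hw)))).continuousAt.continuousWithinAt
      have hMpos : 0 < M := ha.trans hM'
      obtain ⟨w, hw, hwr⟩ := intermediate_value_uIcc hcont (Set.mem_uIcc.2
        (.inl ⟨by linarith, by linarith [hout u hu hu']⟩ :
          rad (γ s) ≤ 3 * M ∧ 3 * M ≤ rad (γ u) ∨ rad (γ u) ≤ 3 * M ∧ 3 * M ≤ rad (γ s)))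
      simp only at hwr
      have := hout w (hsub hw) (by linarith)
      linarith
    rcases h.startsAt ha hM' hELK (Z := Set.Ici (31 / 10 * M)) (ζ := -1) isClosed_Ici hall
      (fun r hr hrp hP hR => by
        have hr : 31 / 10 * M ≤ r := hr
        have := (radialSlope_pos hA ha hM' (by linarith) hP hR).2
        linarith) with h3 | h3
    exacts [h1 h3, h2 h3]

end Orbit

end Kerr

/-! ### Assembly of the five statements -/

theorem mainTheorem8 :
    -- behaviour of `t` and `t*` at the ends, for all subextremal parameters
    (∀ M a : ℝ, 0 < |a| → |a| < M →
      ∀ (γ : ℝ → Kerr.Pt) (sm sp : EReal), Kerr.IsFutureNullGeodesic M a γ sm sp →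
        Filter.Tendsto (fun s => γ s 0) (Kerr.futureEnd sp) Filter.atTop ∧
        Filter.Tendsto (fun s => γ s 0) (Kerr.pastEnd sm) Filter.atBot ∧
        (Kerr.StartsAtHorizon M a γ sm →
          Filter.Tendsto (fun s => Kerr.tStar M a (γ s)) (Kerr.pastEnd sm) Filter.atBot)) ∧
    -- for slow rotation, geodesics starting neither at `r₊` nor at infinity cross the region
    -- where both Killing fields are timelike
    (∃ a₀ : ℝ, 0 < a₀ ∧ a₀ ≤ 1 ∧ ∀ M a : ℝ, 0 < M → 0 < |a| → |a| / M < a₀ →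
      ∀ (γ : ℝ → Kerr.Pt) (sm sp : EReal), Kerr.IsFutureNullGeodesic M a γ sm sp →
        ¬ Kerr.StartsAtHorizon M a γ sm → ¬ Kerr.StartsAtInfinity γ sm →
        ∃ s ∈ Kerr.interval sm sp, ∀ᶠ x in nhds (γ s),
          Kerr.IsTimelike M a x (Kerr.vH M a x) ∧ Kerr.IsTimelike M a x Kerr.vI) ∧
    -- no double zeros of `R` between the horizons
    (∀ M a : ℝ, 0 < |a| → |a| < M → ∀ E L Q : ℝ, Kerr.AreNullIntegrals M a E L Q →
      ∀ r : ℝ, Kerr.rMinus M a < r → r < Kerr.rPlus M a →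
        ¬ Kerr.IsDoubleZero M a E L Q r) ∧
    -- location of the double zeros of `R` for slow rotation
    (∃ a₀ C : ℝ, 0 < a₀ ∧ a₀ < 1 ∧ 0 < C ∧ ∀ M a : ℝ, 0 < M → 0 < |a| → |a| / M ≤ a₀ →
      ∀ E L Q : ℝ, Kerr.AreNullIntegrals M a E L Q → E ≠ 0 →
      ∀ r : ℝ, Kerr.rMinus M a ≤ r → Kerr.IsDoubleZero M a E L Q r →
        r ∈ Set.Icc (3 * M - C * |a|) (3 * M + C * |a|) ∧
        |L / E| ≤ C * M ∧ |Q / E ^ 2| ≤ C * M ^ 2) ∧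
    -- for slow rotation, both Killing fields are future directed timelike at the double zeros
    (∃ a₁ : ℝ, 0 < a₁ ∧ a₁ ≤ 1 ∧ ∀ M a : ℝ, 0 < M → 0 < |a| → |a| / M < a₁ →
      ∀ E L Q : ℝ, Kerr.AreNullIntegrals M a E L Q →
      ∀ x : Kerr.Pt, Kerr.rPlus M a ≤ Kerr.rad x → Kerr.IsDoubleZero M a E L Q (Kerr.rad x) →
        x ∈ Kerr.exterior M a ∧
        (Kerr.IsTimelike M a x (Kerr.vH M a x) ∧ Kerr.IsFutureDirected (Kerr.vH M a x)) ∧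
        (Kerr.IsTimelike M a x Kerr.vI ∧ Kerr.IsFutureDirected Kerr.vI)) := by
  have key : ∀ {M a : ℝ}, 0 < M → |a| / M < 1 / 100 → 100 * |a| ≤ M := by
    intro M a hM h
    rw [div_lt_iff₀ hM] at h
    linarith
  refine ⟨fun M a ha hM γ sm sp h => ⟨h.tendsto_time_futureEnd ha hM, h.tendsto_time_pastEnd ha hM,
    h.tendsto_tStar_pastEnd ha hM⟩, ⟨1 / 100, by norm_num, by norm_num, ?_⟩, ?_,
    -- This threshold is non-strict, so `1 / 200` is taken in order that it imply the strict bound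
    -- `1 / 100`.
    ⟨1 / 200, 500, by norm_num, by norm_num, by norm_num, ?_⟩,
    ⟨1 / 100, by norm_num, by norm_num, ?_⟩⟩
  · intro M a hM ha haM γ sm sp h h1 h2
    exact h.exists_eventually_isTimelike ha (key hM haM) h1 h2
  · intro M a ha hM E L Q h r h1 h2
    exact Kerr.not_isDoubleZero_between ha hM h h1 h2
  · intro M a hM ha haM E L Q h hE r h1 hd
    exact Kerr.isDoubleZero_location ha (key hM (by linarith)) h hE h1 hd
  · intro M a hM ha haM E L Q h x h1 hd
    exact Kerr.isTimelike_of_isDoubleZero ha (key hM haM) h h1 hd
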